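/- For $n\ge 0$ let $\Gamma(n)$ be the semigroup of partial bijections of $\{1,\dots,n\}$ (bijections between two subsets of $\{1,\dots,n\}$), where $\gamma_1\gamma_2$ is defined at $x$ iff $\gamma_2$ is defined at $x$ and $\gamma_1$ is defined at $\gamma_2(x)$, and then $(\gamma_1\gamma_2)(x)=\gamma_1(\gamma_2(x))$. Let $A(n)=\mathbb C[\Gamma(n)]$ be its semigroup algebra. Write $\varepsilon_i\in\Gamma(n)$ for the identity bijection of $\{1,\dots,n\}\setminus\{i\}$ and $(i\,j)$ for transpositions. For $m\le n$ regard $A(m)$ as a subalgebra of $A(n)$ by letting a partial bijection of $\{1,\dots,m\}$ fix $m+1,\dots,n$. Let $\deg\gamma$ be the number of $i\in\{1,\dots,n\}$ for which it is not the case that $\gamma$ is defined at $i$ with $\gamma(i)=i$; for $a=\sum_\gamma a_\gamma\gamma\in A(n)$ put $\deg a=\max\{\deg\gamma : a_\gamma\ne 0\}$ (and $\deg 0=0$). Let $\theta_n:A(n)\to A(n-1)$ be the linear map sending $\gamma\in\Gamma(n)$ to the partial bijection of $\{1,\dots,n-1\}$ defined at those $y\le n-1$ at which $\gamma$ is defined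 with $\gamma(y)\le n-1$, with value $\gamma(y)$. For $0\le m\le n$ let $\Gamma_m(n)\subseteq\Gamma(n)$ be the subsemigroup of the elements fixing each of $1,\dots,m$, and let $A_m(n)$ be the centralizer of $\Gamma_m(n)$ in $A(n)$; in particular $A_0(n)$ is the center of $A(n)$. For $m\ge 0$ let $A_m$ be the projective limit of the algebras $A_m(n)$, $n\ge m$, in the category of filtered algebras: the algebra of all sequences $a=(a_n)_{n\ge m}$ with $a_n\in A_m(n)$, $\theta_{n+1}(a_{n+1})=a_n$ for all $n\ge m$, and $\sup_n\deg a_n<\infty$, with componentwise operations. The algebra $A_0$ (the case $m=0$) maps to $A_m$ by $(a_n)_{n\ge0}\mapsto(a_n)_{n\ge m}$, and $A(m)$ embeds in $A_m$ by constant sequences. For $1\le k\le m$ let $u_k\in A_m$ be the sequence with components $$u_{k|n}=\sum_{i=k+1}^n (k\,i)(1-\varepsilon_k)(1-\varepsilon_i),\qquad n\ge m,$$ and let $\widetilde{\mathcal H}_m$ be the subalgebra of $A_m$ generated by $A(m)$ and $u_1,\dots,u_m$. **Theorem.** Let $m\ge 0$. The map $a\otimes h\mapsto ah$ is an algebra isomorphism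 $$A_0\otimes\widetilde{\mathcal H}_m\;\simeq\; A_m .$$ Moreover, $\widetilde{\mathcal H}_m$ is isomorphic to the abstract unital associative $\mathbb C$-algebra with generators $s_1,\dots,s_{m-1}$, $\varepsilon_1,\dots,\varepsilon_m$, $u_1,\dots,u_m$ and the following defining relations (for all indices for which they make sense): \begin{align*} &s_k^2=1,\quad s_ks_{k+1}s_k=s_{k+1}s_ks_{k+1},\quad s_ks_l=s_ls_k\ \ (|k-l|>1),\\ &\varepsilon_k^2=\varepsilon_k,\quad \varepsilon_k\varepsilon_l=\varepsilon_l\varepsilon_k,\\ &s_k\varepsilon_k=\varepsilon_{k+1}s_k,\quad s_k\varepsilon_l=\varepsilon_ls_k\ \ (l\ne k,k+1),\quad s_k\varepsilon_k\varepsilon_{k+1}=\varepsilon_k\varepsilon_{k+1},\\ &s_ku_k=u_{k+1}s_k+(1-\varepsilon_k)(1-\varepsilon_{k+1}),\quad s_ku_l=u_ls_k\ \ (l\ne k,k+1),\\ &u_ku_l=u_lu_k,\quad \varepsilon_ku_k=u_k\varepsilon_k=0,\quad \varepsilon_iu_k=u_k\varepsilon_i\ \ (i\ne k), \end{align*} where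 the isomorphism sends the generators $s_k$, $\varepsilon_k$, $u_k$ to the elements $(k\;k+1)$ and $\varepsilon_k$ of $A(m)\subseteq A_m$ and to $u_k\in A_m$, respectively. -/

import Mathlib

noncomputable section

namespace PartialBij

/-! ### The monoid of partial bijections

The set `{1, …, n}` is modelled by `Fin n`, so the index `k` of the text is the element `k - 1`
of `Fin n`. -/

/-- The set `Γ(n)` of partial bijections of an `n`-element set. -/
abbrev PB (n : ℕ) : Type := Fin n ≃. Fin n

/-- The product `γ₁ γ₂` applies `γ₂` first: it is defined at `x` iff `γ₂` is defined at `x` and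
`γ₁` is defined at `γ₂ x`. -/
instance instMonoidPB (n : ℕ) : Monoid (PB n) where
  mul γ₁ γ₂ := γ₂.trans γ₁
  one := PEquiv.refl (Fin n)
  mul_assoc a b c := (PEquiv.trans_assoc c b a).symm
  one_mul a := PEquiv.trans_refl a
  mul_one a := PEquiv.refl_trans a

theorem mul_def {n : ℕ} (a b : PB n) : a * b = b.trans a := rfl

theorem one_def {n : ℕ} : (1 : PB n) = PEquiv.refl (Fin n) := rfl

theorem mul_apply {n : ℕ} (a b : PB n) (x : Fin n) : (a * b) x = (b x).bind a := rfl

theorem one_apply {n : ℕ} (x : Fin n) : (1 : PB n) x = some x := rfl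

/-- The idempotent `ε_i`: the identity bijection of the complement of `{i}`. -/
def epsPB {n : ℕ} (i : Fin n) : PB n := PEquiv.ofSet {x | x ≠ i}

/-- The transposition `(i j)`. -/
def swapPB {n : ℕ} (i j : Fin n) : PB n := (Equiv.swap i j).toPEquiv

theorem epsPB_apply {n : ℕ} (i x : Fin n) :
    epsPB i x = if x = i then none else some x := by
  by_cases h : x = i <;> simp [epsPB, PEquiv.ofSet, h]

theorem swapPB_apply {n : ℕ} (i j x : Fin n) : swapPB i j x = some (Equiv.swap i j x) := rfl

/-- The inclusion of `{1, …, n}` into `{1, …, n + 1}`, as a partial bijection. -/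
def incl (n : ℕ) : Fin n ≃. Fin (n + 1) where
  toFun i := some i.castSucc
  invFun x := if h : x.1 < n then some ⟨x.1, h⟩ else none
  inv a b := by
    by_cases h : b.1 < n
    · simp [h, Fin.ext_iff, eq_comm]
    · have : a.1 ≠ b.1 := by have := a.2; omega
      simp [h, Fin.ext_iff, this]

theorem incl_apply {n : ℕ} (i : Fin n) : incl n i = some i.castSucc := rfl

theorem incl_symm_apply {n : ℕ} (x : Fin (n + 1)) :
    (incl n).symm x = if h : x.1 < n then some ⟨x.1, h⟩ else none := rfl

/-- The canonical projection `Γ(n + 1) → Γ(n)`, the upper left corner of order `n`: it is defined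
at `y` iff `γ` is defined at `y` and `γ y` is one of the first `n` points; its value is `γ y`. -/
def thetaPB (n : ℕ) (γ : PB (n + 1)) : PB n := ((incl n).trans γ).trans (incl n).symm

theorem thetaPB_apply {n : ℕ} (γ : PB (n + 1)) (x : Fin n) :
    thetaPB n γ x = (γ x.castSucc).bind (incl n).symm := rfl

/-- The canonical embedding `Γ(m) → Γ(n)`, `m ≤ n`: the points after the `m`-th are fixed. -/
def phiPB {m n : ℕ} (h : m ≤ n) (γ : PB m) : PB n where
  toFun x := if hx : x.1 < m then (γ ⟨x.1, hx⟩).map (Fin.castLE h) else some x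
  invFun x := if hx : x.1 < m then (γ.symm ⟨x.1, hx⟩).map (Fin.castLE h) else some x
  inv a b := by
    by_cases ha : a.1 < m <;> by_cases hb : b.1 < m
    · simp only [ha, hb, dite_true, Option.map_eq_some_iff]
      constructor
      · rintro ⟨c, hc, rfl⟩
        exact ⟨⟨b.1, hb⟩, (PEquiv.eq_some_iff γ).1 hc, rfl⟩
      · rintro ⟨c, hc, rfl⟩
        exact ⟨⟨a.1, ha⟩, (PEquiv.eq_some_iff γ).2 hc, rfl⟩
    · simp only [ha, hb, dite_true, dite_false, Option.map_eq_some_iff,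
        Option.some.injEq]
      constructor
      · rintro rfl; exact absurd ha hb
      · rintro ⟨c, hc, rfl⟩; exact absurd c.2 hb
    · simp only [ha, hb, dite_true, dite_false, Option.map_eq_some_iff,
        Option.some.injEq]
      constructor
      · rintro ⟨c, hc, rfl⟩; exact absurd c.2 ha
      · rintro rfl; exact absurd hb ha
    · simp only [ha, hb, dite_false, Option.some.injEq]
      exact eq_comm

theorem phiPB_apply_lt {m n : ℕ} (h : m ≤ n) (γ : PB m) (x : Fin n) (hx : x.1 < m) :
    phiPB h γ x = (γ ⟨x.1, hx⟩).map (Fin.castLE h) := by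
  change (if hx : x.1 < m then (γ ⟨x.1, hx⟩).map (Fin.castLE h) else some x) = _
  simp [hx]

theorem phiPB_apply_ge {m n : ℕ} (h : m ≤ n) (γ : PB m) (x : Fin n) (hx : ¬ x.1 < m) :
    phiPB h γ x = some x := by
  change (if hx : x.1 < m then (γ ⟨x.1, hx⟩).map (Fin.castLE h) else some x) = _
  simp [hx]

/-- The canonical embedding as a monoid homomorphism. -/
def phiHom {m n : ℕ} (h : m ≤ n) : PB m →* PB n where
  toFun := phiPB h
  map_one' := by
    ext1 x
    by_cases hx : x.1 < m
    · rw [phiPB_apply_lt h _ x hx]; rfl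
    · rw [phiPB_apply_ge h _ x hx]; rfl
  map_mul' a b := by
    ext1 x
    by_cases hx : x.1 < m
    · rw [phiPB_apply_lt h _ x hx, mul_apply, mul_apply, phiPB_apply_lt h _ x hx]
      cases hb : b ⟨x.1, hx⟩ with
      | none => rfl
      | some y =>
        simp only [Option.bind_some, Option.map_some]
        rw [phiPB_apply_lt h a (Fin.castLE h y) y.2]
        rfl
    · rw [phiPB_apply_ge h _ x hx, mul_apply, phiPB_apply_ge h _ x hx, Option.bind_some,
        phiPB_apply_ge h _ x hx]

/-- The submonoid `Γ_m(n)` of the partial bijections that fix each of the first `m` points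
(the matrices whose first `m` diagonal entries are `1`). -/
def stab (m n : ℕ) : Submonoid (PB n) where
  carrier := {γ | ∀ i : Fin n, i.1 < m → γ i = some i}
  one_mem' := fun i _ => one_apply i
  mul_mem' := by
    intro a b ha hb i hi
    rw [mul_apply, hb i hi, Option.bind_some, ha i hi]

/-- The degree of `γ`: the number of indices `i` whose diagonal entry `γ_ii` is zero. -/
def deg {n : ℕ} (γ : PB n) : ℕ := (Finset.univ.filter fun i : Fin n => γ i ≠ some i).card

theorem deg_mul_le {n : ℕ} (a b : PB n) : deg (a * b) ≤ deg a + deg b := by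
  classical
  unfold deg
  refine le_trans (Finset.card_le_card ?_) (Finset.card_union_le _ _)
  intro i hi
  simp only [Finset.mem_filter, Finset.mem_univ, true_and, Finset.mem_union] at hi ⊢
  by_contra hc
  push Not at hc
  exact hi (by rw [mul_apply, hc.2, Option.bind_some, hc.1])

theorem deg_one {n : ℕ} : deg (1 : PB n) = 0 := by
  simp [deg, one_apply]

/-! ### The semigroup algebras, their filtrations and the projections -/

/-- The semigroup algebra `A(n) = ℂ[Γ(n)]`. -/
abbrev Alg (n : ℕ) : Type := MonoidAlgebra ℂ (PB n)

/-- The canonical basis element of `A(n)` given by `γ`. -/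
abbrev of {n : ℕ} (γ : PB n) : Alg n := MonoidAlgebra.of ℂ (PB n) γ

theorem of_one {n : ℕ} : of (1 : PB n) = 1 := map_one _

theorem of_mul {n : ℕ} (a b : PB n) : of (a * b) = of a * of b := map_mul _ _ _

/-- `A^M(n)`, the span of the `γ` of degree at most `M`. -/
def filt (n M : ℕ) : Submodule ℂ (Alg n) := Submodule.span ℂ (of '' {γ : PB n | deg γ ≤ M})

/-- The linear extension `θ_{n+1} : A(n + 1) → A(n)` of the canonical projection. -/
def theta (n : ℕ) : Alg (n + 1) →ₗ[ℂ] Alg n :=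
  MonoidAlgebra.mapDomainLinearMap ℂ ℂ (thetaPB n)

/-- The embedding `A(m) → A(n)`, `m ≤ n`, extending the canonical embedding. -/
def phi {m n : ℕ} (h : m ≤ n) : Alg m →ₐ[ℂ] Alg n :=
  MonoidAlgebra.mapDomainAlgHom ℂ ℂ (phiHom h)

/-- `A_m(n)`, the centralizer of `Γ_m(n)` in `A(n)`. -/
def cent (m n : ℕ) : Subalgebra ℂ (Alg n) :=
  Subalgebra.centralizer ℂ (of '' (stab m n : Set (PB n)))

/-- The element `ε_i` of `A(n)`. -/
def eps {n : ℕ} (i : Fin n) : Alg n := of (epsPB i)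

/-- The transposition `(i j)` as an element of `A(n)`. -/
def swapEl {n : ℕ} (i j : Fin n) : Alg n := of (swapPB i j)

/-- The element `u_{k|n} = ∑_{i > k} (k i) (1 - ε_k) (1 - ε_i)` of `A(n)`. -/
def uEl {n : ℕ} (k : Fin n) : Alg n :=
  ∑ i ∈ Finset.univ.filter (fun i : Fin n => k < i),
    swapEl k i * (1 - eps k) * (1 - eps i)

theorem theta_of {n : ℕ} (γ : PB (n + 1)) : theta n (of γ) = of (thetaPB n γ) := by
  simp [theta, MonoidAlgebra.of_apply]

theorem phi_of {m n : ℕ} (h : m ≤ n) (γ : PB m) : phi h (of γ) = of (phiPB h γ) := by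
  simp [phi, MonoidAlgebra.of_apply, phiHom]

/-- A linear map out of `A(n)` is determined by the basis elements. -/
theorem lin_ext {n : ℕ} {V : Type*} [AddCommMonoid V] [Module ℂ V] {f g : Alg n →ₗ[ℂ] V}
    (h : ∀ γ : PB n, f (of γ) = g (of γ)) : f = g := by
  ext γ
  exact h γ

theorem thetaPB_eps {n : ℕ} (a b : PB (n + 1)) :
    thetaPB n (a * epsPB (Fin.last n) * b) = thetaPB n a * thetaPB n b := by
  ext1 x
  rw [thetaPB_apply, mul_apply, mul_apply, thetaPB_apply]
  cases hb : b x.castSucc with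
  | none => rfl
  | some y =>
    simp only [Option.bind_some, mul_apply, epsPB_apply, incl_symm_apply]
    by_cases hy : y = Fin.last n
    · subst hy; simp
    · have hy2 : y.1 < n := by
        have := y.2
        have h3 : y.1 ≠ n := fun h => hy (Fin.ext h)
        omega
      simp only [hy, hy2, if_false, dite_true, Option.bind_some, thetaPB_apply]
      rfl

theorem thetaPB_one {n : ℕ} : thetaPB n 1 = 1 := by
  ext1 x
  rw [thetaPB_apply, one_apply, one_apply, Option.bind_some, incl_symm_apply]
  simp

theorem theta_one {n : ℕ} : theta n 1 = 1 := by
  have h := theta_of (1 : PB (n + 1))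
  rwa [thetaPB_one, of_one, of_one] at h

theorem theta_mul_eps_mul {n : ℕ} (x y : Alg (n + 1)) :
    theta n (x * eps (Fin.last n) * y) = theta n x * theta n y := by
  induction x using MonoidAlgebra.induction_on with
  | of a =>
    induction y using MonoidAlgebra.induction_on with
    | of b =>
      rw [eps, ← map_mul, ← map_mul, theta_of, thetaPB_eps, of_mul]
      exact congrArg₂ (· * ·) (theta_of a).symm (theta_of b).symm
    | add p q hp hq => rw [mul_add, map_add, map_add, mul_add, hp, hq]
    | smul r p hp => rw [mul_smul_comm, map_smul, map_smul, mul_smul_comm, hp]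
  | add p q hp hq => rw [add_mul, add_mul, map_add, map_add, add_mul, hp, hq]
  | smul r p hp => rw [smul_mul_assoc, smul_mul_assoc, map_smul, map_smul, smul_mul_assoc, hp]

theorem theta_mul_eps {n : ℕ} (x : Alg (n + 1)) :
    theta n (x * eps (Fin.last n)) = theta n x := by
  have h := theta_mul_eps_mul x 1
  rwa [mul_one, theta_one, mul_one] at h

theorem epsPB_mem_stab {m n : ℕ} (i : Fin n) (hi : m ≤ i.1) : epsPB i ∈ stab m n := by
  intro x hx
  rw [epsPB_apply, if_neg]
  rintro rfl
  omega

theorem mem_cent {m n : ℕ} {x : Alg n} :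
    x ∈ cent m n ↔ ∀ γ ∈ stab m n, of γ * x = x * of γ := by
  simp [cent, Subalgebra.mem_centralizer_iff]

/-- On the centralizers the projections are multiplicative. -/
theorem theta_mul {m n : ℕ} (h : m ≤ n) (x : Alg (n + 1)) {y : Alg (n + 1)}
    (hy : y ∈ cent m (n + 1)) : theta n (x * y) = theta n x * theta n y := by
  rw [← theta_mul_eps_mul, ← theta_mul_eps (x * y), mul_assoc, mul_assoc]
  congr 2
  exact (mem_cent.1 hy _ (epsPB_mem_stab (Fin.last n) h)).symm

theorem filt_mono {n M N : ℕ} (h : M ≤ N) : filt n M ≤ filt n N :=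
  Submodule.span_mono (Set.image_mono fun _ hγ => le_trans hγ h)

theorem of_mem_filt {n M : ℕ} {γ : PB n} (h : deg γ ≤ M) : of γ ∈ filt n M :=
  Submodule.subset_span ⟨γ, h, rfl⟩

theorem one_mem_filt {n M : ℕ} : (1 : Alg n) ∈ filt n M := by
  have h : of (1 : PB n) ∈ filt n M := of_mem_filt (by rw [deg_one]; exact Nat.zero_le _)
  rwa [of_one] at h

theorem mul_mem_filt {n M N : ℕ} {x y : Alg n} (hx : x ∈ filt n M) (hy : y ∈ filt n N) :
    x * y ∈ filt n (M + N) := by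
  have h : filt n M * filt n N ≤ filt n (M + N) := by
    unfold filt
    rw [Submodule.span_mul_span]
    refine Submodule.span_mono ?_
    rintro _ ⟨_, ⟨a, ha, rfl⟩, _, ⟨b, hb, rfl⟩, rfl⟩
    exact ⟨a * b, le_trans (deg_mul_le a b) (add_le_add ha hb), map_mul _ _ _⟩
  exact h (Submodule.mul_mem_mul hx hy)

/-! ### The projective limit `A_m` -/

/-- The algebra `A_m`, the projective limit of the `A_m(n)`, `n ≥ m`, in the category of filtered
algebras: the sequences `(a_n)_{n ≥ m}` with `a_n ∈ A_m(n)`, `θ_{n+1}(a_{n+1}) = a_n`, and bounded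
degrees, with componentwise operations. -/
def Alim (m : ℕ) : Subalgebra ℂ ((n : Set.Ici m) → Alg n.1) where
  carrier := {a | (∀ n : Set.Ici m, a n ∈ cent m n.1) ∧
    (∀ (n : ℕ) (h : m ≤ n), theta n (a ⟨n + 1, Nat.le_succ_of_le h⟩) = a ⟨n, h⟩) ∧
    ∃ M : ℕ, ∀ n : Set.Ici m, a n ∈ filt n.1 M}
  mul_mem' := by
    rintro a b ⟨ha, ha2, M, haM⟩ ⟨hb, hb2, N, hbN⟩
    refine ⟨fun n => mul_mem (ha n) (hb n), fun n h => ?_, M + N,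
      fun n => mul_mem_filt (haM n) (hbN n)⟩
    rw [Pi.mul_apply, Pi.mul_apply, theta_mul h _ (hb ⟨n + 1, Nat.le_succ_of_le h⟩), ha2 n h, hb2 n h]
  add_mem' := by
    rintro a b ⟨ha, ha2, M, haM⟩ ⟨hb, hb2, N, hbN⟩
    refine ⟨fun n => add_mem (ha n) (hb n), fun n h => ?_, M + N, fun n => ?_⟩
    · rw [Pi.add_apply, Pi.add_apply, map_add, ha2 n h, hb2 n h]
    · exact add_mem (filt_mono (Nat.le_add_right M N) (haM n))
        (filt_mono (Nat.le_add_left N M) (hbN n))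
  algebraMap_mem' := by
    intro r
    refine ⟨fun n => Subalgebra.algebraMap_mem _ r, fun n h => ?_, 0, fun n => ?_⟩
    · rw [Pi.algebraMap_apply, Pi.algebraMap_apply, Algebra.algebraMap_eq_smul_one,
        Algebra.algebraMap_eq_smul_one, map_smul, theta_one]
    · rw [Pi.algebraMap_apply, Algebra.algebraMap_eq_smul_one]
      exact Submodule.smul_mem _ _ one_mem_filt

theorem cent_anti {m n : ℕ} : cent 0 n ≤ cent m n := by
  intro x hx
  rw [mem_cent] at hx ⊢
  exact fun γ _ => hx γ fun i hi => absurd hi (Nat.not_lt_zero _)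

/-- The natural homomorphism `A_0 → A_m`, `(a_n)_{n ≥ 0} ↦ (a_n)_{n ≥ m}`. -/
def fromA0 (m : ℕ) : Alim 0 →ₐ[ℂ] Alim m where
  toFun a := ⟨fun n => a.1 ⟨n.1, Nat.zero_le _⟩, fun n => cent_anti (a.2.1 ⟨n.1, Nat.zero_le _⟩),
    fun n _ => a.2.2.1 n (Nat.zero_le n), by
      obtain ⟨M, hM⟩ := a.2.2.2
      exact ⟨M, fun n => hM ⟨n.1, Nat.zero_le _⟩⟩⟩
  map_one' := rfl
  map_mul' _ _ := rfl
  map_zero' := rfl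
  map_add' _ _ := rfl
  commutes' _ := rfl

/-! ### The embedding of `A(m)` into `A_m` -/

theorem thetaPB_phiPB {m n : ℕ} (h : m ≤ n) (γ : PB m) :
    thetaPB n (phiPB (Nat.le_succ_of_le h) γ) = phiPB h γ := by
  ext1 x
  rw [thetaPB_apply]
  by_cases hx : x.1 < m
  · rw [phiPB_apply_lt _ _ x.castSucc hx, phiPB_apply_lt _ _ x hx]
    change (Option.map _ (γ ⟨x.1, hx⟩)).bind _ = _
    cases γ ⟨x.1, hx⟩ with
    | none => rfl
    | some y =>
      simp only [Option.map_some, Option.bind_some, incl_symm_apply, Fin.val_castLE]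
      rw [dif_pos (lt_of_lt_of_le y.2 h)]
      rfl
  · rw [phiPB_apply_ge _ _ x.castSucc hx, phiPB_apply_ge _ _ x hx, Option.bind_some,
      incl_symm_apply]
    simp

theorem theta_phi {m n : ℕ} (h : m ≤ n) (x : Alg m) :
    theta n (phi (Nat.le_succ_of_le h) x) = phi h x := by
  have H : (theta n).comp (phi (Nat.le_succ_of_le h)).toLinearMap = (phi h).toLinearMap :=
    lin_ext fun γ => by
      simp only [LinearMap.comp_apply, AlgHom.toLinearMap_apply]
      rw [phi_of, theta_of, phi_of, thetaPB_phiPB]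
  exact congrArg (fun f => f x) H

theorem stab_apply_ge {m n : ℕ} {γ : PB n} (hγ : γ ∈ stab m n) {x y : Fin n}
    (hxy : γ x = some y) (hx : m ≤ x.1) : m ≤ y.1 := by
  by_contra hy
  have h1 : γ y = some y := hγ y (by omega)
  have : x = y := γ.inj hxy h1
  omega

theorem phiPB_comm {m n : ℕ} (h : m ≤ n) (γ : PB m) {δ : PB n} (hδ : δ ∈ stab m n) :
    δ * phiPB h γ = phiPB h γ * δ := by
  ext1 x
  rw [mul_apply, mul_apply]
  by_cases hx : x.1 < m
  · rw [hδ x hx, Option.bind_some, phiPB_apply_lt _ _ x hx]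
    cases γ ⟨x.1, hx⟩ with
    | none => rfl
    | some y => exact hδ _ y.2
  · rw [phiPB_apply_ge _ _ x hx, Option.bind_some]
    cases hy : δ x with
    | none => rfl
    | some y =>
      rw [Option.bind_some, phiPB_apply_ge]
      have := stab_apply_ge hδ hy (by omega)
      omega

theorem phi_mem_cent {m n : ℕ} (h : m ≤ n) (x : Alg m) : phi h x ∈ cent m n := by
  rw [mem_cent]
  intro δ hδ
  induction x using MonoidAlgebra.induction_on with
  | of γ =>
    change of δ * phi h (of γ) = phi h (of γ) * of δ
    rw [phi_of, ← map_mul, ← map_mul, phiPB_comm h γ hδ]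
  | add p q hp hq => rw [map_add, mul_add, add_mul, hp, hq]
  | smul r p hp => rw [map_smul, mul_smul_comm, smul_mul_assoc, hp]

theorem deg_phiPB {m n : ℕ} (h : m ≤ n) (γ : PB m) : deg (phiPB h γ) ≤ m := by
  unfold deg
  have h1 : (Finset.univ.filter fun i : Fin n => phiPB h γ i ≠ some i) ⊆
      Finset.univ.image (Fin.castLE h) := by
    intro i hi
    simp only [Finset.mem_filter, Finset.mem_univ, true_and, Finset.mem_image] at hi ⊢
    by_cases hx : i.1 < m
    · exact ⟨⟨i.1, hx⟩, rfl⟩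
    · exact absurd (phiPB_apply_ge h γ i hx) hi
  refine le_trans (Finset.card_le_card h1) (le_trans Finset.card_image_le ?_)
  simp

theorem phi_mem_filt {m n : ℕ} (h : m ≤ n) (x : Alg m) : phi h x ∈ filt n m := by
  induction x using MonoidAlgebra.induction_on with
  | of γ =>
    change phi h (of γ) ∈ _
    rw [phi_of]
    exact of_mem_filt (deg_phiPB h γ)
  | add p q hp hq => rw [map_add]; exact add_mem hp hq
  | smul r p hp => rw [map_smul]; exact Submodule.smul_mem _ _ hp

/-- The natural embedding of `A(m)` into `A_m`: `b` goes to the stable sequence `a_n = b`. -/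
def const (m : ℕ) : Alg m →ₐ[ℂ] Alim m :=
  AlgHom.codRestrict (AlgHom.pi fun n : Set.Ici m => phi n.2) (Alim m) fun x =>
    ⟨fun n => phi_mem_cent n.2 x, fun _ h => theta_phi h x, m, fun n => phi_mem_filt n.2 x⟩

/-! ### The elements `u_k` of `A_m` -/

/-- A summand of `u_{k|n}`. -/
theorem term_eq {n : ℕ} (k i : Fin n) :
    swapEl k i * (1 - eps k) * (1 - eps i) =
      of (swapPB k i) - of (swapPB k i * epsPB k) - of (swapPB k i * epsPB i)
        + of (swapPB k i * epsPB k * epsPB i) := by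
  simp only [swapEl, eps, of, map_mul]
  noncomm_ring

theorem deg_swap_le {n : ℕ} (k i : Fin n) (γ : PB n)
    (hγ : ∀ x, x ≠ k → x ≠ i → γ x = some x) : deg γ ≤ 2 := by
  unfold deg
  refine le_trans (Finset.card_le_card (t := {k, i}) ?_) Finset.card_le_two
  intro x hx
  simp only [Finset.mem_filter, Finset.mem_univ, true_and] at hx
  simp only [Finset.mem_insert, Finset.mem_singleton]
  by_contra hc
  push Not at hc
  exact hx (hγ x hc.1 hc.2)

theorem uEl_mem_filt {n : ℕ} (k : Fin n) : uEl k ∈ filt n 2 := by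
  refine Submodule.sum_mem _ fun i _ => ?_
  rw [term_eq]
  refine add_mem (sub_mem (sub_mem ?_ ?_) ?_) ?_ <;> refine of_mem_filt (deg_swap_le k i _ ?_) <;>
    intro x hk hi <;>
    simp [mul_apply, epsPB_apply, swapPB_apply, hk, hi, Equiv.swap_apply_of_ne_of_ne]

theorem phiPB_swap {n : ℕ} (k i : Fin n) :
    phiPB (Nat.le_succ n) (swapPB k i) = swapPB k.castSucc i.castSucc := by
  ext1 x
  refine Fin.lastCases ?_ (fun y => ?_) x
  · rw [phiPB_apply_ge _ _ _ (by simp), swapPB_apply, Equiv.swap_apply_of_ne_of_ne]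
    · exact (Fin.castSucc_ne_last k).symm
    · exact (Fin.castSucc_ne_last i).symm
  · rw [phiPB_apply_lt _ _ _ (by simp), swapPB_apply, swapPB_apply, Option.map_some]
    simp only [Fin.val_castSucc, Fin.eta]
    congr 1
    rw [Equiv.swap_apply_def, Equiv.swap_apply_def]
    simp only [Fin.castSucc_inj]
    split_ifs <;> rfl

theorem phiPB_eps {n : ℕ} (i : Fin n) :
    phiPB (Nat.le_succ n) (epsPB i) = epsPB i.castSucc := by
  ext1 x
  refine Fin.lastCases ?_ (fun y => ?_) x
  · rw [phiPB_apply_ge _ _ _ (by simp), epsPB_apply, if_neg (Fin.castSucc_ne_last i).symm]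
  · rw [phiPB_apply_lt _ _ _ (by simp), epsPB_apply, epsPB_apply]
    simp only [Fin.val_castSucc, Fin.eta, Fin.castSucc_inj]
    split_ifs <;> rfl

theorem phi_refl {n : ℕ} (x : Alg n) : phi (le_refl n) x = x := by
  have H : (phi (le_refl n)).toLinearMap = LinearMap.id :=
    lin_ext fun γ => by
      simp only [AlgHom.toLinearMap_apply, LinearMap.id_apply]
      rw [phi_of]
      congr 1
      ext1 x
      rw [phiPB_apply_lt _ _ x x.2]
      simp
  exact congrArg (fun f => f x) H

theorem theta_uEl {n : ℕ} (k : Fin n) : theta n (uEl k.castSucc) = uEl k := by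
  unfold uEl
  rw [map_sum, Finset.sum_filter, Finset.sum_filter, Fin.sum_univ_castSucc]
  have h0 : theta n (swapEl k.castSucc (Fin.last n) * (1 - eps k.castSucc) *
      (1 - eps (Fin.last n))) = 0 := by
    rw [mul_sub, mul_one, map_sub, theta_mul_eps, sub_self]
  rw [h0, ite_self, add_zero]
  refine Finset.sum_congr rfl fun i _ => ?_
  simp only [Fin.castSucc_lt_castSucc_iff]
  split_ifs
  · have h1 : swapEl k.castSucc i.castSucc * (1 - eps k.castSucc) * (1 - eps i.castSucc)
        = phi (Nat.le_succ n) (swapEl k i * (1 - eps k) * (1 - eps i)) := by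
      simp only [map_mul, map_sub, map_one, swapEl, eps]
      rw [phi_of, phi_of, phi_of, phiPB_swap, phiPB_eps, phiPB_eps]
    rw [h1, theta_phi (le_refl n), phi_refl]
  · rfl

theorem stab_mul_swap {n : ℕ} {γ : PB n} {k i j : Fin n} (hk : γ k = some k)
    (hij : γ i = some j) : γ * swapPB k i = swapPB k j * γ := by
  ext1 x
  rw [mul_apply, mul_apply, swapPB_apply, Option.bind_some]
  by_cases h1 : x = k
  · subst h1
    rw [Equiv.swap_apply_left, hij, hk, Option.bind_some, swapPB_apply, Equiv.swap_apply_left]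
  by_cases h2 : x = i
  · subst h2
    rw [Equiv.swap_apply_right, hij, hk, Option.bind_some, swapPB_apply, Equiv.swap_apply_right]
  rw [Equiv.swap_apply_of_ne_of_ne h1 h2]
  cases hx : γ x with
  | none => rfl
  | some y =>
    rw [Option.bind_some, swapPB_apply, Equiv.swap_apply_of_ne_of_ne]
    · rintro rfl; exact h1 (γ.inj hx hk)
    · rintro rfl; exact h2 (γ.inj hx hij)

theorem stab_mul_eps {n : ℕ} {γ : PB n} {i j : Fin n} (hij : γ i = some j) :
    γ * epsPB i = epsPB j * γ := by
  ext1 x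
  rw [mul_apply, mul_apply, epsPB_apply]
  by_cases h2 : x = i
  · subst h2
    rw [if_pos rfl, hij, Option.bind_some, epsPB_apply, if_pos rfl]; rfl
  rw [if_neg h2, Option.bind_some]
  cases hx : γ x with
  | none => rfl
  | some y =>
    rw [Option.bind_some, epsPB_apply, if_neg]
    rintro rfl; exact h2 (γ.inj hx hij)

theorem mul_eps_none {n : ℕ} {γ : PB n} {i : Fin n} (hi : γ i = none) : γ * epsPB i = γ := by
  ext1 x
  rw [mul_apply, epsPB_apply]
  by_cases h2 : x = i
  · subst h2; rw [if_pos rfl, hi]; rfl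
  · rw [if_neg h2]; rfl

theorem eps_mul_none {n : ℕ} {γ : PB n} {j : Fin n} (hj : ∀ i, γ i ≠ some j) :
    epsPB j * γ = γ := by
  ext1 x
  rw [mul_apply]
  cases hx : γ x with
  | none => rfl
  | some y =>
    rw [Option.bind_some, epsPB_apply, if_neg]
    rintro rfl; exact hj x hx

theorem term_comm {n : ℕ} {γ : PB n} {k i j : Fin n} (hk : γ k = some k)
    (hij : γ i = some j) :
    of γ * (swapEl k i * (1 - eps k) * (1 - eps i)) =
      swapEl k j * (1 - eps k) * (1 - eps j) * of γ := by
  have h1 : of γ * swapEl k i = swapEl k j * of γ := by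
    simp only [swapEl, of]; rw [← map_mul, ← map_mul, stab_mul_swap hk hij]
  have h2 : of γ * (1 - eps k) = (1 - eps k) * of γ := by
    rw [mul_sub, sub_mul, mul_one, one_mul]
    congr 1
    simp only [eps, of]; rw [← map_mul, ← map_mul, stab_mul_eps hk]
  have h3 : of γ * (1 - eps i) = (1 - eps j) * of γ := by
    rw [mul_sub, sub_mul, mul_one, one_mul]
    congr 1
    simp only [eps, of]; rw [← map_mul, ← map_mul, stab_mul_eps hij]
  rw [← mul_assoc, ← mul_assoc, h1, mul_assoc _ (of γ), h2, mul_assoc, mul_assoc _ (of γ), h3]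
  simp only [mul_assoc]

theorem term_left {n : ℕ} (k i : Fin n) :
    swapEl k i * (1 - eps k) * (1 - eps i) = (1 - eps i) * (swapEl k i * (1 - eps i)) := by
  have h : swapEl k i * eps k = eps i * swapEl k i := by
    simp only [swapEl, eps, of]
    rw [← map_mul, ← map_mul, stab_mul_eps (j := i)]
    rw [swapPB_apply, Equiv.swap_apply_left]
  rw [← mul_assoc, mul_sub (swapEl k i), mul_one, h, sub_mul (1 : Alg n) _ (swapEl k i), one_mul]

theorem term_none {n : ℕ} {γ : PB n} {k i : Fin n} (hi : γ i = none) :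
    of γ * (swapEl k i * (1 - eps k) * (1 - eps i)) = 0 := by
  have h : of γ * (1 - eps i) = 0 := by
    rw [mul_sub, mul_one, eps]
    simp only [of]; rw [← map_mul, mul_eps_none hi, sub_self]
  rw [term_left, ← mul_assoc, h, zero_mul]

theorem none_term {n : ℕ} {γ : PB n} {k j : Fin n} (hj : ∀ i, γ i ≠ some j) :
    swapEl k j * (1 - eps k) * (1 - eps j) * of γ = 0 := by
  have h : (1 - eps j) * of γ = 0 := by
    rw [sub_mul, one_mul, eps]
    simp only [of]; rw [← map_mul, eps_mul_none hj, sub_self]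
  rw [mul_assoc, h, mul_zero]

theorem uEl_mem_cent {m n : ℕ} (k : Fin n) (hk : k.1 < m) : uEl k ∈ cent m n := by
  classical
  rw [mem_cent]
  intro γ hγ
  have hgk : γ k = some k := hγ k hk
  -- `γ` preserves the set of indices that come after `k`
  have hord : ∀ i j, γ i = some j → (k < i ↔ k < j) := by
    intro i j hij
    by_cases hi : i.1 < m
    · have := hγ i hi
      rw [hij, Option.some.injEq] at this
      rw [this]
    · have := stab_apply_ge hγ hij (by omega)
      constructor <;> intro _ <;> rw [Fin.lt_def] <;> omega
  unfold uEl
  set t : Fin n → Alg n := fun i => swapEl k i * (1 - eps k) * (1 - eps i) with ht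
  have hL : ∀ i, of γ * t i = ∑ j, if γ i = some j then t j * of γ else 0 := by
    intro i
    cases hi : γ i with
    | none => simpa using term_none hi
    | some j =>
      simp only [Option.some.injEq, Finset.sum_ite_eq, Finset.mem_univ, if_true]
      exact term_comm hgk hi
  have hR : ∀ j, t j * of γ = ∑ i, if γ i = some j then t j * of γ else 0 := by
    intro j
    by_cases hj : ∃ i, γ i = some j
    · obtain ⟨i, hi⟩ := hj
      rw [Finset.sum_eq_single i]
      · rw [if_pos hi]
      · intro b _ hb
        rw [if_neg]
        exact fun h => hb (γ.inj h hi)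
      · exact fun h => absurd (Finset.mem_univ i) h
    · push Not at hj
      simpa [hj] using none_term hj
  rw [Finset.mul_sum, Finset.sum_mul, Finset.sum_filter, Finset.sum_filter]
  calc ∑ i, (if k < i then of γ * t i else 0)
      = ∑ i, ∑ j, if k < j then (if γ i = some j then t j * of γ else 0) else 0 := by
        refine Finset.sum_congr rfl fun i _ => ?_
        rw [hL i]
        by_cases hi : k < i
        · rw [if_pos hi]
          refine Finset.sum_congr rfl fun j _ => ?_
          by_cases hij : γ i = some j
          · rw [if_pos ((hord i j hij).1 hi)]
          · simp [hij]
        · rw [if_neg hi]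
          refine (Finset.sum_eq_zero fun j _ => ?_).symm
          by_cases hij : γ i = some j
          · rw [if_neg fun h => hi ((hord i j hij).2 h)]
          · simp [hij]
    _ = ∑ j, ∑ i, if k < j then (if γ i = some j then t j * of γ else 0) else 0 :=
        Finset.sum_comm
    _ = ∑ j, (if k < j then t j * of γ else 0) := by
        refine Finset.sum_congr rfl fun j _ => ?_
        by_cases hj : k < j
        · simp only [if_pos hj]
          exact (hR j).symm
        · simp [hj]

/-- The element `u_k = (u_{k|n})_{n ≥ m}` of `A_m`. -/
def uLim {m : ℕ} (k : Fin m) : Alim m :=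
  ⟨fun n => uEl (Fin.castLE n.2 k), fun _ => uEl_mem_cent _ k.2,
    fun _ h => theta_uEl (Fin.castLE h k), 2, fun _ => uEl_mem_filt _⟩

/-- The subalgebra of `A_m` generated by `A(m)` and the elements `u_1, …, u_m`. -/
def Htilde (m : ℕ) : Subalgebra ℂ (Alim m) :=
  Algebra.adjoin ℂ (Set.range (const m) ∪ Set.range (uLim (m := m)))

/-! ### The abstract algebra -/

/-- The generators `s_1, …, s_{m-1}`, `ε_1, …, ε_m`, `u_1, …, u_m`; indices start at `0`. -/
inductive Gen (m : ℕ) : Type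
  | s (k : ℕ) (hk : k + 1 < m) : Gen m
  | e (k : Fin m) : Gen m
  | u (k : Fin m) : Gen m

/-- The generator `s_k` in the free algebra. -/
abbrev fs {m : ℕ} (k : ℕ) (hk : k + 1 < m) : FreeAlgebra ℂ (Gen m) :=
  FreeAlgebra.ι ℂ (Gen.s k hk)

/-- The generator `ε_k` in the free algebra. -/
abbrev fe {m : ℕ} (k : Fin m) : FreeAlgebra ℂ (Gen m) := FreeAlgebra.ι ℂ (Gen.e k)

/-- The generator `u_k` in the free algebra. -/
abbrev fu {m : ℕ} (k : Fin m) : FreeAlgebra ℂ (Gen m) := FreeAlgebra.ι ℂ (Gen.u k)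

/-- The index `k` as an element of `Fin m`. -/
abbrev ix {m : ℕ} (k : ℕ) (hk : k + 1 < m) : Fin m := ⟨k, Nat.lt_of_succ_lt hk⟩

/-- The index `k + 1` as an element of `Fin m`. -/
abbrev ixs {m : ℕ} (k : ℕ) (hk : k + 1 < m) : Fin m := ⟨k + 1, hk⟩

/-- The defining relations. -/
inductive Rel (m : ℕ) : FreeAlgebra ℂ (Gen m) → FreeAlgebra ℂ (Gen m) → Prop
  | s_sq (k : ℕ) (hk : k + 1 < m) : Rel m (fs k hk * fs k hk) 1
  | braid (k : ℕ) (hk : k + 1 < m) (hk2 : k + 1 + 1 < m) :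
      Rel m (fs k hk * fs (k + 1) hk2 * fs k hk) (fs (k + 1) hk2 * fs k hk * fs (k + 1) hk2)
  | s_comm (k l : ℕ) (hk : k + 1 < m) (hl : l + 1 < m) (hkl : k + 1 < l) :
      Rel m (fs k hk * fs l hl) (fs l hl * fs k hk)
  | e_sq (k : Fin m) : Rel m (fe k * fe k) (fe k)
  | e_comm (k l : Fin m) : Rel m (fe k * fe l) (fe l * fe k)
  | s_e (k : ℕ) (hk : k + 1 < m) : Rel m (fs k hk * fe (ix k hk)) (fe (ixs k hk) * fs k hk)
  | s_e_comm (k : ℕ) (hk : k + 1 < m) (l : Fin m) (h1 : l ≠ ix k hk) (h2 : l ≠ ixs k hk) :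
      Rel m (fs k hk * fe l) (fe l * fs k hk)
  | s_e_e (k : ℕ) (hk : k + 1 < m) :
      Rel m (fs k hk * fe (ix k hk) * fe (ixs k hk)) (fe (ix k hk) * fe (ixs k hk))
  | s_u (k : ℕ) (hk : k + 1 < m) :
      Rel m (fs k hk * fu (ix k hk))
        (fu (ixs k hk) * fs k hk + (1 - fe (ix k hk)) * (1 - fe (ixs k hk)))
  | s_u_comm (k : ℕ) (hk : k + 1 < m) (l : Fin m) (h1 : l ≠ ix k hk) (h2 : l ≠ ixs k hk) :
      Rel m (fs k hk * fu l) (fu l * fs k hk)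
  | u_comm (k l : Fin m) : Rel m (fu k * fu l) (fu l * fu k)
  | e_u (k : Fin m) : Rel m (fe k * fu k) 0
  | u_e (k : Fin m) : Rel m (fu k * fe k) 0
  | e_u_comm (i k : Fin m) (h : i ≠ k) : Rel m (fe i * fu k) (fu k * fe i)

/-- The abstract algebra with these generators and defining relations. -/
abbrev Abs (m : ℕ) : Type := RingQuot (Rel m)

/-- The class of a generator in the abstract algebra. -/
def gen {m : ℕ} (g : Gen m) : Abs m := RingQuot.mkAlgHom ℂ (Rel m) (FreeAlgebra.ι ℂ g)

end PartialBij

end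

/-! Call an index inner if it is below `m` and outer otherwise. The proof rests on coordinates on
A(n) adapted both to θ and to the centralizer condition. The functional `cf m δ` is a product over
columns: a column where δ is undefined has weight 1, and any other column k tests γ(k) = δ(k), with
1 subtracted if k is an outer fixed point of δ. These functionals form a basis of the dual of A(n)
(`exists_dual`, `cf_injective`). In them θ is restriction to the δ that are undefined at the last
point (`cf_theta`), commuting with ε_i means that every δ in the support has i in its domain exactly
when it has i in its image (`eps_comm_iff`), and commuting with permutations is invariance under
relabelling. So an element of A_m is a function of δ that is invariant under injections fixing the
inner points, supported on the δ whose domain and image have the same outer points, and zero once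
the number `cnt` of outer points in the domain is large (`cf_push`, `exists_of_coord`).

Such a δ consists of paths that join inner points through outer ones, and of a permutation of the
remaining outer points of its domain. The paths give a partial bijection γ of the inner points
together with a length r_x for each x; the rest is a datum of A_0. This matches the elements γ u^r
with coefficients in A_0, where γ must be defined at x if r_x ≠ 0. The match is exact in top degree
for the filtration by `cnt`: multiplying by u_k shortens the path k → i → δ(i) to k → δ(i)
(`cf_mul_uEl_of_eq`), and a product of elements of A_0 and A(m) factors into an outer and an inner
coordinate (`cf_mul_phi`).

Generation follows by induction on the filtration: products b u_x remove the part of the leading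
term in which x leaves the inner points (`isClosedUpTo_sub`), and what is left is block diagonal and
lies in A_0 A(m) modulo lower terms (`closed_mem`). Independence uses the same shortening of paths
to isolate the leading coordinates of a single coefficient (`cf_coeff_eq_zero`, `coeff_eq_zero`).

In the abstract algebra the Coxeter presentation of the symmetric group and the ε-relations yield an
element `pbA γ` for each partial bijection. The u-relations move the u's to the right, so the γ u^r
span (`span_basisA`), and those with γ undefined at some x with r_x ≠ 0 vanish (`basisA_eq_zero`).
The surviving ones have images independent over A_0; hence A_0 ⊗ `Abs m` → A_m is bijective, `Abs m`
embeds, and its image is the subalgebra generated by A(m) and the u_k. -/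

noncomputable section

namespace PartialBij

open Function

/-! ### Column functionals -/

/-- The linear functional on `A(n)` whose value at `γ` is the product over the columns `k` of the
weights `w k (γ k)`. -/
def colFun {n : ℕ} (w : Fin n → Option (Fin n) → ℂ) : Alg n →ₗ[ℂ] ℂ :=
  Finsupp.linearCombination ℂ (fun γ : PB n => ∏ k, w k (γ k)) ∘ₗ
    (MonoidAlgebra.coeffLinearEquiv ℂ).toLinearMap

theorem colFun_of {n : ℕ} (w : Fin n → Option (Fin n) → ℂ) (γ : PB n) :
    colFun w (of γ) = ∏ k, w k (γ k) := by
  simp [colFun, MonoidAlgebra.of_apply, MonoidAlgebra.coeffLinearEquiv]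

/-- Induction principle: two linear maps that agree on the basis elements agree. -/
theorem lin_congr {n : ℕ} {V : Type*} [AddCommMonoid V] [Module ℂ V] (f g : Alg n →ₗ[ℂ] V)
    (h : ∀ γ : PB n, f (of γ) = g (of γ)) (a : Alg n) : f a = g a := by
  rw [lin_ext h]

theorem prod_update {n : ℕ} (w : Fin n → Option (Fin n) → ℂ) (i : Fin n) (f : Option (Fin n) → ℂ)
    (γ : Fin n → Option (Fin n)) :
    ∏ k, update w i f k (γ k) = f (γ i) * ∏ k ∈ Finset.univ \ {i}, w k (γ k) := by
  rw [← Finset.prod_update_of_mem (Finset.mem_univ i) (fun k => w k (γ k)) (f (γ i))]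
  refine Finset.prod_congr rfl fun k _ => ?_
  by_cases h : k = i
  · subst h; simp
  · simp [h]

theorem colFun_update_sub {n : ℕ} (w : Fin n → Option (Fin n) → ℂ) (i : Fin n)
    (f g : Option (Fin n) → ℂ) (a : Alg n) :
    colFun (update w i fun o => f o - g o) a =
      colFun (update w i f) a - colFun (update w i g) a := by
  refine lin_congr _ (colFun (update w i f) - colFun (update w i g)) (fun γ => ?_) a
  rw [LinearMap.sub_apply, colFun_of, colFun_of, colFun_of, prod_update, prod_update, prod_update,
    sub_mul]

theorem colFun_update_zero {n : ℕ} (w : Fin n → Option (Fin n) → ℂ) (i : Fin n)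
    (hw : ∀ o, w i o = 0) (a : Alg n) : colFun w a = 0 := by
  refine lin_congr _ 0 (fun γ => ?_) a
  rw [colFun_of]
  exact Finset.prod_eq_zero (Finset.mem_univ i) (hw _)

theorem colFun_of_mul {n : ℕ} (w : Fin n → Option (Fin n) → ℂ) (δ : PB n) (a : Alg n) :
    colFun w (of δ * a) = colFun (fun k o => w k (o.bind δ)) a := by
  refine lin_congr (colFun w ∘ₗ LinearMap.mulLeft ℂ (of δ)) _ (fun γ => ?_) a
  rw [LinearMap.comp_apply, LinearMap.mulLeft_apply, ← of_mul, colFun_of, colFun_of]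
  rfl

/-- Right multiplication acts on the column index, left multiplication on the values inside each
column. In both cases the functional keeps its product form, so products can be computed on weights
alone. -/
theorem colFun_mul_perm {n : ℕ} (w : Fin n → Option (Fin n) → ℂ) (σ : Equiv.Perm (Fin n))
    (a : Alg n) : colFun w (a * of σ.toPEquiv) = colFun (fun k => w (σ.symm k)) a := by
  refine lin_congr (colFun w ∘ₗ LinearMap.mulRight ℂ (of σ.toPEquiv)) _ (fun γ => ?_) a
  rw [LinearMap.comp_apply, LinearMap.mulRight_apply, ← of_mul, colFun_of, colFun_of]
  rw [← Equiv.prod_comp σ fun k => w (σ.symm k) (γ k)]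
  refine Finset.prod_congr rfl fun k _ => ?_
  rw [σ.symm_apply_apply]
  rfl

/-- Right multiplication by ε_i empties column i, which freezes its weight at the value at `none`.
-/
theorem colFun_mul_eps {n : ℕ} (w : Fin n → Option (Fin n) → ℂ) (i : Fin n) (a : Alg n) :
    colFun w (a * eps i) = colFun (update w i fun _ => w i none) a := by
  refine lin_congr (colFun w ∘ₗ LinearMap.mulRight ℂ (eps i)) _ (fun γ => ?_) a
  rw [LinearMap.comp_apply, LinearMap.mulRight_apply, eps, ← of_mul, colFun_of, colFun_of]
  refine Finset.prod_congr rfl fun k _ => ?_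
  rw [mul_apply, epsPB_apply]
  by_cases h : k = i
  · subst h; simp
  · simp [h]

theorem colFun_mul_one_sub_eps {n : ℕ} (w : Fin n → Option (Fin n) → ℂ) (i : Fin n) (a : Alg n) :
    colFun w (a * (1 - eps i)) = colFun (update w i fun o => w i o - w i none) a := by
  rw [colFun_update_sub, mul_sub, mul_one, map_sub, colFun_mul_eps]
  congr 2
  exact congrArg colFun (update_eq_self i w).symm

/-! ### The coordinates with respect to the dual basis -/

/-- The weight of a column in the coordinate functional of `δ`. -/
def colWt (m : ℕ) {n : ℕ} (δ : PB n) (k : Fin n) (o : Option (Fin n)) : ℂ :=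
  match δ k with
  | none => 1
  | some j => (if o = some j then 1 else 0) - (if m ≤ k.1 ∧ j = k then 1 else 0)

theorem colWt_none {m n : ℕ} {δ : PB n} {k : Fin n} (h : δ k = none) (o : Option (Fin n)) :
    colWt m δ k o = 1 := by
  simp [colWt, h]

theorem colWt_some {m n : ℕ} {δ : PB n} {k j : Fin n} (h : δ k = some j) (o : Option (Fin n)) :
    colWt m δ k o = (if o = some j then 1 else 0) - (if m ≤ k.1 ∧ j = k then 1 else 0) := by
  simp [colWt, h]

/-- This vanishing is the purpose of the diagonal correction: every outer point in the domain of δ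
gives a column that kills all γ fixing that point, so coordinates detect the degree. -/
theorem colWt_self {m n : ℕ} {δ : PB n} {k : Fin n} (hk : m ≤ k.1) (h : (δ k).isSome) :
    colWt m δ k (some k) = 0 := by
  obtain ⟨j, hj⟩ := Option.isSome_iff_exists.1 h
  rw [colWt_some hj]
  simp [hk, eq_comm]

/-- The coordinate functional of `δ`. -/
def cf (m : ℕ) {n : ℕ} (δ : PB n) : Alg n →ₗ[ℂ] ℂ := colFun (colWt m δ)

theorem cf_of (m : ℕ) {n : ℕ} (δ γ : PB n) : cf m δ (of γ) = ∏ k, colWt m δ k (γ k) :=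
  colFun_of _ _

/-- The number of points `k ≥ m` that `γ` does not fix. -/
def odeg (m : ℕ) {n : ℕ} (γ : PB n) : ℕ :=
  (Finset.univ.filter fun k : Fin n => m ≤ k.1 ∧ γ k ≠ some k).card

/-- The number of points `k ≥ m` at which `δ` is defined. -/
def cnt (m : ℕ) {n : ℕ} (δ : PB n) : ℕ :=
  (Finset.univ.filter fun k : Fin n => m ≤ k.1 ∧ (δ k).isSome).card

/-- The span of the `γ` that move fewer than `d` of the points `k ≥ m`. -/
def outFilt (m n d : ℕ) : Submodule ℂ (Alg n) := Submodule.span ℂ (of '' {γ : PB n | odeg m γ < d})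

theorem outFilt_mono {m n d e : ℕ} (h : d ≤ e) : outFilt m n d ≤ outFilt m n e :=
  Submodule.span_mono (Set.image_mono fun _ hγ => lt_of_lt_of_le hγ h)

theorem outFilt_zero {m n : ℕ} : outFilt m n 0 = ⊥ := by
  simp [outFilt]

theorem of_mem_outFilt {m n d : ℕ} {γ : PB n} (h : odeg m γ < d) : of γ ∈ outFilt m n d :=
  Submodule.subset_span ⟨γ, h, rfl⟩

/-- Pigeonhole: a γ that moves fewer than d outer points fixes one of the d outer points whose
weight vanishes on the diagonal. -/
theorem colFun_eq_zero {m n d : ℕ} {w : Fin n → Option (Fin n) → ℂ}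
    (hw : d ≤ (Finset.univ.filter fun k : Fin n => m ≤ k.1 ∧ w k (some k) = 0).card)
    {a : Alg n} (ha : a ∈ outFilt m n d) : colFun w a = 0 := by
  have : outFilt m n d ≤ LinearMap.ker (colFun w) := by
    refine Submodule.span_le.2 ?_
    rintro _ ⟨γ, hγ, rfl⟩
    change colFun w (of γ) = 0
    rw [colFun_of]
    obtain ⟨k, hk, hk2⟩ := Finset.exists_mem_notMem_of_card_lt_card (lt_of_lt_of_le hγ hw)
    simp only [Finset.mem_filter, Finset.mem_univ, true_and] at hk hk2
    have h2 : γ k = some k := by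
      by_contra h
      exact hk2 ⟨hk.1, h⟩
    exact Finset.prod_eq_zero (Finset.mem_univ k) (by rw [h2, hk.2])
  exact this ha

theorem cf_eq_zero {m n d : ℕ} {δ : PB n} (hδ : d ≤ cnt m δ) {a : Alg n}
    (ha : a ∈ outFilt m n d) : cf m δ a = 0 := by
  refine colFun_eq_zero (le_trans hδ (Finset.card_le_card ?_)) ha
  intro k hk
  simp only [Finset.mem_filter, Finset.mem_univ, true_and] at hk ⊢
  exact ⟨hk.1, colWt_self hk.1 hk.2⟩

/-! ### The dual basis -/

/-- The restriction of a basis element by the factors `1 - ε_i`, `i ∈ S`, is a combination of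
partial bijections that agree with it outside `S`. -/
theorem exists_mul_prod_one_sub_eps {n : ℕ} (γ : PB n) (S : Finset (Fin n)) :
    ∃ t : Alg n, (∀ w, colFun w t = ∏ k, if k ∈ S then w k (γ k) - w k none else w k (γ k)) ∧
      t ∈ Submodule.span ℂ (of '' {γ' : PB n | ∀ k ∉ S, γ' k = γ k}) := by
  classical
  induction S using Finset.induction_on with
  | empty =>
    exact ⟨of γ, fun w => by rw [colFun_of]; simp, Submodule.subset_span ⟨γ, fun _ _ => rfl, rfl⟩⟩
  | insert i S hi ih =>
    obtain ⟨t, ht, ht2⟩ := ih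
    refine ⟨t * (1 - eps i), fun w => ?_, ?_⟩
    · rw [colFun_mul_one_sub_eps, ht]
      refine Finset.prod_congr rfl fun k _ => ?_
      by_cases h : k = i
      · subst h; simp [hi]
      · simp [h]
    · rw [mul_sub, mul_one]
      have hmono : {γ' : PB n | ∀ k ∉ S, γ' k = γ k} ⊆ {γ' : PB n | ∀ k ∉ insert i S, γ' k = γ k} :=
        fun γ' h k hk => h k fun hk2 => hk (Finset.mem_insert_of_mem hk2)
      refine sub_mem (Submodule.span_mono (Set.image_mono hmono) ht2) ?_
      have h2 := Submodule.mem_map_of_mem (f := LinearMap.mulRight ℂ (eps i)) ht2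
      rw [Submodule.map_span] at h2
      refine Submodule.span_le.2 ?_ h2
      rintro _ ⟨_, ⟨γ', hγ', rfl⟩, rfl⟩
      rw [LinearMap.mulRight_apply, eps, ← of_mul]
      refine Submodule.subset_span ⟨_, fun k hk => ?_, rfl⟩
      rw [Finset.mem_insert, not_or] at hk
      rw [mul_apply, epsPB_apply, if_neg hk.1]
      exact hγ' k hk.2

/-- The extension of `δ` by the identity on the points `k ≥ m` outside the domain and the image. -/
def extId (m : ℕ) {n : ℕ} (δ : PB n) : PB n where
  toFun k := if δ k = none ∧ δ.symm k = none ∧ m ≤ k.1 then some k else δ k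
  invFun k := if δ k = none ∧ δ.symm k = none ∧ m ≤ k.1 then some k else δ.symm k
  inv a b := by
    have := PEquiv.eq_some_iff δ (a := a) (b := b)
    by_cases ha : δ a = none ∧ δ.symm a = none ∧ m ≤ a.1 <;>
      by_cases hb : δ b = none ∧ δ.symm b = none ∧ m ≤ b.1
    · simp [ha, hb, eq_comm]
    · rw [if_pos ha, if_neg hb]
      constructor
      · intro h
        rw [this] at h
        simp [h] at ha
      · intro h
        simp only [Option.some.injEq] at h
        exact absurd (h ▸ ha) hb
    · rw [if_neg ha, if_pos hb]
      constructor
      · intro h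
        simp only [Option.some.injEq] at h
        exact absurd (h ▸ hb) ha
      · intro h
        rw [← this] at h
        simp [h] at hb
    · rw [if_neg ha, if_neg hb]
      exact this

theorem extId_apply (m : ℕ) {n : ℕ} (δ : PB n) (k : Fin n) :
    extId m δ k = if δ k = none ∧ δ.symm k = none ∧ m ≤ k.1 then some k else δ k := rfl

/-- The element is the extension of δ by the identity on the free outer points, multiplied by 1 -
ε_k for all k in the domain of δ. The factors 1 - ε_k force δ' to extend δ. A further value δ'(k) =
j gives a zero factor: if k is outer and free, the diagonal correction cancels; if k is inner, the
extension is undefined there and nothing is subtracted; if k is an outer point of the image of δ,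
only j = k could survive, against injectivity of δ'. -/
theorem exists_dual (m : ℕ) {n : ℕ} (δ : PB n) :
    ∃ t : Alg n, (∀ δ' : PB n, cf m δ' t = if δ' = δ then 1 else 0) ∧
      t ∈ Submodule.span ℂ (of '' {γ : PB n | ∀ k : Fin n, m ≤ k.1 → δ k = none →
        δ.symm k = none → γ k = some k}) := by
  classical
  obtain ⟨t, ht, ht2⟩ := exists_mul_prod_one_sub_eps (extId m δ)
    (Finset.univ.filter fun k => (δ k).isSome)
  refine ⟨t, fun δ' => ?_, ?_⟩
  · rw [cf, ht]
    simp only [Finset.mem_filter, Finset.mem_univ, true_and]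
    by_cases h : δ' = δ
    · subst h
      rw [if_pos rfl]
      refine Finset.prod_eq_one fun k _ => ?_
      cases hk : δ' k with
      | none => simp [colWt_none hk]
      | some j => simp [colWt_some hk, extId_apply, hk]
    · rw [if_neg h]
      have hne : ∃ k, δ' k ≠ δ k := by
        by_contra hc
        push Not at hc
        exact h (PEquiv.ext hc)
      obtain ⟨k, hk⟩ := hne
      by_contra hprod
      rw [← ne_eq, Finset.prod_ne_zero_iff] at hprod
      -- In a column of the domain of δ the factor is a difference of two values of the same weight,
      -- so the diagonal correction drops out and only the test δ'(i) = δ(i) remains.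
      have key : ∀ i j, δ i = some j → δ' i = some j := by
        intro i j hij
        have := hprod i (Finset.mem_univ _)
        rw [hij, Option.isSome_some, if_pos rfl, extId_apply, hij] at this
        simp only [reduceCtorEq, false_and, if_false] at this
        cases hi : δ' i with
        | none => simp [colWt_none hi] at this
        | some j' =>
          rw [colWt_some hi, colWt_some hi] at this
          by_contra hc
          apply this
          have : ¬ (some j = some j') := fun h => hc h.symm
          simp [this]
      cases hk1 : δ k with
      | some j => exact hk (by rw [hk1, key k j hk1])
      | none =>
        rw [hk1] at hk
        obtain ⟨j, hj⟩ := Option.ne_none_iff_exists'.1 hk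
        have := hprod k (Finset.mem_univ _)
        rw [hk1, Option.isSome_none, if_neg (by simp), extId_apply, hk1, colWt_some hj] at this
        by_cases hkm : m ≤ k.1
        · cases hk2 : δ.symm k with
          | none => simp [hk2, hkm, eq_comm] at this
          | some l =>
            by_cases hjk : j = k
            · subst hjk
              have h1 : δ l = some j := (PEquiv.eq_some_iff δ).1 hk2
              have h2 := key l j h1
              have := δ'.inj h2 hj
              subst this
              rw [h1] at hk1
              cases hk1
            · simp [hk2, hjk] at this
        · simp [hkm] at this
  · refine Submodule.span_mono (Set.image_mono fun γ hγ k hk1 hk2 hk3 => ?_) ht2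
    rw [hγ k (by simp [hk2]), extId_apply, if_pos ⟨hk2, hk3, hk1⟩]

/-- The element of the dual basis. -/
def dualEl (m : ℕ) {n : ℕ} (δ : PB n) : Alg n := (exists_dual m δ).choose

theorem cf_dualEl (m : ℕ) {n : ℕ} (δ' δ : PB n) :
    cf m δ' (dualEl m δ) = if δ' = δ then 1 else 0 := (exists_dual m δ).choose_spec.1 δ'

theorem dualEl_mem (m : ℕ) {n : ℕ} (δ : PB n) :
    dualEl m δ ∈ Submodule.span ℂ (of '' {γ : PB n | ∀ k : Fin n, m ≤ k.1 → δ k = none →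
        δ.symm k = none → γ k = some k}) := (exists_dual m δ).choose_spec.2

instance finitePB (n : ℕ) : Finite (PB n) :=
  Finite.of_injective (fun γ : PB n => (γ : Fin n → Option (Fin n))) DFunLike.coe_injective

noncomputable instance fintypePB (n : ℕ) : Fintype (PB n) := Fintype.ofFinite _

/-- The dual elements make the coordinate map onto, and its source and target have the same finite
dimension. -/
theorem cf_injective (m : ℕ) {n : ℕ} {a b : Alg n} (h : ∀ δ : PB n, cf m δ a = cf m δ b) :
    a = b := by
  classical
  let Φ : (PB n → ℂ) →ₗ[ℂ] Alg n := Fintype.linearCombination ℂ (dualEl m (n := n))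
  let Ψ : Alg n →ₗ[ℂ] (PB n → ℂ) := LinearMap.pi fun δ => cf m δ
  have hΨ : Function.Surjective Ψ := by
    intro g
    refine ⟨Φ g, ?_⟩
    ext δ
    simp [Φ, Ψ, Fintype.linearCombination_apply, cf_dualEl]
  have e : Alg n ≃ₗ[ℂ] (PB n → ℂ) :=
    (MonoidAlgebra.coeffLinearEquiv ℂ).trans (Finsupp.linearEquivFunOnFinite ℂ ℂ (PB n))
  have : FiniteDimensional ℂ (Alg n) := LinearEquiv.finiteDimensional e.symm
  have hinj : Function.Injective Ψ :=
    (LinearMap.injective_iff_surjective_of_finrank_eq_finrank e.finrank_eq).2 hΨ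
  exact hinj (funext h)

/-- The element with given coordinates. -/
def ofCoord (m : ℕ) {n : ℕ} (g : PB n → ℂ) : Alg n := ∑ δ, g δ • dualEl m δ

theorem cf_ofCoord (m : ℕ) {n : ℕ} (g : PB n → ℂ) (δ : PB n) : cf m δ (ofCoord m g) = g δ := by
  classical
  simp [ofCoord, cf_dualEl]

theorem ofCoord_cf (m : ℕ) {n : ℕ} (a : Alg n) : ofCoord m (fun δ => cf m δ a) = a :=
  cf_injective m fun δ => cf_ofCoord m _ δ

/-- If the coordinates vanish unless domain and image agree beyond `m` and have fewer than `d`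
points there, then the element lies in the filtration step `d`. -/
theorem mem_outFilt_of_cf {m n d : ℕ} {a : Alg n}
    (h1 : ∀ (δ : PB n) (i : Fin n), m ≤ i.1 → cf m δ a ≠ 0 → δ i = none → δ.symm i = none)
    (h2 : ∀ δ : PB n, d ≤ cnt m δ → cf m δ a = 0) : a ∈ outFilt m n d := by
  rw [← ofCoord_cf m a]
  refine Submodule.sum_mem _ fun δ _ => ?_
  by_cases hδ : cf m δ a = 0
  · simp only [hδ, zero_smul]; exact zero_mem _
  refine Submodule.smul_mem _ _ (Submodule.span_mono (Set.image_mono ?_) (dualEl_mem m δ))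
  intro γ hγ
  have hc : cnt m δ < d := by
    by_contra hc
    exact hδ (h2 δ (not_lt.1 hc))
  refine lt_of_le_of_lt (Finset.card_le_card ?_) hc
  intro k hk
  simp only [Finset.mem_filter, Finset.mem_univ, true_and] at hk ⊢
  refine ⟨hk.1, ?_⟩
  by_contra hn
  have hn' : δ k = none := by simpa using hn
  exact hk.2 (hγ k hk.1 hn' (h1 δ k hk.1 hδ hn'))

/-! ### Commutation with the generators of the stabilizers -/

theorem cf_mul_eps_none {m n : ℕ} {δ : PB n} {i : Fin n} (hi : δ i = none) (a : Alg n) :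
    cf m δ (a * eps i) = cf m δ a := by
  rw [cf, colFun_mul_eps]
  congr 2
  conv_rhs => rw [← update_eq_self i (colWt m δ)]
  congr 1
  funext o
  rw [colWt_none hi, colWt_none hi]

theorem cf_mul_eps_ne {m n : ℕ} {δ : PB n} {i j : Fin n} (hi : δ i = some j) (hj : j ≠ i)
    (a : Alg n) : cf m δ (a * eps i) = 0 := by
  rw [cf, colFun_mul_eps]
  refine colFun_update_zero _ i (fun o => ?_) a
  simp [colWt_some hi, hj]

theorem cf_eps_mul_none {m n : ℕ} {δ : PB n} {i : Fin n} (hi : δ.symm i = none) (a : Alg n) :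
    cf m δ (eps i * a) = cf m δ a := by
  rw [cf, eps, colFun_of_mul]
  congr 2
  funext k o
  cases hk : δ k with
  | none => rw [colWt_none hk, colWt_none hk]
  | some j =>
    rw [colWt_some hk, colWt_some hk]
    have hj : j ≠ i := by
      rintro rfl
      rw [(PEquiv.eq_some_iff δ).2 hk] at hi
      cases hi
    cases o with
    | none => rfl
    | some y =>
      rw [Option.bind_some, epsPB_apply]
      by_cases hy : y = i
      · subst hy; simp [hj.symm]
      · simp [hy]

theorem cf_eps_mul_ne {m n : ℕ} {δ : PB n} {i l : Fin n} (hl : δ l = some i) (h : l ≠ i)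
    (a : Alg n) : cf m δ (eps i * a) = 0 := by
  rw [cf, eps, colFun_of_mul]
  refine colFun_update_zero _ l (fun o => ?_) a
  rw [colWt_some hl]
  cases o with
  | none => simp [h.symm]
  | some y =>
    rw [Option.bind_some, epsPB_apply]
    by_cases hy : y = i <;> simp [hy, h.symm]

theorem cf_eps_mul_self {m n : ℕ} {δ : PB n} {i : Fin n} (hi : δ i = some i)
    (a : Alg n) : cf m δ (eps i * a) = cf m δ (a * eps i) := by
  rw [cf, colFun_mul_eps, eps, colFun_of_mul]
  congr 2
  funext k o
  by_cases hk : k = i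
  · subst hk
    rw [update_self, colWt_some hi, colWt_some hi]
    cases o with
    | none => rfl
    | some y =>
      rw [Option.bind_some, epsPB_apply]
      by_cases hy : y = k <;> simp [hy]
  · rw [update_of_ne hk]
    cases hd : δ k with
    | none => rw [colWt_none hd, colWt_none hd]
    | some j =>
      rw [colWt_some hd, colWt_some hd]
      have hj : j ≠ i := by
        rintro rfl
        exact hk (δ.inj hd hi)
      cases o with
      | none => rfl
      | some y =>
        rw [Option.bind_some, epsPB_apply]
        by_cases hy : y = i
        · subst hy; simp [hj.symm]
        · simp [hy]

/-- The coordinate at δ of a ε_i is that of a if δ is undefined at i, and zero if δ moves i. The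
coordinate of ε_i a is that of a if i is not in the image, and zero if i is the image of another
point. If δ fixes i the two coordinates agree for every a. Only a δ with i in exactly one of domain
and image therefore imposes a condition. -/
theorem eps_comm_iff (m : ℕ) {n : ℕ} {a : Alg n} {i : Fin n} :
    eps i * a = a * eps i ↔ ∀ δ : PB n, cf m δ a ≠ 0 → (δ i = none ↔ δ.symm i = none) := by
  constructor
  · intro h δ hδ
    constructor
    · intro h1
      by_contra h2
      obtain ⟨l, hl⟩ := Option.ne_none_iff_exists'.1 h2
      have hl' : δ l = some i := (PEquiv.eq_some_iff δ).1 hl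
      apply hδ
      rw [← cf_mul_eps_none h1, ← h]
      refine cf_eps_mul_ne hl' ?_ a
      rintro rfl
      rw [h1] at hl'
      cases hl'
    · intro h1
      by_contra h2
      obtain ⟨j, hj⟩ := Option.ne_none_iff_exists'.1 h2
      apply hδ
      rw [← cf_eps_mul_none h1, h]
      refine cf_mul_eps_ne hj ?_ a
      rintro rfl
      rw [(PEquiv.eq_some_iff δ).2 hj] at h1
      cases h1
  · intro h
    refine cf_injective m fun δ => ?_
    cases hi : δ i with
    | none =>
      rw [cf_mul_eps_none hi]
      cases hs : δ.symm i with
      | none => rw [cf_eps_mul_none hs]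
      | some l =>
        have hl : δ l = some i := (PEquiv.eq_some_iff δ).1 hs
        rw [cf_eps_mul_ne hl]
        · by_contra hc
          have := (h δ (Ne.symm hc)).1 hi
          rw [hs] at this
          cases this
        · rintro rfl
          rw [hi] at hl
          cases hl
    | some j =>
      by_cases hj : j = i
      · subst hj
        exact cf_eps_mul_self hi a
      · rw [cf_mul_eps_ne hi hj]
        cases hs : δ.symm i with
        | none =>
          rw [cf_eps_mul_none hs]
          by_contra hc
          have := (h δ hc).2 hs
          rw [hi] at this
          cases this
        | some l =>
          have hl : δ l = some i := (PEquiv.eq_some_iff δ).1 hs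
          refine cf_eps_mul_ne hl ?_ a
          rintro rfl
          rw [hi, Option.some.injEq] at hl
          exact hj hl

/-- Every partial bijection of a finite set extends to a permutation. -/
theorem exists_perm_extend {n : ℕ} (γ : PB n) :
    ∃ σ : Equiv.Perm (Fin n), ∀ x y, γ x = some y → σ x = y := by
  classical
  let e : {x // (γ x).isSome} ≃ {y // (γ.symm y).isSome} :=
    { toFun := fun x => ⟨(γ x.1).get x.2, by
        rw [(PEquiv.eq_some_iff γ (a := x.1)).2 (Option.some_get x.2).symm]; rfl⟩
      invFun := fun y => ⟨(γ.symm y.1).get y.2, by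
        rw [(PEquiv.eq_some_iff γ (a := (γ.symm y.1).get y.2) (b := y.1)).1
          (Option.some_get y.2).symm]; rfl⟩
      left_inv := fun x => by
        apply Subtype.ext
        apply Option.get_of_eq_some
        exact (PEquiv.eq_some_iff γ).2 (Option.some_get x.2).symm
      right_inv := fun y => by
        apply Subtype.ext
        apply Option.get_of_eq_some
        exact (PEquiv.eq_some_iff γ).1 (Option.some_get y.2).symm }
  refine ⟨e.extendSubtype, fun x y h => ?_⟩
  rw [Equiv.extendSubtype_apply_of_mem e x (by rw [h]; rfl)]
  exact Option.get_of_eq_some _ h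

/-- The identity bijection of the complement of `S`. -/
def epsSet {n : ℕ} (S : Finset (Fin n)) : PB n := PEquiv.ofSet {x | x ∉ S}

theorem epsSet_apply {n : ℕ} (S : Finset (Fin n)) (x : Fin n) :
    epsSet S x = if x ∈ S then none else some x := by
  by_cases h : x ∈ S <;> simp [epsSet, PEquiv.ofSet, h]

theorem epsSet_empty {n : ℕ} : epsSet (∅ : Finset (Fin n)) = 1 := by
  ext1 x
  simp [epsSet_apply, one_apply]

theorem epsPB_mul_epsSet {n : ℕ} (i : Fin n) (S : Finset (Fin n)) :
    epsPB i * epsSet S = epsSet (insert i S) := by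
  ext1 x
  rw [mul_apply, epsSet_apply, epsSet_apply]
  by_cases h : x ∈ S
  · simp [h]
  · by_cases h2 : x = i <;> simp [h, epsPB_apply, h2]

theorem eq_perm_mul_epsSet {n : ℕ} {γ : PB n} {σ : Equiv.Perm (Fin n)}
    (h : ∀ x y, γ x = some y → σ x = y) :
    γ = σ.toPEquiv * epsSet (Finset.univ.filter fun x => γ x = none) := by
  ext1 x
  rw [mul_apply, epsSet_apply]
  cases hx : γ x with
  | none => simp [hx]
  | some y => simp [hx, ← h x y hx]

/-- An element of the stabilizer is an extending permutation, which fixes the inner points, times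
the idempotent of its undefined points, which are outer. -/
theorem mem_cent_of_generators {m n : ℕ} {a : Alg n}
    (hperm : ∀ σ : Equiv.Perm (Fin n), (∀ x : Fin n, x.1 < m → σ x = x) →
      of σ.toPEquiv * a = a * of σ.toPEquiv)
    (heps : ∀ i : Fin n, m ≤ i.1 → eps i * a = a * eps i) : a ∈ cent m n := by
  classical
  rw [mem_cent]
  intro γ hγ
  obtain ⟨σ, hσ⟩ := exists_perm_extend γ
  have hS : ∀ S : Finset (Fin n), (∀ i ∈ S, m ≤ i.1) → of (epsSet S) * a = a * of (epsSet S) := by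
    intro S
    induction S using Finset.induction_on with
    | empty => intro _; rw [epsSet_empty, of_one, one_mul, mul_one]
    | insert i S _ ih =>
      intro h
      rw [← epsPB_mul_epsSet, of_mul, mul_assoc, ih fun j hj => h j (Finset.mem_insert_of_mem hj),
        ← mul_assoc, ← mul_assoc]
      congr 1
      exact heps i (h i (Finset.mem_insert_self _ _))
  rw [eq_perm_mul_epsSet hσ, of_mul, mul_assoc, hS, ← mul_assoc, ← mul_assoc, hperm]
  · exact fun x hx => hσ x x (hγ x hx)
  · intro i hi
    simp only [Finset.mem_filter, Finset.mem_univ, true_and] at hi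
    by_contra hc
    rw [hγ i (not_le.1 hc)] at hi
    cases hi

/-! ### Transport along injections -/

/-- `δ'` is the transport of `δ` along the injection `ι`. -/
def IsPush {n n' : ℕ} (ι : Fin n ↪ Fin n') (δ : PB n) (δ' : PB n') : Prop :=
  (∀ x, δ' (ι x) = (δ x).map ι) ∧ ∀ y, (∀ x, ι x ≠ y) → δ' y = none

/-- The condition on `ι` enters only through the diagonal correction, which depends on whether a
column is inner or outer. -/
theorem colWt_map {m n n' : ℕ} {ι : Fin n ↪ Fin n'} (hι : ∀ x, m ≤ (ι x).1 ↔ m ≤ x.1)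
    {δ : PB n} {δ' : PB n'} {k : Fin n} (h : δ' (ι k) = (δ k).map ι) (o : Option (Fin n)) :
    colWt m δ' (ι k) (o.map ι) = colWt m δ k o := by
  cases hk : δ k with
  | none =>
    rw [hk, Option.map_none] at h
    rw [colWt_none h, colWt_none hk]
  | some j =>
    rw [hk, Option.map_some] at h
    rw [colWt_some h, colWt_some hk]
    congr 1
    · cases o with
      | none => simp
      | some y => simp
    · simp [hι]

theorem perm_lt_iff {m n : ℕ} {σ : Equiv.Perm (Fin n)} (hσ : ∀ x : Fin n, x.1 < m → σ x = x)
    (x : Fin n) : m ≤ (σ x).1 ↔ m ≤ x.1 := by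
  constructor
  · intro h
    by_contra hc
    rw [hσ x (not_le.1 hc)] at h
    exact hc h
  · intro h
    by_contra hc
    have h1 := hσ (σ x) (not_le.1 hc)
    rw [σ.injective h1] at hc
    exact hc h

theorem cf_conj {m n : ℕ} {σ : Equiv.Perm (Fin n)} (hσ : ∀ x : Fin n, x.1 < m → σ x = x)
    {δ δ' : PB n} (h : IsPush σ.toEmbedding δ δ') (a : Alg n) :
    cf m δ' (of σ.toPEquiv * a * of σ.symm.toPEquiv) = cf m δ a := by
  rw [cf, colFun_mul_perm, colFun_of_mul, cf]
  congr 2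
  funext k o
  rw [← colWt_map (perm_lt_iff hσ) (h.1 k)]
  simp only [Equiv.symm_symm]
  congr 1
  cases o <;> rfl

theorem of_perm_mul_symm {n : ℕ} (σ : Equiv.Perm (Fin n)) :
    of σ.toPEquiv * of σ.symm.toPEquiv = (1 : Alg n) := by
  rw [← of_mul, ← of_one]
  congr 1
  rw [mul_def, ← Equiv.toPEquiv_trans, Equiv.symm_trans_self]
  rfl

theorem perm_comm_iff {n : ℕ} {σ : Equiv.Perm (Fin n)} {a : Alg n} :
    of σ.toPEquiv * a = a * of σ.toPEquiv ↔ of σ.toPEquiv * a * of σ.symm.toPEquiv = a := by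
  constructor
  · intro h
    rw [h, mul_assoc, of_perm_mul_symm, mul_one]
  · intro h
    conv_rhs => rw [← h]
    have := of_perm_mul_symm σ.symm
    rw [Equiv.symm_symm] at this
    rw [mul_assoc _ (of σ.symm.toPEquiv), this, mul_one]

/-- The conjugate of a partial bijection by a permutation. -/
def conjPB {n : ℕ} (σ : Equiv.Perm (Fin n)) (δ : PB n) : PB n :=
  σ.toPEquiv * δ * σ.symm.toPEquiv

theorem isPush_conjPB {n : ℕ} (σ : Equiv.Perm (Fin n)) (δ : PB n) :
    IsPush σ.toEmbedding δ (conjPB σ δ) := by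
  refine ⟨fun x => ?_, fun y hy => absurd (σ.apply_symm_apply y) (hy _)⟩
  change ((σ.symm.toPEquiv (σ x)).bind δ).bind σ.toPEquiv = _
  rw [Equiv.toPEquiv_apply, Equiv.symm_apply_apply, Option.bind_some]
  cases δ x <;> rfl

theorem stab_perm {m n : ℕ} {σ : Equiv.Perm (Fin n)} (hσ : ∀ x : Fin n, x.1 < m → σ x = x) :
    (σ.toPEquiv : PB n) ∈ stab m n := by
  intro x hx
  rw [Equiv.toPEquiv_apply, hσ x hx]

theorem cf_push_perm {m n : ℕ} {σ : Equiv.Perm (Fin n)} (hσ : ∀ x : Fin n, x.1 < m → σ x = x)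
    {δ δ' : PB n} (h : IsPush σ.toEmbedding δ δ') {a : Alg n} (ha : a ∈ cent m n) :
    cf m δ' a = cf m δ a := by
  rw [← cf_conj hσ h a, perm_comm_iff.1 (mem_cent.1 ha _ (stab_perm hσ))]

/-- The last column of δ' is empty, so its weight is 1. In the other columns δ' never takes the last
point as value, so a column of γ ending there has the same weight as an undefined one, and the
truncation by θ is invisible. -/
theorem cf_theta {m n : ℕ} {δ : PB n} {δ' : PB (n + 1)} (h : IsPush Fin.castSuccEmb δ δ')
    (a : Alg (n + 1)) : cf m δ (theta n a) = cf m δ' a := by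
  refine lin_congr ((cf m δ) ∘ₗ theta n) (cf m δ') (fun γ => ?_) a
  rw [LinearMap.comp_apply, theta_of, cf_of, cf_of, Fin.prod_univ_castSucc]
  have hl : δ' (Fin.last n) = none := h.2 _ fun x => Fin.castSucc_ne_last x
  rw [colWt_none hl, mul_one]
  refine Finset.prod_congr rfl fun k _ => ?_
  have hk : δ' k.castSucc = (δ k).map Fin.castSuccEmb := h.1 k
  rw [← colWt_map (ι := Fin.castSuccEmb) (fun _ => Iff.rfl) hk, thetaPB_apply]
  cases hγ : γ k.castSucc with
  | none => rfl
  | some y =>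
    rw [Option.bind_some, incl_symm_apply]
    by_cases hy : y.1 < n
    · rw [dif_pos hy]; rfl
    · rw [dif_neg hy, Option.map_none]
      cases hd : δ k with
      | none =>
        rw [hd] at hk
        change colWt m δ' k.castSucc none = _
        rw [colWt_none hk, colWt_none hk]
      | some j =>
        rw [hd] at hk
        change colWt m δ' k.castSucc none = _
        rw [colWt_some hk, colWt_some hk]
        have : y ≠ j.castSucc := by
          rintro rfl
          exact hy j.2
        simp [this]

/-- The coordinates of a sequence in `A_m` are invariant under transport along injections that fix
the first `m` points. -/
theorem cf_push {m : ℕ} (a : Alim m) : ∀ (n' n : ℕ) (hn' : m ≤ n') (hn : m ≤ n)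
    (ι : Fin n ↪ Fin n') (_ : ∀ x : Fin n, x.1 < m → (ι x).1 = x.1) (δ : PB n) (δ' : PB n')
    (_ : IsPush ι δ δ'), cf m δ' (a.1 ⟨n', hn'⟩) = cf m δ (a.1 ⟨n, hn⟩) := by
  intro n'
  induction n' with
  | zero =>
    intro n hn' hn ι hι δ δ' h
    have : n = 0 := by
      have := Fintype.card_le_of_embedding ι
      simpa using this
    subst this
    have : δ = δ' := by
      ext1 x
      exact x.elim0
    rw [this]
  | succ N ih =>
    intro n hn' hn ι hι δ δ' h
    by_cases hs : Surjective ι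
    · have hc : n = N + 1 := by
        have := Fintype.card_of_bijective ⟨ι.injective, hs⟩
        simpa using this
      subst hc
      let σ : Equiv.Perm (Fin (N + 1)) := Equiv.ofBijective ι ⟨ι.injective, hs⟩
      have hσ : σ.toEmbedding = ι := by ext; rfl
      exact cf_push_perm (σ := σ) (fun x hx => Fin.ext (hι x hx)) (by rwa [hσ]) (a.2.1 ⟨N + 1, hn'⟩)
    · rw [Surjective] at hs
      push Not at hs
      obtain ⟨y, hy⟩ := hs
      have hym : m ≤ y.1 := by
        by_contra hc
        exact hy ⟨y.1, by omega⟩ (Fin.ext (hι _ (not_le.1 hc)))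
      have hN : m ≤ N := by have := y.2; omega
      -- The missed point and the last point are both outer, so this transposition stabilizes the
      -- inner points. After it, δ' is undefined at the last point and `cf_theta` lowers the level.
      let σ : Equiv.Perm (Fin (N + 1)) := Equiv.swap y (Fin.last N)
      have hσ : ∀ x : Fin (N + 1), x.1 < m → σ x = x := by
        intro x hx
        refine Equiv.swap_apply_of_ne_of_ne ?_ ?_
        · rintro rfl; omega
        · rintro rfl; simp at hx; omega
      have hlast : ∀ x, σ (ι x) ≠ Fin.last N := by
        intro x hx
        have : ι x = y := by
          apply σ.injective
          rw [hx]
          exact (Equiv.swap_apply_left _ _).symm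
        exact hy x this
      have hlt : ∀ x, (σ (ι x)).1 < N := fun x => by
        have := (σ (ι x)).2
        have h2 : (σ (ι x)).1 ≠ N := fun h => hlast x (Fin.ext h)
        omega
      let κ : Fin n ↪ Fin N := ⟨fun x => ⟨(σ (ι x)).1, hlt x⟩, fun x z hxz => by
        apply ι.injective
        apply σ.injective
        apply Fin.ext
        exact Fin.mk.inj_iff.1 hxz⟩
      have hκ : ∀ x, (κ x).castSucc = σ (ι x) := fun x => rfl
      set δ₂ := conjPB σ δ' with hδ₂
      have h2 := isPush_conjPB σ δ'
      rw [← cf_push_perm hσ h2 (a.2.1 ⟨N + 1, hn'⟩)]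
      have hval : ∀ x, δ₂ (κ x).castSucc = ((δ x).map κ).map Fin.castSuccEmb := by
        intro x
        rw [hκ x]
        have := h2.1 (ι x)
        rw [h.1] at this
        refine this.trans ?_
        cases δ x <;> rfl
      have hval2 : ∀ z : Fin (N + 1), (∀ x, (κ x).castSucc ≠ z) → δ₂ z = none := by
        intro z hz
        obtain ⟨w, rfl⟩ := σ.surjective z
        have hw : δ' w = none := h.2 w (by
          rintro x rfl
          exact hz x (hκ x))
        have := h2.1 w
        rw [hw] at this
        exact this
      have hκm : ∀ x : Fin n, x.1 < m → (κ x).1 = x.1 := by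
        intro x hx
        have h1 := hι x hx
        have h2 : σ (ι x) = ι x := hσ _ (by omega)
        have h3 : (κ x).1 = (σ (ι x)).1 := rfl
        rw [h3, h2, h1]
      have hth : ∀ x, thetaPB N δ₂ (κ x) = (δ x).map κ := by
        intro x
        rw [thetaPB_apply, hval x]
        cases δ x with
        | none => rfl
        | some z => simp [incl_symm_apply]
      have hp1 : IsPush κ δ (thetaPB N δ₂) := by
        refine ⟨hth, fun z hz => ?_⟩
        rw [thetaPB_apply, hval2]
        · rfl
        · exact fun x hx => hz x (Fin.castSucc_injective _ hx)
      have hp2 : IsPush Fin.castSuccEmb (thetaPB N δ₂) δ₂ := by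
        refine ⟨fun z => ?_, fun z hz => ?_⟩
        · by_cases hzr : ∃ x, κ x = z
          · obtain ⟨x, rfl⟩ := hzr
            rw [hth]
            exact hval x
          · push Not at hzr
            rw [hp1.2 z hzr]
            exact hval2 _ fun x hx => hzr x (Fin.castSucc_injective _ hx)
        · exact hval2 _ fun x hx => hz (κ x) hx
      rw [← ih n hN hn κ hκm δ _ hp1, ← a.2.2.1 N hN]
      exact (cf_theta hp2 _).symm

/-- For outer i the idempotent ε_i lies in the stabilizer, hence commutes with each component. -/
theorem cf_support {m : ℕ} (a : Alim m) {n : ℕ} (hn : m ≤ n) {δ : PB n}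
    (h : cf m δ (a.1 ⟨n, hn⟩) ≠ 0) (i : Fin n) (hi : m ≤ i.1) :
    δ i = none ↔ δ.symm i = none :=
  (eps_comm_iff m).1 (mem_cent.1 (a.2.1 ⟨n, hn⟩) _ (epsPB_mem_stab i hi)) δ h

/-! ### The filtration of the projective limit -/

/-- The elements of `A_m` all of whose components lie in the filtration step `d`. -/
def limFilt (m d : ℕ) : Submodule ℂ (Alim m) where
  carrier := {a | ∀ n, a.1 n ∈ outFilt m n.1 d}
  add_mem' ha hb n := add_mem (ha n) (hb n)
  zero_mem' _ := zero_mem _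
  smul_mem' c _ ha n := Submodule.smul_mem _ c (ha n)

theorem limFilt_mono {m d e : ℕ} (h : d ≤ e) : limFilt m d ≤ limFilt m e :=
  fun _ ha n => outFilt_mono h (ha n)

theorem limFilt_zero {m : ℕ} : limFilt m 0 = ⊥ := by
  rw [eq_bot_iff]
  intro a ha
  apply Subtype.ext
  funext n
  have := ha n
  rw [outFilt_zero] at this
  exact this

theorem exists_mem_limFilt {m : ℕ} (a : Alim m) : ∃ d, a ∈ limFilt m d := by
  obtain ⟨M, hM⟩ := a.2.2.2
  -- The shift by one turns the bound `deg ≤ M` into the strict inequality in the definition of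
  -- `outFilt`.
  refine ⟨M + 1, fun n => ?_⟩
  refine Submodule.span_mono (Set.image_mono fun γ hγ => ?_) (hM n)
  refine Nat.lt_succ_of_le (le_trans (Finset.card_le_card fun k hk => ?_) hγ)
  simp only [Finset.mem_filter, Finset.mem_univ, true_and] at hk ⊢
  exact hk.2

/-- Converse of `cf_eq_zero`. It needs no support hypothesis, since elements of A_m satisfy it
automatically. -/
theorem mem_limFilt_of_cf {m d : ℕ} {a : Alim m}
    (h : ∀ (n : ℕ) (hn : m ≤ n) (δ : PB n), d ≤ cnt m δ → cf m δ (a.1 ⟨n, hn⟩) = 0) :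
    a ∈ limFilt m d := fun n =>
  mem_outFilt_of_cf (fun _ i hi hδ h1 => (cf_support a n.2 hδ i hi).1 h1) (h n.1 n.2)

/-- At most m inner points can be moved as well. This gives the uniform degree bound for sequences
built from coordinates. -/
theorem outFilt_le_filt {m n d : ℕ} : outFilt m n d ≤ filt n (m + d) := by
  refine Submodule.span_mono (Set.image_mono fun γ hγ => ?_)
  have hsub : (Finset.univ.filter fun i : Fin n => γ i ≠ some i) ⊆
      (Finset.univ.filter fun k : Fin n => m ≤ k.1 ∧ γ k ≠ some k) ∪
        Finset.univ.filter fun k : Fin n => k.1 < m := by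
    intro k hk
    simp only [Finset.mem_filter, Finset.mem_univ, true_and, Finset.mem_union] at hk ⊢
    by_cases h : k.1 < m
    · exact Or.inr h
    · exact Or.inl ⟨not_lt.1 h, hk⟩
  have h1 : (Finset.univ.filter fun k : Fin n => k.1 < m).card ≤ m := by
    rw [← Finset.card_map Fin.valEmbedding]
    refine le_trans (Finset.card_le_card (t := Finset.range m) fun x hx => ?_) (by simp)
    simp only [Finset.mem_map, Finset.mem_filter, Finset.mem_univ, true_and] at hx
    obtain ⟨y, hy, rfl⟩ := hx
    simpa using hy
  have h2 := le_trans (Finset.card_le_card hsub) (Finset.card_union_le _ _)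
  have h3 : odeg m γ < d := hγ
  unfold odeg at h3
  change (Finset.univ.filter fun i : Fin n => γ i ≠ some i).card ≤ m + d
  omega

theorem isPush_up {n : ℕ} (δ : PB n) :
    IsPush Fin.castSuccEmb δ (phiPB (Nat.le_succ n) δ * epsPB (Fin.last n)) := by
  refine ⟨fun x => ?_, fun y hy => ?_⟩
  · change (epsPB (Fin.last n) x.castSucc).bind _ = _
    rw [epsPB_apply, if_neg (Fin.castSucc_ne_last x), Option.bind_some,
      phiPB_apply_lt _ _ _ (by simp)]
    rfl
  · have : y = Fin.last n := by
      by_contra hc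
      obtain ⟨z, hz⟩ := Fin.exists_castSucc_eq.2 hc
      exact hy z hz
    subst this
    rw [mul_apply, epsPB_apply, if_pos rfl]
    rfl

/-- A family of coordinates that is invariant under transport, supported on the partial bijections
with the same domain and image beyond `m`, and bounded, is that of an element of `A_m`. -/
theorem exists_of_coord (m d : ℕ) (g : ∀ n, PB n → ℂ)
    (hpush : ∀ (n' n : ℕ) (_ : m ≤ n') (_ : m ≤ n) (ι : Fin n ↪ Fin n')
      (_ : ∀ x : Fin n, x.1 < m → (ι x).1 = x.1) (δ : PB n) (δ' : PB n') (_ : IsPush ι δ δ'),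
      g n' δ' = g n δ)
    (hsupp : ∀ (n : ℕ) (_ : m ≤ n) (δ : PB n) (_ : g n δ ≠ 0) (i : Fin n) (_ : m ≤ i.1),
      δ i = none ↔ δ.symm i = none)
    (hbd : ∀ (n : ℕ) (_ : m ≤ n) (δ : PB n), d ≤ cnt m δ → g n δ = 0) :
    ∃ a : Alim m, a ∈ limFilt m d ∧
      ∀ (n : ℕ) (hn : m ≤ n) (δ : PB n), cf m δ (a.1 ⟨n, hn⟩) = g n δ := by
  have hF : ∀ n : Set.Ici m, ofCoord m (g n.1) ∈ outFilt m n.1 d := fun n => by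
    refine mem_outFilt_of_cf (fun δ i hi hδ h1 => ?_) fun δ hδ => ?_
    · rw [cf_ofCoord] at hδ
      exact (hsupp n.1 n.2 δ hδ i hi).1 h1
    · rw [cf_ofCoord]
      exact hbd n.1 n.2 δ hδ
  refine ⟨⟨fun n => ofCoord m (g n.1), fun n => ?_, fun n hn => ?_, m + d, fun n => ?_⟩, hF,
    fun n hn δ => cf_ofCoord m _ δ⟩
  · refine mem_cent_of_generators (fun σ hσ => ?_) fun i hi => ?_
    · rw [perm_comm_iff]
      refine cf_injective m fun δ => ?_
      have h1 := isPush_conjPB σ.symm δ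
      have h2 : IsPush σ.toEmbedding (conjPB σ.symm δ) δ := by
        have h3 := isPush_conjPB σ (conjPB σ.symm δ)
        have h4 : conjPB σ (conjPB σ.symm δ) = δ := by
          ext1 x
          change ((((σ.symm.toPEquiv x).bind σ.symm.symm.toPEquiv).bind δ).bind
            σ.symm.toPEquiv).bind σ.toPEquiv = δ x
          simp only [Equiv.toPEquiv_apply, Option.bind_some, Equiv.symm_symm,
            Equiv.apply_symm_apply]
          cases δ x <;> simp
        rwa [h4] at h3
      rw [cf_conj hσ h2, cf_ofCoord, cf_ofCoord]
      exact (hpush n.1 n.1 n.2 n.2 σ.toEmbedding (fun x hx => congrArg Fin.val (hσ x hx)) _ _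
        h2).symm
    · rw [eps_comm_iff m]
      intro δ hδ
      rw [cf_ofCoord] at hδ
      exact hsupp n.1 n.2 δ hδ i hi
  · refine cf_injective m fun δ => ?_
    rw [cf_theta (isPush_up δ), cf_ofCoord, cf_ofCoord]
    exact hpush _ _ (Nat.le_succ_of_le hn) hn Fin.castSuccEmb (fun _ _ => rfl) _ _ (isPush_up δ)
  · exact outFilt_le_filt (hF n)

/-! ### Leading coordinates of products -/

/-- The diagonal correction cancels in this difference; this is what a factor 1 - ε_k produces. -/
theorem colWt_sub_none {m n : ℕ} (δ : PB n) (k : Fin n) (o : Option (Fin n)) :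
    colWt m δ k o - colWt m δ k none = if o = δ k ∧ (δ k).isSome then 1 else 0 := by
  cases hk : δ k with
  | none => simp [colWt_none hk]
  | some j => simp [colWt_some hk]

/-- The transposition exchanges the two columns, and the two idempotent factors subtract from each
weight its value at `none`. -/
theorem colFun_mul_term {n : ℕ} (w : Fin n → Option (Fin n) → ℂ) {k i : Fin n} (h : k ≠ i)
    (b : Alg n) :
    colFun w (b * (swapEl k i * (1 - eps k) * (1 - eps i))) =
      colFun (update (update w k fun o => w i o - w i none) i fun o => w k o - w k none) b := by
  rw [← mul_assoc, ← mul_assoc, colFun_mul_one_sub_eps, colFun_mul_one_sub_eps, swapEl, swapPB,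
    colFun_mul_perm]
  congr 2
  funext j
  rw [Equiv.symm_swap]
  by_cases h1 : j = i
  · subst h1
    rw [Equiv.swap_apply_right, update_self, update_self, update_of_ne h]
  · rw [update_of_ne h1]
    by_cases h2 : j = k
    · subst h2
      rw [Equiv.swap_apply_left, update_self, update_of_ne h.symm, update_self]
    · rw [Equiv.swap_apply_of_ne_of_ne h2 h1, update_of_ne h2, update_of_ne h2, update_of_ne h1]

/-- If δ is undefined at i, the new weight of column k is identically zero. Otherwise the outer
columns of the domain other than i still vanish on the diagonal. Column i fails to do so only if
δ(k) = i; if i is also outer, one vanishing column is lost, which is harmless when `cnt m δ` exceeds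
d. In every excluded case at least d columns kill b. -/
theorem cf_mul_term_eq_zero {m n d : ℕ} {δ : PB n} (hd : d ≤ cnt m δ) {k i : Fin n} (hk : k.1 < m)
    (hki : k ≠ i) (h : ¬ (m ≤ i.1 ∧ cnt m δ = d ∧ δ k = some i ∧ (δ i).isSome)) {b : Alg n}
    (hb : b ∈ outFilt m n d) :
    cf m δ (b * (swapEl k i * (1 - eps k) * (1 - eps i))) = 0 := by
  rw [cf, colFun_mul_term _ hki]
  by_cases hi0 : (δ i).isSome
  swap
  · refine colFun_update_zero _ k (fun o => ?_) b
    rw [update_of_ne hki, update_self, colWt_sub_none, if_neg fun hc => hi0 hc.2]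
  have hother : ∀ j : Fin n, m ≤ j.1 → j ≠ i → (δ j).isSome →
      update (update (colWt m δ) k fun o => colWt m δ i o - colWt m δ i none) i
        (fun o => colWt m δ k o - colWt m δ k none) j (some j) = 0 := by
    intro j hj hji hs
    have hjk : j ≠ k := by rintro rfl; omega
    rw [update_of_ne hji, update_of_ne hjk, colWt_self hj hs]
  refine colFun_eq_zero ?_ hb
  by_cases hcase : m ≤ i.1 ∧ δ k = some i
  · have hlt : d < cnt m δ := by
      refine lt_of_le_of_ne hd fun he => h ⟨hcase.1, he.symm, hcase.2, hi0⟩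
    have h1 : (Finset.univ.filter fun j : Fin n => m ≤ j.1 ∧ (δ j).isSome).card - 1 ≤
        ((Finset.univ.filter fun j : Fin n => m ≤ j.1 ∧ (δ j).isSome).erase i).card :=
      Finset.pred_card_le_card_erase
    refine le_trans (le_trans (Nat.le_pred_of_lt hlt) h1) (Finset.card_le_card fun j hj => ?_)
    simp only [Finset.mem_erase, Finset.mem_filter, Finset.mem_univ, true_and] at hj ⊢
    exact ⟨hj.2.1, hother j hj.2.1 hj.1 hj.2.2⟩
  · refine le_trans hd (Finset.card_le_card fun j hj => ?_)
    simp only [Finset.mem_filter, Finset.mem_univ, true_and] at hj ⊢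
    refine ⟨hj.1, ?_⟩
    by_cases hji : j = i
    · subst hji
      rw [update_self, colWt_sub_none, if_neg]
      exact fun hc => hcase ⟨hj.1, hc.1.symm⟩
    · exact hother j hj.1 hji hj.2

/-- Removal of the point `i` that follows `k`. -/
def peelPB {n : ℕ} (k i : Fin n) (δ : PB n) : PB n := δ * swapPB k i * epsPB i

theorem peelPB_self {n : ℕ} (k i : Fin n) (δ : PB n) : peelPB k i δ i = none := by
  rw [peelPB, mul_apply, epsPB_apply, if_pos rfl]; rfl

theorem peelPB_left {n : ℕ} {k i : Fin n} (h : k ≠ i) (δ : PB n) : peelPB k i δ k = δ i := by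
  rw [peelPB, mul_apply, epsPB_apply, if_neg h, Option.bind_some, mul_apply, swapPB_apply,
    Equiv.swap_apply_left, Option.bind_some]

theorem peelPB_of_ne {n : ℕ} {k i j : Fin n} (hk : j ≠ k) (hi : j ≠ i) (δ : PB n) :
    peelPB k i δ j = δ j := by
  rw [peelPB, mul_apply, epsPB_apply, if_neg hi, Option.bind_some, mul_apply, swapPB_apply,
    Equiv.swap_apply_of_ne_of_ne hk hi, Option.bind_some]

theorem cnt_peelPB {m n : ℕ} {k i : Fin n} (hk : k.1 < m) (hi : m ≤ i.1) {δ : PB n}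
    (hs : (δ i).isSome) : cnt m (peelPB k i δ) + 1 = cnt m δ := by
  have hmem : i ∈ Finset.univ.filter fun j : Fin n => m ≤ j.1 ∧ (δ j).isSome := by simp [hi, hs]
  rw [cnt, cnt, ← Finset.card_erase_add_one hmem]
  congr 2
  ext j
  simp only [Finset.mem_erase, Finset.mem_filter, Finset.mem_univ, true_and]
  by_cases hji : j = i
  · subst hji; simp [peelPB_self]
  · by_cases hj : m ≤ j.1
    · rw [peelPB_of_ne (by rintro rfl; omega) hji]
      simp [hj, hji]
    · simp [hj]

/-- The weight of column i is now the indicator of the value i. Written as 1 minus the complementary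
indicator, it splits the functional in two. The complementary part vanishes on the diagonal at i and
so kills b; the part with weight 1 is the coordinate of the partial bijection with i removed. Column
k tests δ(i) without correction because k is inner. -/
theorem cf_mul_term_of_eq {m n d : ℕ} {δ : PB n} (hd : d ≤ cnt m δ) {k i : Fin n} (hk : k.1 < m)
    (hi : m ≤ i.1) (h : δ k = some i) (hs : (δ i).isSome) {b : Alg n} (hb : b ∈ outFilt m n d) :
    cf m δ (b * (swapEl k i * (1 - eps k) * (1 - eps i))) = cf m (peelPB k i δ) b := by
  have hki : k ≠ i := by rintro rfl; omega
  rw [cf, colFun_mul_term _ hki]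
  set w := update (colWt m δ) k fun o => colWt m δ i o - colWt m δ i none with hw
  have h1 : (fun o => colWt m δ k o - colWt m δ k none) =
      fun o : Option (Fin n) => 1 - if o = some i then (0 : ℂ) else 1 := by
    funext o
    rw [colWt_sub_none, h]
    by_cases ho : o = some i <;> simp [ho]
  have h2 : colFun (update w i fun o : Option (Fin n) => if o = some i then (0 : ℂ) else 1) b
      = 0 := by
    refine colFun_eq_zero (le_trans hd (Finset.card_le_card fun j hj => ?_)) hb
    simp only [Finset.mem_filter, Finset.mem_univ, true_and] at hj ⊢
    refine ⟨hj.1, ?_⟩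
    by_cases hji : j = i
    · subst hji; rw [update_self, if_pos rfl]
    · rw [update_of_ne hji, hw, update_of_ne (by rintro rfl; omega), colWt_self hj.1 hj.2]
  rw [h1, colFun_update_sub w i (fun _ => 1), h2, sub_zero, cf]
  congr 2
  funext j o
  by_cases hji : j = i
  · subst hji
    rw [update_self, colWt_none (peelPB_self _ _ _)]
  · rw [update_of_ne hji, hw]
    by_cases hjk : j = k
    · subst hjk
      rw [update_self, colWt_sub_none]
      obtain ⟨l, hl⟩ := Option.isSome_iff_exists.1 hs
      rw [colWt_some (j := l) (by rw [peelPB_left hki, hl]), hl]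
      simp [not_le.2 hk]
    · rw [update_of_ne hjk, colWt, colWt, peelPB_of_ne hjk hji]

theorem cf_mul_uEl_eq_zero {m n d : ℕ} {δ : PB n} (hd : d ≤ cnt m δ) {k : Fin n} (hk : k.1 < m)
    (h : ¬ (cnt m δ = d ∧ ∃ i, m ≤ i.1 ∧ δ k = some i ∧ (δ i).isSome)) {b : Alg n}
    (hb : b ∈ outFilt m n d) : cf m δ (b * uEl k) = 0 := by
  rw [uEl, Finset.mul_sum, map_sum]
  refine Finset.sum_eq_zero fun i hi => ?_
  simp only [Finset.mem_filter, Finset.mem_univ, true_and] at hi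
  exact cf_mul_term_eq_zero hd hk hi.ne (fun hc => h ⟨hc.2.1, i, hc.1, hc.2.2⟩) hb

/-- Only the summand of u_k with index δ(k) contributes in top degree. -/
theorem cf_mul_uEl_of_eq {m n d : ℕ} {δ : PB n} (hd : d ≤ cnt m δ) {k i : Fin n} (hk : k.1 < m)
    (hi : m ≤ i.1) (h : δ k = some i) (hs : (δ i).isSome) {b : Alg n} (hb : b ∈ outFilt m n d) :
    cf m δ (b * uEl k) = cf m (peelPB k i δ) b := by
  rw [uEl, Finset.mul_sum, map_sum, Finset.sum_eq_single i]
  · exact cf_mul_term_of_eq hd hk hi h hs hb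
  · intro j hj hji
    simp only [Finset.mem_filter, Finset.mem_univ, true_and] at hj
    refine cf_mul_term_eq_zero hd hk hj.ne (fun hc => hji ?_) hb
    have := hc.2.2.1
    rw [h, Option.some.injEq] at this
    exact this.symm
  · intro hc
    simp only [Finset.mem_filter, Finset.mem_univ, true_and, Fin.lt_def] at hc
    omega

/-- The restriction to the points `k ≥ m`. -/
def outPB (m : ℕ) {n : ℕ} (δ : PB n) : PB n := δ * epsSet (Finset.univ.filter fun k => k.1 < m)

/-- The restriction to the points `k < m`. -/
def inPB (m : ℕ) {n : ℕ} (δ : PB n) : PB n := δ * epsSet (Finset.univ.filter fun k => m ≤ k.1)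

theorem outPB_lt {m n : ℕ} (δ : PB n) {k : Fin n} (hk : k.1 < m) : outPB m δ k = none := by
  simp [outPB, mul_apply, epsSet_apply, hk]

theorem outPB_ge {m n : ℕ} (δ : PB n) {k : Fin n} (hk : m ≤ k.1) : outPB m δ k = δ k := by
  simp [outPB, mul_apply, epsSet_apply, not_lt.2 hk]

theorem inPB_lt {m n : ℕ} (δ : PB n) {k : Fin n} (hk : k.1 < m) : inPB m δ k = δ k := by
  simp [inPB, mul_apply, epsSet_apply, not_le.2 hk]

theorem inPB_ge {m n : ℕ} (δ : PB n) {k : Fin n} (hk : m ≤ k.1) : inPB m δ k = none := by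
  simp [inPB, mul_apply, epsSet_apply, hk]

/-- If α fixes some outer point of the domain of δ, both sides vanish at that column. Otherwise α
moves all of these at least d points; as it moves at most d points in all, it fixes every inner
point, and then α and γ act in separate columns. -/
theorem cf_of_mul_phi {m n d : ℕ} (hn : m ≤ n) {δ : PB n} (hd : d ≤ cnt m δ) {α : PB n}
    (hα : odeg 0 α < d + 1) (γ : PB m) :
    cf m δ (of α * of (phiPB hn γ)) =
      cf 0 (outPB m δ) (of α) * cf m (inPB m δ) (of (phiPB hn γ)) := by
  rw [← of_mul, cf_of, cf_of, cf_of, ← Finset.prod_mul_distrib]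
  by_cases hall : ∀ k : Fin n, m ≤ k.1 → (δ k).isSome → α k ≠ some k
  · have hfix : ∀ k : Fin n, k.1 < m → α k = some k := by
      intro k hk
      by_contra hne
      have hsub : insert k (Finset.univ.filter fun k : Fin n => m ≤ k.1 ∧ (δ k).isSome) ⊆
          Finset.univ.filter fun k : Fin n => 0 ≤ k.1 ∧ α k ≠ some k := by
        intro j hj
        simp only [Finset.mem_insert, Finset.mem_filter, Finset.mem_univ, true_and] at hj ⊢
        rcases hj with rfl | hj
        · exact ⟨Nat.zero_le _, hne⟩
        · exact ⟨Nat.zero_le _, hall j hj.1 hj.2⟩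
      have h1 := Finset.card_le_card hsub
      rw [Finset.card_insert_of_notMem (by simp [hk])] at h1
      unfold cnt at hd
      unfold odeg at hα
      omega
    refine Finset.prod_congr rfl fun k _ => ?_
    rw [mul_apply]
    by_cases hk : m ≤ k.1
    · rw [phiPB_apply_ge _ _ _ (not_lt.2 hk), Option.bind_some, colWt_none (inPB_ge δ hk), mul_one,
        colWt, colWt, outPB_ge δ hk]
      simp [hk]
    · rw [colWt_none (outPB_lt δ (not_le.1 hk)), one_mul, colWt, colWt,
        inPB_lt δ (not_le.1 hk)]
      congr 1
      rw [phiPB_apply_lt _ _ _ (not_le.1 hk)]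
      cases γ ⟨k.1, not_le.1 hk⟩ with
      | none => rfl
      | some y => 
        rw [Option.map_some, Option.bind_some, hfix _ y.2]
  · push Not at hall
    obtain ⟨k, hk, hs, hfix⟩ := hall
    rw [Finset.prod_eq_zero (Finset.mem_univ k), Finset.prod_eq_zero (Finset.mem_univ k)]
    · rw [hfix, colWt_self (Nat.zero_le _) (by rwa [outPB_ge δ hk]), zero_mul]
    · rw [mul_apply, phiPB_apply_ge _ _ _ (not_lt.2 hk), Option.bind_some, hfix, colWt_self hk hs]

theorem cf_mul_phi {m n d : ℕ} (hn : m ≤ n) {δ : PB n} (hd : d ≤ cnt m δ) {a : Alg n}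
    (ha : a ∈ outFilt 0 n (d + 1)) (z : Alg m) :
    cf m δ (a * phi hn z) = cf 0 (outPB m δ) a * cf m (inPB m δ) (phi hn z) := by
  have h1 : ∀ α : PB n, odeg 0 α < d + 1 → cf m δ (of α * phi hn z) =
      cf 0 (outPB m δ) (of α) * cf m (inPB m δ) (phi hn z) := by
    intro α hα
    refine lin_congr (cf m δ ∘ₗ LinearMap.mulLeft ℂ (of α) ∘ₗ (phi hn).toLinearMap)
      (cf 0 (outPB m δ) (of α) • (cf m (inPB m δ) ∘ₗ (phi hn).toLinearMap)) (fun γ => ?_) z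
    simp only [LinearMap.comp_apply, LinearMap.smul_apply, AlgHom.toLinearMap_apply, smul_eq_mul,
      LinearMap.mulLeft_apply]
    rw [phi_of]
    exact cf_of_mul_phi hn hd hα γ
  induction ha using Submodule.span_induction with
  | mem x hx =>
    obtain ⟨α, hα, rfl⟩ := hx
    exact h1 α hα
  | zero => simp
  | add x y _ _ hx hy => rw [add_mul, map_add, hx, hy, map_add, add_mul]
  | smul r x _ hx => rw [smul_mul_assoc, map_smul, hx, map_smul, smul_mul_assoc]

theorem cf_phi_eq_zero {m n : ℕ} (hn : m ≤ n) {δ : PB n} {k i : Fin n} (hk : k.1 < m)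
    (hi : m ≤ i.1) (h : δ k = some i) (z : Alg m) : cf m δ (phi hn z) = 0 := by
  refine lin_congr (cf m δ ∘ₗ (phi hn).toLinearMap) 0 (fun γ => ?_) z
  rw [LinearMap.comp_apply, AlgHom.toLinearMap_apply, phi_of, cf_of]
  refine Finset.prod_eq_zero (Finset.mem_univ k) ?_
  rw [colWt_some h, phiPB_apply_lt _ _ _ hk]
  cases γ ⟨k.1, hk⟩ with
  | none => simp [not_le.2 hk]
  | some y =>
    have : Fin.castLE hn y ≠ i := by
      rintro rfl
      exact absurd y.2 (not_lt.2 hi)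
    simp [not_le.2 hk, this]

/-- This is `cf_push` for a constant sequence. -/
theorem cf_phi {m n : ℕ} (hn : m ≤ n) {β : PB m} {δ : PB n}
    (h : IsPush (Fin.castLEEmb hn) β δ) (z : Alg m) : cf m δ (phi hn z) = cf m β z := by
  have := cf_push (const m z) n m hn le_rfl (Fin.castLEEmb hn) (fun _ _ => rfl) β δ h
  refine this.trans ?_
  change cf m β (phi le_rfl z) = _
  rw [phi_refl]

/-! ### The filtration and products in the projective limit -/

theorem fromA0_mem_limFilt {m d : ℕ} {a : Alim 0} (ha : a ∈ limFilt 0 d) :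
    fromA0 m a ∈ limFilt m d := by
  intro n
  refine Submodule.span_mono (Set.image_mono fun γ hγ => ?_) (ha ⟨n.1, Nat.zero_le _⟩)
  refine lt_of_le_of_lt (Finset.card_le_card fun k hk => ?_) hγ
  simp only [Finset.mem_filter, Finset.mem_univ, true_and] at hk ⊢
  exact ⟨Nat.zero_le _, hk.2⟩

/-- An element of Γ(m) fixes the outer points, so right multiplication by it cannot make a further
outer point move. -/
theorem mul_const_mem_limFilt {m d : ℕ} {a : Alim m} (ha : a ∈ limFilt m d) (z : Alg m) :
    a * const m z ∈ limFilt m d := by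
  rintro ⟨n, hn⟩
  replace hn : m ≤ n := hn
  change a.1 ⟨n, hn⟩ * phi hn z ∈ _
  have h1 : ∀ γ : PB m, a.1 ⟨n, hn⟩ * of (phiPB hn γ) ∈ outFilt m n d := by
    intro γ
    have h2 := Submodule.mem_map_of_mem (f := LinearMap.mulRight ℂ (of (phiPB hn γ))) (ha ⟨n, hn⟩)
    rw [outFilt, Submodule.map_span] at h2
    refine Submodule.span_le.2 ?_ h2
    rintro _ ⟨_, ⟨α, hα, rfl⟩, rfl⟩
    rw [LinearMap.mulRight_apply, ← of_mul]
    refine of_mem_outFilt (lt_of_le_of_lt (Finset.card_le_card fun k hk => ?_) hα)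
    simp only [Finset.mem_filter, Finset.mem_univ, true_and] at hk ⊢
    refine ⟨hk.1, ?_⟩
    have := hk.2
    rwa [mul_apply, phiPB_apply_ge _ _ _ (not_lt.2 hk.1), Option.bind_some] at this
  induction z using MonoidAlgebra.induction_on with
  | of γ =>
    change a.1 ⟨n, hn⟩ * phi hn (of γ) ∈ _
    rw [phi_of]
    exact h1 γ
  | add p q hp hq => rw [map_add, mul_add]; exact add_mem hp hq
  | smul r p hp => rw [map_smul, mul_smul_comm]; exact Submodule.smul_mem _ _ hp

/-- A nonzero coordinate of the product with `cnt m δ ≥ d` must have `cnt m δ = d`. -/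
theorem mul_uLim_mem_limFilt {m d : ℕ} {b : Alim m} (hb : b ∈ limFilt m d) (x : Fin m) :
    b * uLim x ∈ limFilt m (d + 1) := by
  refine mem_limFilt_of_cf fun n hn δ hδ => ?_
  refine cf_mul_uEl_eq_zero (d := d) (by omega) (k := Fin.castLE hn x) x.2 (fun hc => ?_)
    (hb ⟨n, hn⟩)
  omega

/-! ### Insertion of a point -/

/-- Insertion of the last point after `k`. -/
def insPB {n : ℕ} (k : Fin n) (β : PB n) : PB (n + 1) :=
  phiPB (Nat.le_succ n) β * swapPB k.castSucc (Fin.last n)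

theorem insPB_self {n : ℕ} (k : Fin n) (β : PB n) :
    insPB k β k.castSucc = some (Fin.last n) := by
  rw [insPB, mul_apply, swapPB_apply, Equiv.swap_apply_left, Option.bind_some,
    phiPB_apply_ge _ _ _ (by simp)]

theorem insPB_last {n : ℕ} (k : Fin n) (β : PB n) :
    insPB k β (Fin.last n) = (β k).map Fin.castSucc := by
  rw [insPB, mul_apply, swapPB_apply, Equiv.swap_apply_right, Option.bind_some,
    phiPB_apply_lt _ _ _ (by simp)]
  rfl

theorem insPB_of_ne {n : ℕ} {k j : Fin n} (h : j ≠ k) (β : PB n) :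
    insPB k β j.castSucc = (β j).map Fin.castSucc := by
  rw [insPB, mul_apply, swapPB_apply, Equiv.swap_apply_of_ne_of_ne, Option.bind_some,
    phiPB_apply_lt _ _ _ (by simp)]
  · rfl
  · exact fun hc => h (Fin.castSucc_injective _ hc)
  · exact Fin.castSucc_ne_last j

theorem peelPB_insPB {n : ℕ} (k : Fin n) (β : PB n) :
    peelPB k.castSucc (Fin.last n) (insPB k β) =
      phiPB (Nat.le_succ n) β * epsPB (Fin.last n) := by
  have : swapPB k.castSucc (Fin.last n) * swapPB k.castSucc (Fin.last n) = 1 := by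
    ext1 x
    simp [mul_apply, swapPB_apply, one_apply]
  rw [peelPB, insPB, mul_assoc (phiPB _ β), this, mul_one]

theorem cnt_push {m n n' : ℕ} {ι : Fin n ↪ Fin n'} (hι : ∀ x, m ≤ (ι x).1 ↔ m ≤ x.1)
    {δ : PB n} {δ' : PB n'} (h : IsPush ι δ δ') : cnt m δ' = cnt m δ := by
  unfold cnt
  rw [← Finset.card_map ι]
  congr 1
  ext y
  simp only [Finset.mem_filter, Finset.mem_univ, true_and, Finset.mem_map]
  constructor
  · rintro ⟨h1, h2⟩
    by_cases hy : ∃ x, ι x = y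
    · obtain ⟨x, rfl⟩ := hy
      rw [h.1, Option.isSome_map] at h2
      exact ⟨x, ⟨(hι x).1 h1, h2⟩, rfl⟩
    · push Not at hy
      rw [h.2 y hy] at h2
      simp at h2
  · rintro ⟨x, ⟨h1, h2⟩, rfl⟩
    rw [h.1, Option.isSome_map]
    exact ⟨(hι x).2 h1, h2⟩

theorem cnt_insPB {m n : ℕ} {k : Fin n} (hk : k.1 < m) (hn : m ≤ n) {β : PB n}
    (hs : (β k).isSome) : cnt m (insPB k β) = cnt m β + 1 := by
  rw [← cnt_peelPB (k := k.castSucc) (i := Fin.last n) hk (by simpa using hn)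
    (by rwa [insPB_last, Option.isSome_map]), peelPB_insPB,
    cnt_push (ι := Fin.castSuccEmb) (fun _ => Iff.rfl) (isPush_up β)]

/-- Leading coordinates of a product with `u_x` at a partial bijection with an inserted point. -/
theorem cf_mul_uLim_insPB {m n d : ℕ} (hn : m ≤ n) {β : PB n} (x : Fin m)
    (hs : (β (Fin.castLE hn x)).isSome) (hd : d ≤ cnt m β + 1) {b : Alim m} (hb : b ∈ limFilt m d) :
    cf m (insPB (Fin.castLE hn x) β) ((b * uLim x).1 ⟨n + 1, Nat.le_succ_of_le hn⟩) =
      cf m β (b.1 ⟨n, hn⟩) := by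
  have hk : (Fin.castLE hn x).1 < m := x.2
  have h1 := cf_mul_uEl_of_eq (δ := insPB (Fin.castLE hn x) β) (d := d)
    (by rw [cnt_insPB hk hn hs]; exact hd) hk (by simpa using hn)
    (insPB_self (Fin.castLE hn x) β) (by rwa [insPB_last, Option.isSome_map])
    (hb ⟨n + 1, Nat.le_succ_of_le hn⟩)
  refine Eq.trans ?_ (h1.trans ?_)
  · rfl
  · rw [peelPB_insPB]
    exact cf_push b (n + 1) n (Nat.le_succ_of_le hn) hn Fin.castSuccEmb (fun _ _ => rfl) _ _
      (isPush_up β)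

/-- A partial bijection with `δ k = i` is, up to transport, obtained by inserting a point. -/
theorem isPush_insPB_peelPB {n : ℕ} {k i : Fin n} (hki : k ≠ i) {δ : PB n} (h : δ k = some i) :
    IsPush (Fin.castSuccEmb.trans (Equiv.swap i.castSucc (Fin.last n)).toEmbedding) δ
      (insPB k (peelPB k i δ)) := by
  have hι : ∀ x : Fin n, x ≠ i →
      (Fin.castSuccEmb.trans (Equiv.swap i.castSucc (Fin.last n)).toEmbedding) x = x.castSucc := by
    intro x hx
    refine Equiv.swap_apply_of_ne_of_ne ?_ (Fin.castSucc_ne_last x)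
    exact fun hc => hx (Fin.castSucc_injective _ hc)
  have hιi : (Fin.castSuccEmb.trans (Equiv.swap i.castSucc (Fin.last n)).toEmbedding) i =
      Fin.last n := Equiv.swap_apply_left _ _
  have hmap : ∀ x, x ≠ k → (δ x).map Fin.castSucc = (δ x).map
      (Fin.castSuccEmb.trans (Equiv.swap i.castSucc (Fin.last n)).toEmbedding) := by
    intro x hx
    cases hd : δ x with
    | none => rfl
    | some y =>
      rw [Option.map_some, Option.map_some, hι]
      rintro rfl
      exact hx (δ.inj hd h)
  refine ⟨fun x => ?_, fun y hy => ?_⟩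
  · by_cases hxi : x = i
    · subst hxi
      rw [hιi, insPB_last, peelPB_left hki, hmap x hki.symm]
    · rw [hι x hxi]
      by_cases hxk : x = k
      · subst hxk
        rw [insPB_self, h, Option.map_some, hιi]
      · rw [insPB_of_ne hxk, peelPB_of_ne hxk hxi, hmap x hxk]
  · have hyl : y ≠ Fin.last n := fun hc => hy i (by rw [hιi, hc])
    obtain ⟨z, rfl⟩ := Fin.exists_castSucc_eq.2 hyl
    have hz : z = i := by
      by_contra hc
      exact hy z (hι z hc)
    subst hz
    rw [insPB_of_ne hki.symm, peelPB_self]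
    rfl

/-! ### Generation of the projective limit -/

theorem symm_eq_none_iff {n : ℕ} {δ : PB n} {i : Fin n} : δ.symm i = none ↔ ∀ k, δ k ≠ some i := by
  constructor
  · intro h k hk
    rw [(PEquiv.eq_some_iff δ).2 hk] at h
    cases h
  · intro h
    by_contra hc
    obtain ⟨k, hk⟩ := Option.ne_none_iff_exists'.1 hc
    exact h k ((PEquiv.eq_some_iff δ).1 hk)

/-- The extension of an injection by one more point. -/
def snocEmb {n n' : ℕ} (ι : Fin n ↪ Fin n') : Fin (n + 1) ↪ Fin (n' + 1) where
  toFun := Fin.lastCases (Fin.last n') fun i => (ι i).castSucc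
  inj' := by
    intro x y
    refine Fin.lastCases ?_ (fun i => ?_) x <;> refine Fin.lastCases ?_ (fun j => ?_) y
    · simp
    · simp [(Fin.castSucc_ne_last (ι j)).symm]
    · simp
    · simp

theorem snocEmb_last {n n' : ℕ} (ι : Fin n ↪ Fin n') : snocEmb ι (Fin.last n) = Fin.last n' :=
  Fin.lastCases_last (motive := fun _ => Fin (n' + 1))

theorem snocEmb_castSucc {n n' : ℕ} (ι : Fin n ↪ Fin n') (i : Fin n) :
    snocEmb ι i.castSucc = (ι i).castSucc :=
  Fin.lastCases_castSucc (motive := fun _ => Fin (n' + 1)) i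

theorem map_snocEmb {n n' : ℕ} (ι : Fin n ↪ Fin n') (o : Option (Fin n)) :
    (o.map ι).map Fin.castSucc = (o.map Fin.castSucc).map (snocEmb ι) := by
  cases o with
  | none => rfl
  | some y => simp [snocEmb_castSucc]

theorem isPush_insPB {n n' : ℕ} {ι : Fin n ↪ Fin n'} {β : PB n} {β' : PB n'} (h : IsPush ι β β')
    {k : Fin n} : IsPush (snocEmb ι) (insPB k β) (insPB (ι k) β') := by
  refine ⟨fun x => ?_, fun y hy => ?_⟩
  · refine Fin.lastCases ?_ (fun i => ?_) x
    · rw [snocEmb_last, insPB_last, insPB_last, h.1, map_snocEmb]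
    · rw [snocEmb_castSucc]
      by_cases hi : i = k
      · subst hi
        rw [insPB_self, insPB_self, Option.map_some, snocEmb_last]
      · rw [insPB_of_ne hi, insPB_of_ne (fun hc => hi (ι.injective hc)), h.1, map_snocEmb]
  · have hyl : y ≠ Fin.last n' := fun hc => hy (Fin.last n) (by rw [snocEmb_last, hc])
    obtain ⟨z, rfl⟩ := Fin.exists_castSucc_eq.2 hyl
    have hz : ∀ x, ι x ≠ z := fun x hx => hy x.castSucc (by rw [snocEmb_castSucc, hx])
    rw [insPB_of_ne (hz k).symm, h.2 z hz]
    rfl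

/-- Insertion only reroutes k through the new point: the old value at k becomes the value at the new
point, so the image among the old points does not change, and outer columns are untouched. -/
theorem insPB_support {m n : ℕ} {k : Fin n} (hk : k.1 < m) {β : PB n} {i : Fin n} (hi : m ≤ i.1)
    (h : insPB k β i.castSucc = none ↔ (insPB k β).symm i.castSucc = none) :
    β i = none ↔ β.symm i = none := by
  have hik : i ≠ k := by rintro rfl; omega
  rw [insPB_of_ne hik, Option.map_eq_none_iff] at h
  rw [h, symm_eq_none_iff, symm_eq_none_iff]
  have hinj : ∀ o : Option (Fin n), o.map Fin.castSucc = some i.castSucc ↔ o = some i := by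
    intro o
    cases o <;> simp
  constructor
  · intro h1 x hx
    by_cases hxk : x = k
    · subst hxk
      apply h1 (Fin.last n)
      rw [insPB_last, hinj, hx]
    · apply h1 x.castSucc
      rw [insPB_of_ne hxk, hinj, hx]
  · intro h1 x
    refine Fin.lastCases ?_ (fun j => ?_) x
    · rw [insPB_last, Ne, hinj]
      exact h1 k
    · by_cases hj : j = k
      · subst hj
        rw [insPB_self]
        intro hc
        exact Fin.castSucc_ne_last i (Option.some.inj hc).symm
      · rw [insPB_of_ne hj, Ne, hinj]
        exact h1 j

/-- The element b is prescribed by its coordinates, namely those of a with an outer point inserted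
after x. Insertion raises `cnt` by one, so b lies one step lower in the filtration. -/
theorem exists_peel {m d : ℕ} {a : Alim m} (ha : a ∈ limFilt m (d + 1)) (x : Fin m) :
    ∃ b ∈ limFilt m d, ∀ (n : ℕ) (hn : m ≤ n) (β : PB n), (β (Fin.castLE hn x)).isSome →
      cf m β (b.1 ⟨n, hn⟩) =
        cf m (insPB (Fin.castLE hn x) β) (a.1 ⟨n + 1, Nat.le_succ_of_le hn⟩) := by
  classical
  refine (exists_of_coord m d
    -- Where β is undefined at x the insertion is undefined at the new point but has it in its
    -- image, so a has coordinate zero there by `cf_support`. Prescribing zero outright avoids the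
    -- case in which insertion does not raise `cnt`.
    (fun n β => if h : m ≤ n then
      if (β (Fin.castLE h x)).isSome then
        cf m (insPB (Fin.castLE h x) β) (a.1 ⟨n + 1, Nat.le_succ_of_le h⟩) else 0 else 0)
    ?_ ?_ ?_).imp fun b hb => ⟨hb.1, fun n hn β hβ => by rw [hb.2, dif_pos hn, if_pos hβ]⟩
  · intro n' n hn' hn ι hι β β' h
    have hx : Fin.castLE hn' x = ι (Fin.castLE hn x) := Fin.ext (hι (Fin.castLE hn x) x.2).symm
    rw [dif_pos hn', dif_pos hn, hx, h.1, Option.isSome_map]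
    congr 1
    refine cf_push a _ _ _ _ (snocEmb ι) (fun z hz => ?_) _ _ (isPush_insPB h)
    revert hz
    refine Fin.lastCases ?_ (fun i => ?_) z
    · intro hz
      simp at hz
      omega
    · intro hz
      rw [snocEmb_castSucc]
      exact hι i hz
  · intro n hn β hβ i hi
    rw [dif_pos hn] at hβ
    have h1 : cf m (insPB (Fin.castLE hn x) β) (a.1 ⟨n + 1, Nat.le_succ_of_le hn⟩) ≠ 0 := by
      intro hc
      rw [hc, ite_self] at hβ
      exact hβ rfl
    exact insPB_support (k := Fin.castLE hn x) x.2 hi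
      (cf_support a (Nat.le_succ_of_le hn) h1 i.castSucc hi)
  · intro n hn β hβ
    rw [dif_pos hn]
    split_ifs with hs
    · refine cf_eq_zero (d := d + 1) ?_ (ha ⟨n + 1, Nat.le_succ_of_le hn⟩)
      rw [cnt_insPB (k := Fin.castLE hn x) x.2 hn hs]
      omega
    · rfl

/-- The leading coordinates of degree `d` vanish at the partial bijections that map one of the first
`k` points to a point `i ≥ m`. -/
def IsClosedUpTo {m : ℕ} (d k : ℕ) (a : Alim m) : Prop :=
  ∀ (n : ℕ) (hn : m ≤ n) (δ : PB n), cnt m δ = d →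
    (∃ (x : Fin m) (i : Fin n), x.1 < k ∧ m ≤ i.1 ∧ δ (Fin.castLE hn x) = some i) →
    cf m δ (a.1 ⟨n, hn⟩) = 0

/-- With b from `exists_peel`, the leading coordinates of b u_x and a agree at every δ in the
support that sends x to an outer point. At all other δ the leading coordinate of b u_x is zero, so
the vanishing already reached for the points before x is not disturbed. -/
theorem isClosedUpTo_sub {m d : ℕ} {a : Alim m} (ha : a ∈ limFilt m (d + 1)) (x : Fin m)
    (h : IsClosedUpTo d x.1 a) :
    ∃ b : Alim m, b ∈ limFilt m d ∧ IsClosedUpTo d (x.1 + 1) (a - b * uLim x) := by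
  obtain ⟨b, hb, hb2⟩ := exists_peel ha x
  refine ⟨b, hb, fun n hn δ hδ hex => ?_⟩
  by_cases hgood : ∀ i : Fin n, m ≤ i.1 → (δ i = none ↔ δ.symm i = none)
  swap
  · by_contra hne
    exact hgood (cf_support _ hn hne)
  have hsub : cf m δ ((a - b * uLim x).1 ⟨n, hn⟩) =
      cf m δ (a.1 ⟨n, hn⟩) - cf m δ (b.1 ⟨n, hn⟩ * uEl (Fin.castLE hn x)) := by
    rw [← map_sub]
    rfl
  rw [hsub]
  by_cases hx : ∃ i : Fin n, m ≤ i.1 ∧ δ (Fin.castLE hn x) = some i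
  · obtain ⟨i, hi, hxi⟩ := hx
    have hne : Fin.castLE hn x ≠ i := by
      rintro rfl
      exact absurd x.2 (not_lt.2 hi)
    have hs : (δ i).isSome := by
      rw [Option.isSome_iff_ne_none, Ne, hgood i hi, symm_eq_none_iff]
      exact fun hc => hc _ hxi
    rw [cf_mul_uEl_of_eq (d := d) hδ.ge (k := Fin.castLE hn x) x.2 hi hxi hs (hb ⟨n, hn⟩), hb2,
      sub_eq_zero]
    · refine (cf_push a (n + 1) n (Nat.le_succ_of_le hn) hn _ (fun z hz => ?_) _ _
        (isPush_insPB_peelPB hne hxi)).symm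
      change (Equiv.swap i.castSucc (Fin.last n) z.castSucc).1 = _
      rw [Equiv.swap_apply_of_ne_of_ne]
      · rfl
      · intro hc
        rw [Fin.castSucc_injective _ hc] at hz
        omega
      · exact Fin.castSucc_ne_last z
    · rwa [peelPB_left hne]
  · rw [cf_mul_uEl_eq_zero (d := d) hδ.ge (k := Fin.castLE hn x) x.2 _ (hb ⟨n, hn⟩), sub_zero]
    · refine h n hn δ hδ ?_
      obtain ⟨y, i, hy, hi, hyi⟩ := hex
      refine ⟨y, i, ?_, hi, hyi⟩
      refine lt_of_le_of_ne (Nat.le_of_lt_succ hy) fun hc => hx ⟨i, hi, ?_⟩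
      rw [← Fin.ext hc, hyi]
    · rintro ⟨_, i, hi, hxi, _⟩
      exact hx ⟨i, hi, hxi⟩

/-- The direct sum of two partial bijections. -/
def sumPB {m n : ℕ} (γ : PB m) (σ : PB n) : PB (m + n) where
  toFun := Fin.addCases (fun i => (γ i).map (Fin.castAdd n)) fun j => (σ j).map (Fin.natAdd m)
  invFun := Fin.addCases (fun i => (γ.symm i).map (Fin.castAdd n))
    fun j => (σ.symm j).map (Fin.natAdd m)
  inv a b := by
    have hne : ∀ (i : Fin m) (j : Fin n), Fin.castAdd n i ≠ Fin.natAdd m j := by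
      intro i j hc
      have := congrArg Fin.val hc
      simp at this
      omega
    refine Fin.addCases (fun i => ?_) (fun i => ?_) a <;>
      refine Fin.addCases (fun j => ?_) (fun j => ?_) b
    · simp only [Fin.addCases_left, Option.map_eq_some_iff, Fin.castAdd_inj]
      simpa using PEquiv.eq_some_iff γ
    · simp [hne, (hne _ _).symm]
    · simp [hne, (hne _ _).symm]
    · simp only [Fin.addCases_right, Option.map_eq_some_iff, Fin.natAdd_inj]
      simpa using PEquiv.eq_some_iff σ

theorem sumPB_castAdd {m n : ℕ} (γ : PB m) (σ : PB n) (i : Fin m) :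
    sumPB γ σ (Fin.castAdd n i) = (γ i).map (Fin.castAdd n) :=
  Fin.addCases_left (motive := fun _ => Option (Fin (m + n)))
    (left := fun i => (γ i).map (Fin.castAdd n)) (right := fun j => (σ j).map (Fin.natAdd m)) i

theorem sumPB_natAdd {m n : ℕ} (γ : PB m) (σ : PB n) (j : Fin n) :
    sumPB γ σ (Fin.natAdd m j) = (σ j).map (Fin.natAdd m) :=
  Fin.addCases_right (motive := fun _ => Option (Fin (m + n)))
    (left := fun i => (γ i).map (Fin.castAdd n)) (right := fun j => (σ j).map (Fin.natAdd m)) j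

theorem castAdd_ne_natAdd {m n : ℕ} (i : Fin m) (j : Fin n) :
    Fin.castAdd n i ≠ Fin.natAdd m j := by
  intro hc
  have := congrArg Fin.val hc
  simp at this
  omega

theorem cnt_sumPB {m n : ℕ} (γ : PB m) (σ : PB n) : cnt m (sumPB γ σ) = cnt 0 σ := by
  unfold cnt
  refine Eq.trans (congrArg Finset.card ?_) (Finset.card_map (Fin.natAddEmb m))
  ext y
  refine Fin.addCases (fun i => ?_) (fun j => ?_) y
  · simp [(castAdd_ne_natAdd _ _).symm]
  · simp [sumPB_natAdd]

/-- The direct sum of the identity and an injection. -/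
def sumEmb (m : ℕ) {n n' : ℕ} (ι : Fin n ↪ Fin n') : Fin (m + n) ↪ Fin (m + n') where
  toFun := Fin.addCases (Fin.castAdd n') fun j => Fin.natAdd m (ι j)
  inj' := by
    intro x y
    refine Fin.addCases (fun i => ?_) (fun i => ?_) x <;>
      refine Fin.addCases (fun j => ?_) (fun j => ?_) y
    · simp
    · simp [castAdd_ne_natAdd]
    · simp [(castAdd_ne_natAdd _ _).symm]
    · simp

theorem sumEmb_castAdd {m n n' : ℕ} (ι : Fin n ↪ Fin n') (i : Fin m) :
    sumEmb m ι (Fin.castAdd n i) = Fin.castAdd n' i :=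
  Fin.addCases_left (motive := fun _ => Fin (m + n')) (left := Fin.castAdd n')
    (right := fun j => Fin.natAdd m (ι j)) i

theorem sumEmb_natAdd {m n n' : ℕ} (ι : Fin n ↪ Fin n') (j : Fin n) :
    sumEmb m ι (Fin.natAdd m j) = Fin.natAdd m (ι j) :=
  Fin.addCases_right (motive := fun _ => Fin (m + n')) (left := Fin.castAdd n')
    (right := fun j => Fin.natAdd m (ι j)) j

theorem isPush_sumPB {m n n' : ℕ} (γ : PB m) {ι : Fin n ↪ Fin n'} {σ : PB n} {σ' : PB n'}
    (h : IsPush ι σ σ') : IsPush (sumEmb m ι) (sumPB γ σ) (sumPB γ σ') := by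
  refine ⟨fun x => ?_, fun y => ?_⟩
  · refine Fin.addCases (fun i => ?_) (fun j => ?_) x
    · rw [sumEmb_castAdd, sumPB_castAdd, sumPB_castAdd]
      cases γ i with
      | none => rfl
      | some y => simp [sumEmb_castAdd]
    · rw [sumEmb_natAdd, sumPB_natAdd, sumPB_natAdd, h.1]
      cases σ j with
      | none => rfl
      | some y => simp [sumEmb_natAdd]
  · refine Fin.addCases (fun i => ?_) (fun j => ?_) y
    · intro hy
      exact absurd (sumEmb_castAdd ι i) (hy _)
    · intro hy
      rw [sumPB_natAdd, h.2 j]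
      · rfl
      · intro x hx
        exact hy (Fin.natAdd m x) (by rw [sumEmb_natAdd, hx])

/-- Fixing the inner block γ and letting the outer block σ vary turns the coordinates of a into a
family that satisfies the conditions of `exists_of_coord` with no inner points, hence into an
element of A_0. -/
theorem exists_closed_part {m d : ℕ} {a : Alim m} (ha : a ∈ limFilt m (d + 1)) (γ : PB m) :
    ∃ b ∈ limFilt 0 (d + 1), ∀ (n : ℕ) (σ : PB n), cf 0 σ (b.1 ⟨n, Nat.zero_le n⟩) =
        cf m (sumPB γ σ) (a.1 ⟨m + n, Nat.le_add_right m n⟩) := by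
  refine (exists_of_coord 0 (d + 1)
    (fun n σ => cf m (sumPB γ σ) (a.1 ⟨m + n, Nat.le_add_right m n⟩))
    ?_ ?_ ?_).imp fun b hb => ⟨hb.1, fun n σ => hb.2 n (Nat.zero_le n) σ⟩
  · intro n' n _ _ ι _ σ σ' h
    refine cf_push a _ _ _ _ (sumEmb m ι) (fun x hx => ?_) _ _ (isPush_sumPB γ h)
    revert hx
    refine Fin.addCases (fun i => ?_) (fun j => ?_) x
    · intro _
      rw [sumEmb_castAdd]
      rfl
    · intro hx
      simp at hx
  · intro n _ σ hσ i _
    have h1 := cf_support a (Nat.le_add_right m n) hσ (Fin.natAdd m i) (by simp)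
    rw [sumPB_natAdd, Option.map_eq_none_iff] at h1
    rw [h1, symm_eq_none_iff, symm_eq_none_iff]
    constructor
    · intro h k hk
      apply h (Fin.natAdd m k)
      rw [sumPB_natAdd, hk]
      rfl
    · intro h k
      refine Fin.addCases (fun l => ?_) (fun l => ?_) k
      · rw [sumPB_castAdd]
        cases γ l with
        | none => simp
        | some y => simp [castAdd_ne_natAdd]
      · rw [sumPB_natAdd]
        intro hc
        rw [Option.map_eq_some_iff] at hc
        obtain ⟨z, hz, hzi⟩ := hc
        rw [Fin.natAdd_inj] at hzi
        subst hzi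
        exact h l hz
  · intro n _ σ hσ
    refine cf_eq_zero (d := d + 1) ?_ (ha ⟨m + n, Nat.le_add_right m n⟩)
    rwa [cnt_sumPB]

/-- The upper left corner of order `m`. -/
def cornerPB {m n : ℕ} (h : m ≤ n) (δ : PB n) : PB m where
  toFun x := (δ (Fin.castLE h x)).bind fun y => if hy : y.1 < m then some ⟨y.1, hy⟩ else none
  invFun x := (δ.symm (Fin.castLE h x)).bind fun y => if hy : y.1 < m then some ⟨y.1, hy⟩ else none
  inv a b := by
    simp only [Option.bind_eq_some_iff, Option.dite_none_right_eq_some, Option.some.injEq]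
    constructor
    · rintro ⟨c, hc, h2, rfl⟩
      exact ⟨Fin.castLE h b, (PEquiv.eq_some_iff δ).1 hc, b.2, rfl⟩
    · rintro ⟨c, hc, h2, rfl⟩
      exact ⟨Fin.castLE h a, (PEquiv.eq_some_iff δ).2 hc, a.2, rfl⟩

theorem cornerPB_apply {m n : ℕ} (h : m ≤ n) (δ : PB n) (x : Fin m) : cornerPB h δ x =
    (δ (Fin.castLE h x)).bind fun y => if hy : y.1 < m then some ⟨y.1, hy⟩ else none := rfl

theorem map_cornerPB {m n : ℕ} (h : m ≤ n) {δ : PB n} {x : Fin m}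
    (hx : ∀ i : Fin n, m ≤ i.1 → δ (Fin.castLE h x) ≠ some i) :
    (cornerPB h δ x).map (Fin.castLE h) = δ (Fin.castLE h x) := by
  rw [cornerPB_apply]
  cases hd : δ (Fin.castLE h x) with
  | none => rfl
  | some y =>
    have hy : y.1 < m := by
      by_contra hc
      exact hx y (not_lt.1 hc) hd
    simp [hy]

theorem isPush_cornerPB {m n : ℕ} (h : m ≤ n) {δ : PB n}
    (hx : ∀ (x : Fin m) (i : Fin n), m ≤ i.1 → δ (Fin.castLE h x) ≠ some i) :
    IsPush (Fin.castLEEmb h) (cornerPB h δ) (inPB m δ) := by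
  refine ⟨fun x => ?_, fun y hy => ?_⟩
  · rw [inPB_lt δ (k := Fin.castLEEmb h x) x.2]
    exact (map_cornerPB h (hx x)).symm
  · refine inPB_ge δ ?_
    by_contra hc
    exact hy ⟨y.1, not_le.1 hc⟩ rfl

/-- The injection that fixes the points `i < m` and shifts the other ones by `m`. -/
def shiftEmb (m N : ℕ) : Fin N ↪ Fin (m + N) where
  toFun i := if h : i.1 < m then Fin.castAdd N ⟨i.1, h⟩ else Fin.natAdd m i
  inj' := by
    intro x y hxy
    apply Fin.ext
    dsimp only at hxy
    split_ifs at hxy with h1 h2 h2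
    · simpa using congrArg Fin.val hxy
    · exact absurd hxy (castAdd_ne_natAdd _ _)
    · exact absurd hxy.symm (castAdd_ne_natAdd _ _)
    · exact congrArg Fin.val (Fin.natAdd_inj m |>.1 hxy)

theorem shiftEmb_lt {m N : ℕ} {i : Fin N} (h : i.1 < m) :
    shiftEmb m N i = Fin.castAdd N ⟨i.1, h⟩ := dif_pos h

theorem shiftEmb_ge {m N : ℕ} {i : Fin N} (h : m ≤ i.1) :
    shiftEmb m N i = Fin.natAdd m i := dif_neg (not_lt.2 h)

/-- Every outer point of the domain is also in the image, and its preimage is outer because no inner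
point is sent outside. The preimage map of the finite set of these points is injective, hence
surjective, so δ permutes them. -/
theorem mapsTo_of_closed {m n : ℕ} (hn : m ≤ n) {δ : PB n}
    (hgood : ∀ i : Fin n, m ≤ i.1 → (δ i = none ↔ δ.symm i = none))
    (hx : ∀ (x : Fin m) (i : Fin n), m ≤ i.1 → δ (Fin.castLE hn x) ≠ some i)
    {k j : Fin n} (hk : m ≤ k.1) (h : δ k = some j) : m ≤ j.1 := by
  classical
  set S := Finset.univ.filter fun i : Fin n => m ≤ i.1 ∧ (δ i).isSome with hS
  have hmem : ∀ i, i ∈ S ↔ m ≤ i.1 ∧ (δ i).isSome := by simp [hS]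
  have hex : ∀ i ∈ S, ∃ l ∈ S, δ l = some i := by
    intro i hi
    rw [hmem] at hi
    have h1 : δ.symm i ≠ none := by
      rw [Ne, ← hgood i hi.1]
      exact Option.isSome_iff_ne_none.1 hi.2
    obtain ⟨l, hl⟩ := Option.ne_none_iff_exists'.1 h1
    rw [PEquiv.eq_some_iff δ] at hl
    refine ⟨l, (hmem l).2 ⟨?_, by rw [hl]; rfl⟩, hl⟩
    by_contra hc
    exact hx ⟨l.1, not_le.1 hc⟩ i hi.1 hl
  choose! f hfS hf using hex
  have hinj : Set.InjOn f S := by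
    intro a ha b hb hab
    have h1 := hf a ha
    rw [hab, hf b hb] at h1
    exact (Option.some.inj h1).symm
  have hsurj := Finset.surjOn_of_injOn_of_card_le f (fun x hx => hfS x hx) hinj le_rfl
  obtain ⟨i, hi, hik⟩ := hsurj ((hmem k).2 ⟨hk, by rw [h]; rfl⟩)
  have h1 := hf i hi
  rw [hik, h, Option.some.injEq] at h1
  rw [h1]
  exact ((hmem i).1 hi).1

/-- A partial bijection that preserves both inner and outer points is a block sum up to relabelling.
The outer block keeps its n labels, the first m of them idle, which is why the outer points are
shifted by m. -/
theorem isPush_sumPB_corner {m n : ℕ} (hn : m ≤ n) {δ : PB n}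
    (hgood : ∀ i : Fin n, m ≤ i.1 → (δ i = none ↔ δ.symm i = none))
    (hx : ∀ (x : Fin m) (i : Fin n), m ≤ i.1 → δ (Fin.castLE hn x) ≠ some i) :
    IsPush (shiftEmb m n) δ (sumPB (cornerPB hn δ) (outPB m δ)) := by
  refine ⟨fun x => ?_, fun y => ?_⟩
  · by_cases h : x.1 < m
    · rw [shiftEmb_lt h, sumPB_castAdd]
      have h1 : δ x = (cornerPB hn δ ⟨x.1, h⟩).map (Fin.castLE hn) :=
        (map_cornerPB hn (hx ⟨x.1, h⟩)).symm
      rw [h1]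
      cases cornerPB hn δ ⟨x.1, h⟩ with
      | none => rfl
      | some y =>
        rw [Option.map_some, Option.map_some, Option.map_some,
          shiftEmb_lt (i := Fin.castLE hn y) y.2]
        rfl
    · rw [shiftEmb_ge (not_lt.1 h), sumPB_natAdd, outPB_ge δ (not_lt.1 h)]
      cases hd : δ x with
      | none => rfl
      | some y =>
        rw [Option.map_some, Option.map_some,
          shiftEmb_ge (mapsTo_of_closed hn hgood hx (not_lt.1 h) hd)]
  · refine Fin.addCases (fun i => ?_) (fun j => ?_) y
    · intro hy
      exact absurd (shiftEmb_lt (i := Fin.castLE hn i) i.2) (hy _)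
    · intro hy
      rw [sumPB_natAdd, outPB_lt]
      · rfl
      · by_contra hc
        exact hy j (shiftEmb_ge (not_lt.1 hc))

/-- For each γ take the element of A_0 that records the leading coordinates of a at block sums with
inner block γ. By `cf_mul_phi`, and because the `dualEl m γ` are dual to the inner coordinates, the
sum has the same leading coordinates as a at block sums. At a δ sending an inner point outside, a
vanishes by assumption and the sum by `cf_phi_eq_zero`. -/
theorem closed_mem {m d : ℕ} {a : Alim m} (ha : a ∈ limFilt m (d + 1)) (h : IsClosedUpTo d m a) :
    ∃ b : PB m → Alim 0,
      a - ∑ γ, fromA0 m (b γ) * const m (dualEl m γ) ∈ limFilt m d := by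
  classical
  choose b hb hb2 using fun γ => exists_closed_part ha γ
  refine ⟨b, ?_⟩
  have hmem : a - ∑ γ, fromA0 m (b γ) * const m (dualEl m γ) ∈ limFilt m (d + 1) :=
    sub_mem ha (Submodule.sum_mem _ fun γ _ =>
      mul_const_mem_limFilt (fromA0_mem_limFilt (hb γ)) _)
  refine mem_limFilt_of_cf fun n hn δ hδ => ?_
  by_cases hd : cnt m δ = d
  swap
  · exact cf_eq_zero (d := d + 1) (by omega) (hmem ⟨n, hn⟩)
  by_cases hgood : ∀ i : Fin n, m ≤ i.1 → (δ i = none ↔ δ.symm i = none)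
  swap
  · by_contra hne
    exact hgood (cf_support _ hn hne)
  have hsub : cf m δ ((a - ∑ γ, fromA0 m (b γ) * const m (dualEl m γ)).1 ⟨n, hn⟩) =
      cf m δ (a.1 ⟨n, hn⟩) -
        ∑ γ, cf m δ ((b γ).1 ⟨n, Nat.zero_le n⟩ * phi hn (dualEl m γ)) := by
    rw [← map_sum, ← map_sub]
    congr 1
    have h1 : (∑ γ, fromA0 m (b γ) * const m (dualEl m γ)).1 ⟨n, hn⟩ =
        ∑ γ, (fromA0 m (b γ) * const m (dualEl m γ)).1 ⟨n, hn⟩ := by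
      rw [← Finset.sum_apply]
      exact congrArg (fun f => f ⟨n, hn⟩) (map_sum (Alim m).val _ _)
    rw [show (a - ∑ γ, fromA0 m (b γ) * const m (dualEl m γ)).1 ⟨n, hn⟩ =
      a.1 ⟨n, hn⟩ - (∑ γ, fromA0 m (b γ) * const m (dualEl m γ)).1 ⟨n, hn⟩ from rfl, h1]
    rfl
  rw [hsub]
  simp only [fun γ => cf_mul_phi hn hδ (hb γ ⟨n, Nat.zero_le n⟩) (dualEl m γ)]
  by_cases hx : ∀ (x : Fin m) (i : Fin n), m ≤ i.1 → δ (Fin.castLE hn x) ≠ some i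
  · simp only [cf_phi hn (isPush_cornerPB hn hx), cf_dualEl, mul_ite, mul_one, mul_zero,
      Finset.sum_ite_eq, Finset.mem_univ, if_true, hb2]
    rw [sub_eq_zero]
    refine (cf_push a _ _ _ _ (shiftEmb m n) (fun x hx => ?_) _ _
      (isPush_sumPB_corner hn hgood hx)).symm
    rw [shiftEmb_lt hx]
    rfl
  · push Not at hx
    obtain ⟨x, i, hi, hxi⟩ := hx
    rw [h n hn δ hd ⟨x, i, x.2, hi, hxi⟩, zero_sub, neg_eq_zero]
    refine Finset.sum_eq_zero fun γ _ => ?_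
    rw [cf_phi_eq_zero hn (k := Fin.castLE hn x) x.2 hi
      (by rw [inPB_lt δ (k := Fin.castLE hn x) x.2, hxi]), mul_zero]

/-- The algebra `A_m` is generated by `A_0`, `A(m)` and the elements `u_k`. -/
theorem eq_top_of_generators {m : ℕ} (R : Subalgebra ℂ (Alim m)) (h0 : ∀ a, fromA0 m a ∈ R)
    (h1 : ∀ z, const m z ∈ R) (h2 : ∀ x, uLim x ∈ R) : R = ⊤ := by
  have key : ∀ d, ∀ a ∈ limFilt m d, a ∈ R := by
    intro d
    induction d with
    | zero =>
      intro a ha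
      rw [limFilt_zero, Submodule.mem_bot] at ha
      rw [ha]
      exact zero_mem R
    | succ d ih =>
      intro a ha
      -- The inner points are treated one at a time. The elements b that are peeled off lie in step
      -- d and belong to R by the outer induction.
      have hk : ∀ k ≤ m, ∃ r ∈ R, a - r ∈ limFilt m (d + 1) ∧ IsClosedUpTo d k (a - r) := by
        intro k
        induction k with
        | zero =>
          intro _
          refine ⟨0, zero_mem R, by rwa [sub_zero], ?_⟩
          rintro n hn δ _ ⟨x, i, hx, _⟩
          exact absurd hx (Nat.not_lt_zero _)
        | succ k ihk =>
          intro hkm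
          obtain ⟨r, hr, hr2, hr3⟩ := ihk (by omega)
          obtain ⟨b, hb, hb2⟩ := isClosedUpTo_sub hr2 ⟨k, hkm⟩ hr3
          refine ⟨r + b * uLim ⟨k, hkm⟩, add_mem hr (mul_mem (ih b hb) (h2 _)), ?_, ?_⟩
          · rw [← sub_sub]
            exact sub_mem hr2 (mul_uLim_mem_limFilt hb _)
          · rw [← sub_sub]
            exact hb2
      obtain ⟨r, hr, hr2, hr3⟩ := hk m le_rfl
      obtain ⟨b, hb⟩ := closed_mem hr2 hr3
      have h3 := ih _ hb
      have h4 : ∑ γ, fromA0 m (b γ) * const m (dualEl m γ) ∈ R :=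
        sum_mem fun γ _ => mul_mem (h0 _) (h1 _)
      have h5 := add_mem (add_mem h3 h4) hr
      rwa [sub_add_cancel, sub_add_cancel] at h5
  rw [eq_top_iff]
  intro a _
  obtain ⟨d, hd⟩ := exists_mem_limFilt a
  exact key d a hd

/-! ### The relations in the projective limit -/

/-- Permutations as partial bijections. -/
def permHom (n : ℕ) : Equiv.Perm (Fin n) →* PB n where
  toFun σ := σ.toPEquiv
  map_one' := rfl
  map_mul' _ _ := rfl

theorem swapEl_comm {n : ℕ} (k i : Fin n) : swapEl k i = swapEl i k := by
  rw [swapEl, swapEl, swapPB, swapPB, Equiv.swap_comm]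

theorem swapEl_mul_self {n : ℕ} (k i : Fin n) : swapEl k i * swapEl k i = 1 := by
  rw [swapEl, ← of_mul, ← of_one]
  congr 1
  exact ((permHom n).map_mul _ _).symm.trans (by rw [Equiv.swap_mul_self, map_one])

theorem swapEl_braid {n : ℕ} {a b c : Fin n} (hab : a ≠ b) (hac : a ≠ c) (hbc : b ≠ c) :
    swapEl a b * swapEl b c * swapEl a b = swapEl b c * swapEl a b * swapEl b c := by
  simp only [swapEl, ← of_mul]
  congr 1
  change permHom n (Equiv.swap a b) * permHom n (Equiv.swap b c) * permHom n (Equiv.swap a b) =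
    permHom n (Equiv.swap b c) * permHom n (Equiv.swap a b) * permHom n (Equiv.swap b c)
  simp only [← map_mul]
  rw [Equiv.swap_mul_swap_mul_swap hab hac, Equiv.swap_comm a b, Equiv.swap_comm b c,
    Equiv.swap_mul_swap_mul_swap hbc.symm hac.symm, Equiv.swap_comm]

theorem swapEl_disjoint {n : ℕ} {a b c d : Fin n} (hac : a ≠ c) (had : a ≠ d) (hbc : b ≠ c)
    (hbd : b ≠ d) : swapEl a b * swapEl c d = swapEl c d * swapEl a b := by
  simp only [swapEl, ← of_mul]
  congr 1
  exact stab_mul_swap (by rw [swapPB_apply, Equiv.swap_apply_of_ne_of_ne hac.symm hbc.symm])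
    (by rw [swapPB_apply, Equiv.swap_apply_of_ne_of_ne had.symm hbd.symm])

theorem eps_mul_self {n : ℕ} (k : Fin n) : eps k * eps k = eps k := by
  rw [eps, ← of_mul]
  congr 1
  exact mul_eps_none (by rw [epsPB_apply, if_pos rfl])

theorem eps_comm {n : ℕ} (k l : Fin n) : eps k * eps l = eps l * eps k := by
  rw [eps, eps, ← of_mul, ← of_mul]
  congr 1
  ext1 x
  simp only [mul_apply, epsPB_apply]
  by_cases h1 : x = k <;> by_cases h2 : x = l <;> simp_all

theorem one_sub_eps_comm {n : ℕ} (k l : Fin n) :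
    (1 - eps k) * (1 - eps l) = (1 - eps l) * (1 - eps k) :=
  (((Commute.one_left _).sub_left (((Commute.one_right _).sub_right (eps_comm k l)))).eq)

theorem of_mul_eps {n : ℕ} {γ : PB n} {i j : Fin n} (h : γ i = some j) :
    of γ * eps i = eps j * of γ := by
  rw [eps, eps, ← of_mul, ← of_mul, stab_mul_eps h]

theorem swapEl_mul_eps_mul_eps {n : ℕ} (k l : Fin n) :
    swapEl k l * eps k * eps l = eps k * eps l := by
  simp only [swapEl, eps, ← of_mul]
  congr 1
  ext1 x
  simp only [mul_apply, epsPB_apply]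
  by_cases h1 : x = k
  · by_cases h2 : x = l <;> simp_all [mul_apply, epsPB_apply]
  · by_cases h2 : x = l
    · simp_all
    · simp_all [mul_apply, epsPB_apply, swapPB_apply, Equiv.swap_apply_of_ne_of_ne]

/-- Symmetry in the two indices lets the lemmas about the second index also be applied to k. -/
theorem term_symm {n : ℕ} (k i : Fin n) : swapEl k i * (1 - eps k) * (1 - eps i) =
    swapEl i k * (1 - eps i) * (1 - eps k) := by
  rw [mul_assoc, one_sub_eps_comm, swapEl_comm, mul_assoc]

/-- Conjugation of the summands of the elements `u_k`. -/
theorem of_mul_term {n : ℕ} (σ : Equiv.Perm (Fin n)) (k i : Fin n) :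
    of σ.toPEquiv * (swapEl k i * (1 - eps k) * (1 - eps i)) =
      swapEl (σ k) (σ i) * (1 - eps (σ k)) * (1 - eps (σ i)) * of σ.toPEquiv := by
  have h1 : of σ.toPEquiv * swapEl k i = swapEl (σ k) (σ i) * of σ.toPEquiv := by
    rw [swapEl, swapEl, ← of_mul, ← of_mul]
    congr 1
    change permHom n σ * permHom n _ = permHom n _ * permHom n σ
    rw [← map_mul, ← map_mul, Equiv.mul_swap_eq_swap_mul]
  have h2 : ∀ j, of σ.toPEquiv * (1 - eps j) = (1 - eps (σ j)) * of σ.toPEquiv := by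
    intro j
    rw [mul_sub, sub_mul, mul_one, one_mul, of_mul_eps (Equiv.toPEquiv_apply σ j)]
  rw [← mul_assoc, ← mul_assoc, h1, mul_assoc _ (of _), h2, mul_assoc, mul_assoc _ (of _), h2]
  simp only [mul_assoc]

/-- Conjugation by the adjacent transposition carries the summands of u_a with i > b to those of
u_b. The summand i = b has no partner; there the transposition squares to 1 and leaves the product
of idempotent factors. -/
theorem swapEl_mul_uEl {n : ℕ} {a b : Fin n} (hab : a.1 + 1 = b.1) :
    swapEl a b * uEl a = uEl b * swapEl a b + (1 - eps a) * (1 - eps b) := by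
  have hfil : (Finset.univ.filter fun i : Fin n => a < i) =
      insert b (Finset.univ.filter fun i : Fin n => b < i) := by
    ext i
    simp only [Finset.mem_filter, Finset.mem_univ, true_and, Finset.mem_insert, Fin.lt_def,
      Fin.ext_iff]
    omega
  rw [uEl, hfil, Finset.sum_insert (by simp), mul_add, add_comm, uEl, Finset.mul_sum,
    Finset.sum_mul]
  congr 1
  · refine Finset.sum_congr rfl fun i hi => ?_
    simp only [Finset.mem_filter, Finset.mem_univ, true_and, Fin.lt_def] at hi
    have h1 := of_mul_term (Equiv.swap a b) a i
    rw [Equiv.swap_apply_left, Equiv.swap_apply_of_ne_of_ne (by rintro rfl; omega)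
      (by rintro rfl; omega)] at h1
    exact h1
  · rw [mul_assoc, ← mul_assoc, swapEl_mul_self, one_mul]

/-- If l < a, the transposition fixes all points up to l and u_l centralizes it. If l > b, it fixes
every index occurring in u_l and commutes with each summand. -/
theorem swapEl_mul_uEl_of_ne {n : ℕ} {a b l : Fin n} (hab : a.1 + 1 = b.1) (h1 : l ≠ a)
    (h2 : l ≠ b) : swapEl a b * uEl l = uEl l * swapEl a b := by
  rw [Ne, Fin.ext_iff] at h1 h2
  by_cases hl : l.1 < a.1
  · refine mem_cent.1 (uEl_mem_cent (m := l.1 + 1) l (Nat.lt_succ_self _)) (swapPB a b)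
      fun i hi => ?_
    rw [swapPB_apply, Equiv.swap_apply_of_ne_of_ne] <;> rintro rfl <;> omega
  · rw [uEl, Finset.mul_sum, Finset.sum_mul]
    refine Finset.sum_congr rfl fun i hi => ?_
    simp only [Finset.mem_filter, Finset.mem_univ, true_and, Fin.lt_def] at hi
    refine term_comm ?_ ?_
    · rw [swapPB_apply, Equiv.swap_apply_of_ne_of_ne] <;> rintro rfl <;> omega
    · rw [swapPB_apply, Equiv.swap_apply_of_ne_of_ne] <;> rintro rfl <;> omega

/-- All factors of u_l come from partial bijections that fix the points up to k, and u_k centralizes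
these. -/
theorem uEl_comm_of_lt {n : ℕ} {k l : Fin n} (hkl : k < l) : Commute (uEl l) (uEl k) := by
  have hc : ∀ γ ∈ stab (k.1 + 1) n, Commute (of γ) (uEl k) := fun γ hγ =>
    mem_cent.1 (uEl_mem_cent (m := k.1 + 1) k (Nat.lt_succ_self _)) γ hγ
  refine Commute.sum_left _ _ _ fun i hi => ?_
  simp only [Finset.mem_filter, Finset.mem_univ, true_and] at hi
  rw [Fin.lt_def] at hkl hi
  refine Commute.mul_left (Commute.mul_left (hc _ fun j hj => ?_) ?_) ?_
  · rw [swapPB_apply, Equiv.swap_apply_of_ne_of_ne] <;> rintro rfl <;> omega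
  · exact (Commute.one_left _).sub_left (hc _ (epsPB_mem_stab l (by omega)))
  · exact (Commute.one_left _).sub_left (hc _ (epsPB_mem_stab i (by omega)))

theorem uEl_comm {n : ℕ} (k l : Fin n) : uEl k * uEl l = uEl l * uEl k := by
  rcases lt_trichotomy k l with h | rfl | h
  · exact (uEl_comm_of_lt h).eq.symm
  · rfl
  · exact (uEl_comm_of_lt h).eq

theorem eps_mul_uEl {n : ℕ} (k : Fin n) : eps k * uEl k = 0 := by
  rw [uEl, Finset.mul_sum]
  refine Finset.sum_eq_zero fun i _ => ?_
  rw [term_symm]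
  exact term_none (by rw [epsPB_apply, if_pos rfl])

theorem uEl_mul_eps {n : ℕ} (k : Fin n) : uEl k * eps k = 0 := by
  rw [uEl, Finset.sum_mul]
  refine Finset.sum_eq_zero fun i _ => ?_
  rw [term_symm]
  refine none_term fun j => ?_
  rw [epsPB_apply]
  split_ifs with h
  · simp
  · simpa using h

theorem eps_mul_uEl_of_ne {n : ℕ} {i k : Fin n} (h : i ≠ k) : eps i * uEl k = uEl k * eps i := by
  rcases lt_or_gt_of_ne h with h | h
  · rw [uEl, Finset.mul_sum, Finset.sum_mul]
    refine Finset.sum_congr rfl fun j hj => ?_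
    simp only [Finset.mem_filter, Finset.mem_univ, true_and] at hj
    exact term_comm (by rw [epsPB_apply, if_neg h.ne']) (by rw [epsPB_apply, if_neg (h.trans hj).ne'])
  · exact mem_cent.1 (uEl_mem_cent (m := k.1 + 1) k (Nat.lt_succ_self _)) _ (epsPB_mem_stab i h)

theorem phi_eps {m n : ℕ} (h : m ≤ n) (i : Fin m) : phi h (eps i) = eps (Fin.castLE h i) := by
  rw [eps, phi_of, eps]
  congr 1
  ext1 x
  by_cases hx : x.1 < m
  · rw [phiPB_apply_lt _ _ _ hx, epsPB_apply, epsPB_apply]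
    by_cases hxi : (⟨x.1, hx⟩ : Fin m) = i
    · subst hxi; simp
    · rw [if_neg hxi, if_neg]
      · rfl
      · rintro rfl; exact hxi rfl
  · rw [phiPB_apply_ge _ _ _ hx, epsPB_apply, if_neg]
    rintro rfl
    exact hx i.2

theorem phi_swapEl {m n : ℕ} (h : m ≤ n) (k i : Fin m) :
    phi h (swapEl k i) = swapEl (Fin.castLE h k) (Fin.castLE h i) := by
  rw [swapEl, phi_of, swapEl]
  congr 1
  ext1 x
  by_cases hx : x.1 < m
  · rw [phiPB_apply_lt _ _ _ hx, swapPB_apply, swapPB_apply, Option.map_some]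
    congr 1
    have hinj := Fin.castLE_injective h
    exact (hinj.swap_apply k i ⟨x.1, hx⟩).symm
  · rw [phiPB_apply_ge _ _ _ hx, swapPB_apply, Equiv.swap_apply_of_ne_of_ne]
    · rintro rfl; exact hx k.2
    · rintro rfl; exact hx i.2

/-- The images of the generators in `A_m`. -/
def genLim {m : ℕ} : Gen m → Alim m
  | Gen.s k hk => const m (swapEl (ix k hk) (ixs k hk))
  | Gen.e k => const m (eps k)
  | Gen.u k => uLim k

theorem lim_ext {m : ℕ} {a b : Alim m} (h : ∀ (n : ℕ) (hn : m ≤ n), a.1 ⟨n, hn⟩ = b.1 ⟨n, hn⟩) :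
    a = b := Subtype.ext (funext fun n => h n.1 n.2)

theorem uLim_commute {m : ℕ} (k l : Fin m) : Commute (uLim k) (uLim l) :=
  lim_ext fun _ hn => uEl_comm (Fin.castLE hn k) (Fin.castLE hn l)

theorem genLim_rel {m : ℕ} ⦃x y : FreeAlgebra ℂ (Gen m)⦄ (h : Rel m x y) :
    FreeAlgebra.lift ℂ genLim x = FreeAlgebra.lift ℂ genLim y := by
  cases h with
  | s_sq k hk =>
    simp only [map_mul, map_one, FreeAlgebra.lift_ι_apply, genLim]
    rw [← map_mul, swapEl_mul_self, map_one]
  | braid k hk hk2 =>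
    simp only [map_mul, FreeAlgebra.lift_ι_apply, genLim]
    simp only [← map_mul]
    congr 1
    refine swapEl_braid ?_ ?_ ?_ <;> simp only [ne_eq, Fin.ext_iff] <;> omega
  | s_comm k l hk hl hkl =>
    simp only [map_mul, FreeAlgebra.lift_ι_apply, genLim]
    simp only [← map_mul]
    congr 1
    refine swapEl_disjoint ?_ ?_ ?_ ?_ <;> simp only [ne_eq, Fin.ext_iff] <;> omega
  | e_sq k =>
    simp only [map_mul, FreeAlgebra.lift_ι_apply, genLim]
    rw [← map_mul, eps_mul_self]
  | e_comm k l =>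
    simp only [map_mul, FreeAlgebra.lift_ι_apply, genLim]
    rw [← map_mul, eps_comm, map_mul]
  | s_e k hk =>
    simp only [map_mul, FreeAlgebra.lift_ι_apply, genLim]
    rw [← map_mul, ← map_mul]
    congr 1
    exact of_mul_eps (by rw [swapPB_apply, Equiv.swap_apply_left])
  | s_e_comm k hk l h1 h2 =>
    simp only [map_mul, FreeAlgebra.lift_ι_apply, genLim]
    rw [← map_mul, ← map_mul]
    congr 1
    exact of_mul_eps (by rw [swapPB_apply, Equiv.swap_apply_of_ne_of_ne h1 h2])
  | s_e_e k hk =>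
    simp only [map_mul, FreeAlgebra.lift_ι_apply, genLim]
    simp only [← map_mul]
    rw [swapEl_mul_eps_mul_eps]
  | s_u k hk =>
    simp only [map_mul, map_add, map_sub, map_one, FreeAlgebra.lift_ι_apply, genLim]
    refine lim_ext fun n hn => ?_
    change phi hn (swapEl _ _) * uEl _ = uEl _ * phi hn (swapEl _ _) +
      (1 - phi hn (eps _)) * (1 - phi hn (eps _))
    rw [phi_swapEl, phi_eps, phi_eps]
    exact swapEl_mul_uEl rfl
  | s_u_comm k hk l h1 h2 =>
    simp only [map_mul, FreeAlgebra.lift_ι_apply, genLim]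
    refine lim_ext fun n hn => ?_
    change phi hn (swapEl _ _) * uEl _ = uEl _ * phi hn (swapEl _ _)
    rw [phi_swapEl]
    have hinj := Fin.castLE_injective hn
    exact swapEl_mul_uEl_of_ne rfl (hinj.ne h1) (hinj.ne h2)
  | u_comm k l =>
    simp only [map_mul, FreeAlgebra.lift_ι_apply, genLim]
    exact uLim_commute k l
  | e_u k =>
    simp only [map_mul, map_zero, FreeAlgebra.lift_ι_apply, genLim]
    refine lim_ext fun n hn => ?_
    change phi hn (eps _) * uEl _ = 0
    rw [phi_eps, eps_mul_uEl]
  | u_e k =>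
    simp only [map_mul, map_zero, FreeAlgebra.lift_ι_apply, genLim]
    refine lim_ext fun n hn => ?_
    change uEl _ * phi hn (eps _) = 0
    rw [phi_eps, uEl_mul_eps]
  | e_u_comm i k h =>
    simp only [map_mul, FreeAlgebra.lift_ι_apply, genLim]
    refine lim_ext fun n hn => ?_
    change phi hn (eps _) * uEl _ = uEl _ * phi hn (eps _)
    rw [phi_eps]
    exact eps_mul_uEl_of_ne ((Fin.castLE_injective hn).ne h)

/-- The homomorphism from the abstract algebra to `A_m`. -/
def absHom (m : ℕ) : Abs m →ₐ[ℂ] Alim m :=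
  RingQuot.liftAlgHom ℂ ⟨FreeAlgebra.lift ℂ genLim, genLim_rel⟩

theorem absHom_gen {m : ℕ} (g : Gen m) : absHom m (gen g) = genLim g := by
  rw [absHom, gen, RingQuot.liftAlgHom_mkAlgHom_apply, FreeAlgebra.lift_ι_apply]

/-! ### Ordered products of commuting elements -/

/-- Ordered products stand in for finite products since the ambient monoid is not commutative.
Commutation with `y` alone suffices to move the new factor to the end. -/
theorem list_prod_update {ι M : Type*} [DecidableEq ι] [Monoid M] {g : ι → M} {x : ι} {y : M}
    (hy : ∀ i, Commute (g i) y) {l : List ι} (hl : l.Nodup) (hx : x ∈ l) :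
    (l.map (update g x (g x * y))).prod = (l.map g).prod * y := by
  induction l with
  | nil => simp at hx
  | cons a l ih =>
    rw [List.nodup_cons] at hl
    rw [List.map_cons, List.prod_cons, List.map_cons, List.prod_cons]
    by_cases hax : a = x
    · subst hax
      have hrest : l.map (update g a (g a * y)) = l.map g := by
        refine List.map_congr_left fun i hi => ?_
        rw [update_of_ne]
        rintro rfl
        exact hl.1 hi
      have hc : Commute (l.map g).prod y := by
        refine Commute.list_prod_left _ _ fun z hz => ?_
        obtain ⟨i, _, rfl⟩ := List.mem_map.1 hz
        exact hy i
      rw [hrest, update_self, mul_assoc, mul_assoc, hc.eq]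
    · rw [update_of_ne hax, ih hl.2 ((List.mem_cons.1 hx).resolve_left (Ne.symm hax)), mul_assoc]

/-- The ordered monomial with exponents `r`. -/
def monom {m : ℕ} {M : Type*} [Monoid M] (u : Fin m → M) (r : Fin m → ℕ) : M :=
  ((List.finRange m).map fun i => u i ^ r i).prod

theorem monom_zero {m : ℕ} {M : Type*} [Monoid M] (u : Fin m → M) : monom u 0 = 1 := by
  unfold monom
  refine List.prod_eq_one fun x hx => ?_
  obtain ⟨i, _, rfl⟩ := List.mem_map.1 hx
  simp

theorem monom_add_single {m : ℕ} {M : Type*} [Monoid M] {u : Fin m → M}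
    (hu : ∀ i j, Commute (u i) (u j)) (r : Fin m → ℕ) (x : Fin m) :
    monom u (r + Pi.single x 1) = monom u r * u x := by
  unfold monom
  rw [← list_prod_update (x := x) (fun i => (hu i x).pow_left (r i)) (List.nodup_finRange m)
    (List.mem_finRange x)]
  congr 1
  refine List.map_congr_left fun i _ => ?_
  by_cases h : i = x
  · subst h; simp [pow_succ]
  · simp [h]

theorem map_monom {m : ℕ} {M N F : Type*} [Monoid M] [Monoid N] [FunLike F M N]
    [MonoidHomClass F M N] (f : F) (u : Fin m → M) (r : Fin m → ℕ) :
    f (monom u r) = monom (fun i => f (u i)) r := by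
  simp [monom, map_list_prod, Function.comp_def]

theorem monom_commute {m : ℕ} {M : Type*} [Monoid M] {u : Fin m → M} {y : M}
    (hy : ∀ i, Commute (u i) y) (r : Fin m → ℕ) : Commute (monom u r) y := by
  refine Commute.list_prod_left _ _ fun z hz => ?_
  obtain ⟨i, _, rfl⟩ := List.mem_map.1 hz
  exact (hy i).pow_left _

theorem exists_eq_add_single {m : ℕ} {r : Fin m → ℕ} {x : Fin m} (h : r x ≠ 0) :
    ∃ r' : Fin m → ℕ, r = r' + (Pi.single x 1 : Fin m → ℕ) := by
  refine ⟨update r x (r x - 1), ?_⟩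
  funext i
  by_cases hi : i = x
  · subst hi; simp; omega
  · simp [hi]

theorem sum_add_single {m : ℕ} (r : Fin m → ℕ) (x : Fin m) :
    ∑ i, (r + (Pi.single x 1 : Fin m → ℕ)) i = ∑ i, r i + 1 := by
  simp [Finset.sum_add_distrib]

/-! ### Independence of the monomials over `A_0` -/

theorem mul_monom_mem_limFilt {m e : ℕ} {b : Alim m} (hb : b ∈ limFilt m e) :
    ∀ (N : ℕ) (r : Fin m → ℕ), ∑ i, r i = N → b * monom uLim r ∈ limFilt m (e + N) := by
  intro N
  induction N with
  | zero =>
    intro r hr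
    have : r = 0 := by
      funext i
      exact Finset.sum_eq_zero_iff.1 hr i (Finset.mem_univ i)
    rw [this, monom_zero, mul_one]
    exact hb
  | succ N ih =>
    intro r hr
    have : ∃ x, r x ≠ 0 := by
      by_contra hc
      push Not at hc
      simp [hc] at hr
    obtain ⟨x, hx⟩ := this
    obtain ⟨r', rfl⟩ := exists_eq_add_single hx
    rw [sum_add_single] at hr
    rw [monom_add_single uLim_commute, ← mul_assoc]
    exact mul_uLim_mem_limFilt (ih r' (by omega)) x

/-- The value of a leading coordinate of `b u^r` at a partial bijection that maps `x`, `r x = 0`, to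
a point `i ≥ m`. -/
theorem cf_mul_monom_eq_zero {m e : ℕ} {b : Alim m} (hb : b ∈ limFilt m (e + 1))
    (hcl : IsClosedUpTo e m b) (x : Fin m) : ∀ (N : ℕ) (r : Fin m → ℕ), ∑ i, r i = N → r x = 0 →
    ∀ (n : ℕ) (hn : m ≤ n) (δ : PB n) (i : Fin n), cnt m δ = e + N → m ≤ i.1 →
      δ (Fin.castLE hn x) = some i → cf m δ ((b * monom uLim r).1 ⟨n, hn⟩) = 0 := by
  intro N
  induction N with
  | zero =>
    intro r hr _ n hn δ i hδ hi hxi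
    have : r = 0 := by
      funext i
      exact Finset.sum_eq_zero_iff.1 hr i (Finset.mem_univ i)
    rw [this, monom_zero, mul_one]
    exact hcl n hn δ hδ ⟨x, i, x.2, hi, hxi⟩
  | succ N ih =>
    intro r hr hrx n hn δ i hδ hi hxi
    have : ∃ z, r z ≠ 0 := by
      by_contra hc
      push Not at hc
      simp [hc] at hr
    obtain ⟨z, hz⟩ := this
    have hzx : x ≠ z := by rintro rfl; exact hz hrx
    obtain ⟨r', rfl⟩ := exists_eq_add_single hz
    rw [sum_add_single] at hr
    rw [monom_add_single uLim_commute, ← mul_assoc]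
    have hmem : b * monom uLim r' ∈ limFilt m (e + 1 + N) :=
      mul_monom_mem_limFilt hb N r' (by omega)
    change cf m δ ((b * monom uLim r').1 ⟨n, hn⟩ * uEl (Fin.castLE hn z)) = 0
    -- Removing the point after z ≠ x leaves column x and its outer value in place, so the induction
    -- hypothesis still applies.
    by_cases hj : ∃ j : Fin n, m ≤ j.1 ∧ δ (Fin.castLE hn z) = some j ∧ (δ j).isSome
    · obtain ⟨j, hj, hzj, hs⟩ := hj
      rw [cf_mul_uEl_of_eq (d := e + 1 + N) (by omega) (k := Fin.castLE hn z) z.2 hj hzj hs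
        (hmem ⟨n, hn⟩)]
      have hcnt := cnt_peelPB (m := m) (k := Fin.castLE hn z) z.2 hj hs
      refine ih r' (by omega) ?_ n hn _ i (by omega) hi ?_
      · simpa [hzx] using hrx
      · rw [peelPB_of_ne, hxi]
        · exact fun hc => hzx (Fin.castLE_injective hn hc)
        · rintro rfl
          exact absurd x.2 (not_lt.2 hj)
    · exact cf_mul_uEl_eq_zero (d := e + 1 + N) (by omega) (k := Fin.castLE hn z) z.2
        (fun hc => hj hc.2) (hmem ⟨n, hn⟩)

theorem coe_sum_apply {m : ℕ} {α : Type*} (s : Finset α) (f : α → Alim m) (n : Set.Ici m) :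
    (∑ r ∈ s, f r).1 n = ∑ r ∈ s, (f r).1 n := by
  rw [← Finset.sum_apply]
  exact congrArg (fun f => f n) (map_sum (Alim m).val _ _)

/-- The leading coordinates of the coefficients of `∑ y_r u^r` vanish if those of the sum do. -/
theorem cf_coeff_eq_zero {m : ℕ} : ∀ (N : ℕ) (r₀ : Fin m → ℕ) (_ : ∑ i, r₀ i = N) (d : ℕ)
    (_ : N ≤ d) (s : Finset (Fin m → ℕ)) (y : (Fin m → ℕ) → Alim m) (P : Finset (Fin m))
    (_ : ∀ r ∈ s, y r ∈ limFilt m (d + 1 - ∑ i, r i))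
    (_ : ∀ r ∈ s, IsClosedUpTo (d - ∑ i, r i) m (y r))
    (_ : ∀ (n : ℕ) (hn : m ≤ n) (δ : PB n), cnt m δ = d →
      (∀ x ∈ P, (δ (Fin.castLE hn x)).isSome) →
      cf m δ ((∑ r ∈ s, y r * monom uLim r).1 ⟨n, hn⟩) = 0)
    (_ : r₀ ∈ s) (n : ℕ) (hn : m ≤ n) (δ : PB n) (_ : cnt m δ = d - N)
    (_ : ∀ x, x ∈ P ∨ r₀ x ≠ 0 → (δ (Fin.castLE hn x)).isSome),
    cf m δ ((y r₀).1 ⟨n, hn⟩) = 0 := by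
  classical
  intro N
  induction N with
  | zero =>
    intro r₀ hr₀ d _ s y P hy hcl hE hmem n hn δ hδ hP
    have hr0 : r₀ = 0 := by
      funext i
      exact Finset.sum_eq_zero_iff.1 hr₀ i (Finset.mem_univ i)
    subst hr0
    -- If δ sends an inner point outside, closedness of the coefficient applies. Otherwise every
    -- monomial with a positive exponent has zero leading coordinate at δ, and only the coefficient
    -- of u^0 is seen.
    by_cases hx : ∃ (x : Fin m) (i : Fin n), m ≤ i.1 ∧ δ (Fin.castLE hn x) = some i
    · obtain ⟨x, i, hi, hxi⟩ := hx
      exact hcl 0 hmem n hn δ (by simpa using hδ) ⟨x, i, x.2, hi, hxi⟩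
    · have h := hE n hn δ hδ fun x hx => hP x (Or.inl hx)
      rw [coe_sum_apply, map_sum, Finset.sum_eq_single 0] at h
      · rwa [monom_zero, mul_one] at h
      · intro r hr hr0
        have : ∃ z, r z ≠ 0 := by
          by_contra hc
          push Not at hc
          exact hr0 (funext hc)
        obtain ⟨z, hz⟩ := this
        have hyr := hy r hr
        obtain ⟨r', rfl⟩ := exists_eq_add_single hz
        rw [sum_add_single] at hyr
        rw [monom_add_single uLim_commute, ← mul_assoc]
        have hb : y (r' + Pi.single z 1) * monom uLim r' ∈ limFilt m d := by
          by_cases hd : ∑ i, r' i ≤ d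
          · have := mul_monom_mem_limFilt hyr _ r' rfl
            refine limFilt_mono ?_ this
            omega
          -- The truncated difference is 0 here, and step 0 of the filtration contains only 0.
          · rw [Nat.sub_eq_zero_of_le (by omega), limFilt_zero, Submodule.mem_bot] at hyr
            rw [hyr, zero_mul]
            exact zero_mem _
        refine cf_mul_uEl_eq_zero (d := d) (by omega) (k := Fin.castLE hn z) z.2 ?_ (hb ⟨n, hn⟩)
        rintro ⟨_, i, hi, hzi, _⟩
        exact hx ⟨z, i, hi, hzi⟩
      · exact fun hc => absurd hmem hc
  | succ N ih =>
    intro r₀ hr₀ d hd s y P hy hcl hE hmem n hn δ hδ hP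
    have : ∃ x, r₀ x ≠ 0 := by
      by_contra hc
      push Not at hc
      simp [hc] at hr₀
    obtain ⟨x, hx⟩ := this
    obtain ⟨r', hr'⟩ := exists_eq_add_single hx
    obtain ⟨d, rfl⟩ : ∃ d', d = d' + 1 := ⟨d - 1, by omega⟩
    have hinj : Function.Injective fun r : Fin m → ℕ => r + Pi.single x 1 := add_left_injective _
    set s' : Finset (Fin m → ℕ) := s.preimage (fun r => r + Pi.single x 1) hinj.injOn with hs'
    have hmem' : ∀ r, r ∈ s' ↔ r + Pi.single x 1 ∈ s := fun r => by rw [hs', Finset.mem_preimage]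
    rw [hr', sum_add_single] at hr₀
    have hsum : (∑ r ∈ s', y (r + Pi.single x 1) * monom uLim r) * uLim x =
        ∑ r ∈ s.filter fun r => r x ≠ 0, y r * monom uLim r := by
      rw [Finset.sum_mul]
      refine Finset.sum_bij (fun r _ => r + Pi.single x 1) (fun r hr => ?_)
        (fun a _ b _ hab => hinj hab) (fun r hr => ?_) fun r _ => ?_
      · rw [Finset.mem_filter]
        exact ⟨(hmem' r).1 hr, by simp⟩
      · rw [Finset.mem_filter] at hr
        obtain ⟨r'', hr''⟩ := exists_eq_add_single hr.2
        exact ⟨r'', (hmem' r'').2 (hr'' ▸ hr.1), hr''.symm⟩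
      · rw [monom_add_single uLim_commute, ← mul_assoc]
    have hfilt : ∑ r ∈ s', y (r + Pi.single x 1) * monom uLim r ∈ limFilt m (d + 1) := by
      refine Submodule.sum_mem _ fun r hr => ?_
      have hyr := hy _ ((hmem' r).1 hr)
      rw [sum_add_single] at hyr
      by_cases hd : ∑ i, r i ≤ d
      · refine limFilt_mono ?_ (mul_monom_mem_limFilt hyr _ r rfl)
        omega
      · rw [Nat.sub_eq_zero_of_le (by omega), limFilt_zero, Submodule.mem_bot] at hyr
        rw [hyr, zero_mul]
        exact zero_mem _
    -- One factor u_x is split off, which lowers N and d by one. Since the insertion formula holds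
    -- only for β defined at x, the point x joins the set P of required points; this costs nothing
    -- in the end because r₀ x ≠ 0.
    have key := ih r' (by omega) d (by omega) s' (fun r => y (r + Pi.single x 1)) (insert x P)
      (fun r hr => ?_) (fun r hr => ?_) (fun k hk β hβ hβP => ?_)
      ((hmem' r').2 (hr' ▸ hmem)) n hn δ (by omega) (fun z hz => ?_)
    · rw [hr']
      exact key
    · have := hy _ ((hmem' r).1 hr)
      rw [sum_add_single] at this
      convert this using 2
      omega
    · have := hcl _ ((hmem' r).1 hr)
      rw [sum_add_single] at this
      convert this using 1
      omega
    · have hxs := hβP x (Finset.mem_insert_self x P)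
      have hcnt := cnt_insPB (k := Fin.castLE hk x) x.2 hk hxs
      rw [← cf_mul_uLim_insPB hk x hxs (d := d + 1) (by omega) hfilt, hsum]
      have h1 := hE (k + 1) (Nat.le_succ_of_le hk) (insPB (Fin.castLE hk x) β) (by omega)
        (fun z hz => by
          change (insPB (Fin.castLE hk x) β (Fin.castLE hk z).castSucc).isSome
          by_cases hzx : Fin.castLE hk z = Fin.castLE hk x
          · rw [hzx, insPB_self]
            rfl
          · rw [insPB_of_ne hzx, Option.isSome_map]
            exact hβP z (Finset.mem_insert_of_mem hz))
      rw [← Finset.sum_filter_add_sum_filter_not s fun r => r x ≠ 0] at h1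
      -- Monomials without u_x do not contribute: the insertion sends x to an outer point, and
      -- `cf_mul_monom_eq_zero` applies.
      have h2 : cf m (insPB (Fin.castLE hk x) β)
          ((∑ r ∈ s.filter fun r => ¬ r x ≠ 0, y r * monom uLim r).1
            ⟨k + 1, Nat.le_succ_of_le hk⟩) = 0 := by
        rw [coe_sum_apply, map_sum]
        refine Finset.sum_eq_zero fun r hr => ?_
        rw [Finset.mem_filter, not_not] at hr
        have hyr := hy r hr.1
        by_cases hdr : ∑ i, r i ≤ d + 1
        · refine cf_mul_monom_eq_zero (e := d + 1 - ∑ i, r i) ?_ (hcl r hr.1) x _ r rfl hr.2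
            (k + 1) (Nat.le_succ_of_le hk) _ (Fin.last k) (by omega) (by simpa using hk)
            (insPB_self _ _)
          convert hyr using 2
          omega
        · rw [Nat.sub_eq_zero_of_le (by omega), limFilt_zero, Submodule.mem_bot] at hyr
          rw [hyr, zero_mul]
          exact map_zero _
      have h3 : ∀ p q : Alim m, cf m (insPB (Fin.castLE hk x) β)
          ((p + q).1 ⟨k + 1, Nat.le_succ_of_le hk⟩) =
          cf m (insPB (Fin.castLE hk x) β) (p.1 ⟨k + 1, Nat.le_succ_of_le hk⟩) +
          cf m (insPB (Fin.castLE hk x) β) (q.1 ⟨k + 1, Nat.le_succ_of_le hk⟩) :=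
        fun p q => map_add (cf m (insPB (Fin.castLE hk x) β)) _ _
      rwa [h3, h2, add_zero] at h1
    · refine hP z ?_
      rw [Finset.mem_insert] at hz
      by_cases hzx : z = x
      · exact Or.inr (hzx ▸ hx)
      · rcases hz with (h | h) | h
        · exact absurd h hzx
        · exact Or.inl h
        · refine Or.inr ?_
          rw [hr']
          simpa [hzx] using h

/-- At level m there are no outer points, hence no diagonal correction, and the coordinate just
tests whether γ extends β. -/
theorem cf_self_level {m : ℕ} (β γ : PB m) :
    cf m β (of γ) = if ∀ k, (β k).isSome → γ k = β k then 1 else 0 := by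
  rw [cf_of]
  have hw : ∀ k, colWt m β k (γ k) = if (β k).isSome → γ k = β k then 1 else 0 := by
    intro k
    cases hk : β k with
    | none => rw [colWt_none hk]; simp
    | some j => rw [colWt_some hk]; simp [not_le.2 k.2]
  simp only [hw]
  split_ifs with h
  · exact Finset.prod_eq_one fun k _ => if_pos (h k)
  · push Not at h
    obtain ⟨k, hk, hk2⟩ := h
    exact Finset.prod_eq_zero (Finset.mem_univ k) (if_neg fun hc => hk2 (hc hk))

/-- Triangularity with respect to extension: take β in the support of c with the largest domain. No
other element of the support extends β, and β is itself an admissible test, so c β = 0. -/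
theorem coeff_eq_zero_of_cf {m : ℕ} (P : Fin m → Prop) (c : PB m → ℂ)
    (hc : ∀ γ, c γ ≠ 0 → ∀ x, P x → (γ x).isSome)
    (h : ∀ β : PB m, (∀ x, P x → (β x).isSome) → ∑ γ, c γ * cf m β (of γ) = 0) (γ : PB m) :
    c γ = 0 := by
  classical
  by_contra hne
  have hS : (Finset.univ.filter fun γ => c γ ≠ 0).Nonempty := ⟨γ, by simpa using hne⟩
  obtain ⟨β, hβ, hmax⟩ := Finset.exists_max_image _
    (fun γ : PB m => (Finset.univ.filter fun k => (γ k).isSome).card) hS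
  simp only [Finset.mem_filter, Finset.mem_univ, true_and] at hβ hmax
  have h1 := h β (hc β hβ)
  rw [Finset.sum_eq_single β] at h1
  · rw [cf_self_level, if_pos fun _ _ => rfl, mul_one] at h1
    exact hβ h1
  · intro γ' _ hne'
    by_cases hc' : c γ' = 0
    · rw [hc', zero_mul]
    rw [cf_self_level, if_neg, mul_zero]
    intro hext
    have hsub : (Finset.univ.filter fun k => (β k).isSome) ⊆
        Finset.univ.filter fun k => (γ' k).isSome := by
      intro k hk
      simp only [Finset.mem_filter, Finset.mem_univ, true_and] at hk ⊢
      rw [hext k hk]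
      exact hk
    have heq := Finset.eq_of_subset_of_card_le hsub (hmax γ' hc')
    apply hne'
    ext1 k
    by_cases hk : (β k).isSome
    · exact hext k hk
    · have hk' : ¬ (γ' k).isSome := by
        intro hs
        have : k ∈ Finset.univ.filter fun k => (γ' k).isSome := by simpa using hs
        rw [← heq] at this
        exact hk (by simpa using this)
      rw [Option.not_isSome_iff_eq_none] at hk hk'
      rw [hk, hk']
  · exact fun hc => absurd (Finset.mem_univ _) hc

theorem isPush_outPB_sumPB {m n : ℕ} (β : PB m) (σ : PB n) :
    IsPush (Fin.natAddEmb m) σ (outPB m (sumPB β σ)) := by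
  refine ⟨fun x => ?_, fun y => ?_⟩
  · rw [Fin.natAddEmb_apply, outPB_ge _ (by simp), sumPB_natAdd]
    rfl
  · refine Fin.addCases (fun i => ?_) (fun j => ?_) y
    · intro _
      exact outPB_lt _ (by simp)
    · intro hy
      exact absurd rfl (hy j)

theorem isPush_inPB_sumPB {m n : ℕ} (β : PB m) (σ : PB n) :
    IsPush (Fin.castLEEmb (Nat.le_add_right m n)) β (inPB m (sumPB β σ)) := by
  refine ⟨fun x => ?_, fun y => ?_⟩
  · change inPB m (sumPB β σ) (Fin.castAdd n x) = _
    rw [inPB_lt _ (by simp), sumPB_castAdd]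
    rfl
  · refine Fin.addCases (fun i => ?_) (fun j => ?_) y
    · intro hy
      exact absurd rfl (hy i)
    · intro _
      exact inPB_ge _ (by simp)

/-- The descent step of independence. `cf_mul_phi` shows that the coefficient of each u^r is closed,
so `cf_coeff_eq_zero` makes its leading coordinates vanish at the block sums of β and σ with β
defined wherever r is nonzero. For fixed σ these are linear equations for the coordinates of the c r
γ, solved by `coeff_eq_zero_of_cf`. -/
theorem coeff_mem_limFilt {m d : ℕ} (s : Finset (Fin m → ℕ)) (c : (Fin m → ℕ) → PB m → Alim 0)
    (hsupp : ∀ r γ, c r γ ≠ 0 → ∀ x, r x ≠ 0 → (γ x).isSome)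
    (hE : ∑ r ∈ s, (∑ γ, fromA0 m (c r γ) * const m (of γ)) * monom uLim r = 0)
    (hd : ∀ r ∈ s, ∀ γ, c r γ ∈ limFilt 0 (d + 1 - ∑ i, r i)) :
    ∀ r ∈ s, ∀ γ, c r γ ∈ limFilt 0 (d - ∑ i, r i) := by
  classical
  have hval : ∀ (n : ℕ) (hn : m ≤ n) (δ : PB n), ∀ r ∈ s, ∑ i, r i ≤ d →
      d - ∑ i, r i ≤ cnt m δ →
      cf m δ ((∑ γ, fromA0 m (c r γ) * const m (of γ)).1 ⟨n, hn⟩) =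
      ∑ γ, cf 0 (outPB m δ) ((c r γ).1 ⟨n, Nat.zero_le n⟩) * cf m (inPB m δ) (phi hn (of γ)) := by
    intro n hn δ r hr hrd hδ
    rw [coe_sum_apply, map_sum]
    refine Finset.sum_congr rfl fun γ _ => ?_
    refine cf_mul_phi (d := d - ∑ i, r i) hn hδ ?_ (of γ)
    have := hd r hr γ ⟨n, Nat.zero_le n⟩
    rwa [show d + 1 - ∑ i, r i = d - ∑ i, r i + 1 by omega] at this
  have hcl : ∀ r ∈ s, IsClosedUpTo (d - ∑ i, r i) m
      (∑ γ, fromA0 m (c r γ) * const m (of γ)) := by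
    rintro r hr n hn δ hδ ⟨x, i, _, hi, hxi⟩
    by_cases hrd : ∑ i, r i ≤ d
    · rw [hval n hn δ r hr hrd hδ.ge]
      refine Finset.sum_eq_zero fun γ _ => ?_
      rw [cf_phi_eq_zero hn (k := Fin.castLE hn x) x.2 hi
        (by rw [inPB_lt δ (k := Fin.castLE hn x) x.2, hxi]), mul_zero]
    · have h0 : ∀ γ, c r γ = 0 := fun γ => by
        have := hd r hr γ
        rwa [Nat.sub_eq_zero_of_le (by omega), limFilt_zero, Submodule.mem_bot] at this
      simp only [h0, map_zero, zero_mul, Finset.sum_const_zero]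
      exact map_zero _
  intro r hr γ
  by_cases hrd : ∑ i, r i ≤ d
  swap
  · have := hd r hr γ
    rwa [Nat.sub_eq_zero_of_le (by omega)] at this ⊢
  refine mem_limFilt_of_cf fun n _ σ hσ => ?_
  by_cases hσd : cnt 0 σ = d - ∑ i, r i
  swap
  · exact cf_eq_zero (d := d + 1 - ∑ i, r i) (by omega) (hd r hr γ ⟨n, Nat.zero_le n⟩)
  refine coeff_eq_zero_of_cf (fun x => r x ≠ 0)
    (fun γ => cf 0 σ ((c r γ).1 ⟨n, Nat.zero_le n⟩)) (fun γ hγ => ?_) (fun β hβ => ?_) γ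
  · refine hsupp r γ fun hc => hγ ?_
    simp only [hc]
    exact map_zero _
  · have h1 := cf_coeff_eq_zero _ r rfl d hrd s
      (fun r => ∑ γ, fromA0 m (c r γ) * const m (of γ)) ∅
      (fun r hr => Submodule.sum_mem _ fun γ _ =>
        mul_const_mem_limFilt (fromA0_mem_limFilt (hd r hr γ)) _) hcl
      (fun n hn δ _ _ => by rw [hE]; exact map_zero _) hr (m + n) (Nat.le_add_right m n)
      (sumPB β σ) (by rw [cnt_sumPB, hσd]) (fun x hx => ?_)
    · rw [hval _ _ _ r hr hrd (by rw [cnt_sumPB, hσd])] at h1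
      refine Eq.trans (Finset.sum_congr rfl fun γ _ => ?_) h1
      rw [cf_phi _ (isPush_inPB_sumPB β σ),
        cf_push (c r γ) (m + n) n (Nat.zero_le _) (Nat.zero_le _) (Fin.natAddEmb m)
          (fun x hx => absurd hx (Nat.not_lt_zero _)) σ _ (isPush_outPB_sumPB β σ)]
    · change (sumPB β σ (Fin.castAdd n x)).isSome
      rw [sumPB_castAdd, Option.isSome_map]
      refine hβ x (hx.resolve_left (Finset.notMem_empty x))

/-- The elements `γ u^r`, where `γ` is defined at all `x` with `r x ≠ 0`, are linearly independent
over `A_0`. -/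
theorem coeff_eq_zero {m : ℕ} (s : Finset (Fin m → ℕ)) (c : (Fin m → ℕ) → PB m → Alim 0)
    (hsupp : ∀ r γ, c r γ ≠ 0 → ∀ x, r x ≠ 0 → (γ x).isSome)
    (hE : ∑ r ∈ s, (∑ γ, fromA0 m (c r γ) * const m (of γ)) * monom uLim r = 0) :
    ∀ r ∈ s, ∀ γ, c r γ = 0 := by
  choose D hD using fun r γ => exists_mem_limFilt (c r γ)
  have hstart : ∃ d, ∀ r ∈ s, ∀ γ, c r γ ∈ limFilt 0 (d - ∑ i, r i) := by
    -- Any common bound serves; the sum of all individual bounds is the simplest.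
    refine ⟨∑ r ∈ s, ∑ γ, (D r γ + ∑ i, r i), fun r hr γ => limFilt_mono ?_ (hD r γ)⟩
    have h1 : D r γ + ∑ i, r i ≤ ∑ γ, (D r γ + ∑ i, r i) :=
      Finset.single_le_sum (f := fun γ => D r γ + ∑ i, r i) (fun _ _ => Nat.zero_le _)
        (Finset.mem_univ γ)
    have h2 : ∑ γ, (D r γ + ∑ i, r i) ≤ ∑ r ∈ s, ∑ γ, (D r γ + ∑ i, r i) :=
      Finset.single_le_sum (f := fun r => ∑ γ, (D r γ + ∑ i, r i)) (fun _ _ => Nat.zero_le _) hr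
    omega
  obtain ⟨d, hd⟩ := hstart
  induction d with
  | zero =>
    intro r hr γ
    have := hd r hr γ
    rwa [Nat.zero_sub, limFilt_zero, Submodule.mem_bot] at this
  | succ d ih => exact ih (coeff_mem_limFilt s c hsupp hE hd)

/-! ### The Coxeter presentation of the symmetric groups -/

/-- The relations of the Coxeter generators of type `A`, for the indices below `M`. -/
structure CoxeterRel {H : Type*} [Monoid H] (t : ℕ → H) (M : ℕ) : Prop where
  sq : ∀ k < M, t k * t k = 1
  braid : ∀ k, k + 1 < M → t k * t (k + 1) * t k = t (k + 1) * t k * t (k + 1)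
  comm : ∀ k l, k + 1 < l → l < M → t k * t l = t l * t k

/-- The product `t_j t_{j+1} ⋯` with `p` factors. -/
def run {H : Type*} [Monoid H] (t : ℕ → H) : ℕ → ℕ → H
  | _, 0 => 1
  | j, p + 1 => t j * run t (j + 1) p

theorem mul_run_comm {H : Type*} [Monoid H] {t : ℕ → H} {M : ℕ} (h : CoxeterRel t M) {k : ℕ} :
    ∀ (p j : ℕ), k + 1 < j → j + p ≤ M → t k * run t j p = run t j p * t k := by
  intro p
  induction p with
  | zero => intro j _ _; simp [run]
  | succ p ih =>
    intro j hj hp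
    rw [run, ← mul_assoc, h.comm k j hj (by omega), mul_assoc, ih (j + 1) (by omega) (by omega),
      mul_assoc]

/-- The generator t_{k+1} passes the factors below t_k, meets t_k t_{k+1}, turns into t_k by the
braid relation, and passes the rest. -/
theorem mul_run_shift {H : Type*} [Monoid H] {t : ℕ → H} {M : ℕ} (h : CoxeterRel t M) {k : ℕ} :
    ∀ (p j : ℕ), j ≤ k → k + 1 < j + p → j + p ≤ M →
      t (k + 1) * run t j p = run t j p * t k := by
  intro p
  induction p with
  | zero => intro j _ _ _; omega
  | succ p ih =>
    intro j hj hk hp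
    by_cases hjk : j = k
    · subst hjk
      obtain ⟨q, rfl⟩ : ∃ q, p = q + 1 := ⟨p - 1, by omega⟩
      have h1 := mul_run_comm h (k := j) q (j + 1 + 1) (by omega) (by omega)
      rw [run, run, mul_assoc (t j), mul_assoc (t (j + 1)), ← h1]
      simp only [← mul_assoc]
      rw [h.braid j (by omega)]
    · rw [run, ← mul_assoc, ← h.comm j (k + 1) (by omega) (by omega), mul_assoc,
        ih (j + 1) (by omega) (by omega) (by omega), mul_assoc]

open Classical in
/-- The normal forms of the words in the first `l` generators. -/
def normalForms {H : Type*} [Monoid H] (t : ℕ → H) : ℕ → Finset H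
  | 0 => {1}
  | l + 1 => (Finset.range (l + 2) ×ˢ normalForms t l).image fun p => run t p.1 (l + 1 - p.1) * p.2

theorem mem_normalForms_succ {H : Type*} [Monoid H] {t : ℕ → H} {l : ℕ} {x : H} :
    x ∈ normalForms t (l + 1) ↔
      ∃ j ≤ l + 1, ∃ y ∈ normalForms t l, x = run t j (l + 1 - j) * y := by
  simp only [normalForms, Finset.mem_image, Finset.mem_product, Finset.mem_range, Prod.exists]
  constructor
  · rintro ⟨j, y, ⟨hj, hy⟩, rfl⟩
    exact ⟨j, by omega, y, hy, rfl⟩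
  · rintro ⟨j, hj, y, hy, rfl⟩
    exact ⟨j, y, ⟨by omega, hy⟩, rfl⟩

theorem card_normalForms_le {H : Type*} [Monoid H] (t : ℕ → H) :
    ∀ l, (normalForms t l).card ≤ (l + 1).factorial := by
  intro l
  induction l with
  | zero => simp [normalForms]
  | succ l ih =>
    classical
    rw [normalForms]
    refine le_trans Finset.card_image_le ?_
    rw [Finset.card_product, Finset.card_range, Nat.factorial_succ]
    exact Nat.mul_le_mul_left _ ih

theorem one_mem_normalForms {H : Type*} [Monoid H] (t : ℕ → H) : ∀ l, 1 ∈ normalForms t l := by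
  intro l
  induction l with
  | zero => simp [normalForms]
  | succ l ih =>
    rw [mem_normalForms_succ]
    exact ⟨l + 1, le_rfl, 1, ih, by simp [run]⟩

/-- Multiplying the run starting at j by t_k lengthens it if k + 1 = j, shortens it if k = j,
commutes past it if k + 1 < j, and passes it as t_{k-1} if k > j. In the last two cases the
generator on the right has index below l and is absorbed by induction. -/
theorem mul_mem_normalForms {H : Type*} [Monoid H] {t : ℕ → H} {M : ℕ} (h : CoxeterRel t M) :
    ∀ l ≤ M, ∀ k < l, ∀ x ∈ normalForms t l, t k * x ∈ normalForms t l := by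
  intro l
  induction l with
  | zero => intro _ k hk; omega
  | succ l ih =>
    intro hl k hk x hx
    rw [mem_normalForms_succ] at hx ⊢
    obtain ⟨j, hj, y, hy, rfl⟩ := hx
    rcases lt_trichotomy k j with hkj | hkj | hkj
    · by_cases hkj2 : k + 1 = j
      · subst hkj2
        refine ⟨k, by omega, y, hy, ?_⟩
        rw [← mul_assoc, show l + 1 - k = l + 1 - (k + 1) + 1 by omega, run]
      · refine ⟨j, hj, t k * y, ih (by omega) k (by omega) y hy, ?_⟩
        rw [← mul_assoc, ← mul_assoc, mul_run_comm h _ _ (by omega) (by omega)]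
    · subst hkj
      refine ⟨k + 1, by omega, y, hy, ?_⟩
      rw [show l + 1 - k = l + 1 - (k + 1) + 1 by omega, run, ← mul_assoc, ← mul_assoc,
        h.sq k (by omega), one_mul]
    · obtain ⟨k, rfl⟩ : ∃ k', k = k' + 1 := ⟨k - 1, by omega⟩
      refine ⟨j, hj, t k * y, ih (by omega) k (by omega) y hy, ?_⟩
      rw [← mul_assoc, ← mul_assoc, mul_run_shift h _ _ (by omega) (by omega) (by omega)]

/-- The adjacent transpositions, with indices in `ℕ`. -/
def adjSwap (M k : ℕ) : Equiv.Perm (Fin (M + 1)) :=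
  if h : k < M then Equiv.swap (⟨k, by omega⟩ : Fin (M + 1)) ⟨k + 1, by omega⟩ else 1

theorem adjSwap_lt {M k : ℕ} (h : k < M) :
    adjSwap M k = Equiv.swap (⟨k, by omega⟩ : Fin (M + 1)) ⟨k + 1, by omega⟩ := dif_pos h

theorem adjSwap_rel (M : ℕ) : CoxeterRel (adjSwap M) M where
  sq k hk := by rw [adjSwap_lt hk, Equiv.swap_mul_self]
  braid k hk := by
    rw [adjSwap_lt hk, adjSwap_lt (show k < M by omega)]
    have hab : (⟨k, by omega⟩ : Fin (M + 1)) ≠ ⟨k + 1, by omega⟩ := by simp [Fin.ext_iff]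
    have hac : (⟨k, by omega⟩ : Fin (M + 1)) ≠ ⟨k + 1 + 1, by omega⟩ := by
      simp only [ne_eq, Fin.ext_iff]; omega
    have hbc : (⟨k + 1, by omega⟩ : Fin (M + 1)) ≠ ⟨k + 1 + 1, by omega⟩ := by simp [Fin.ext_iff]
    generalize (⟨k, by omega⟩ : Fin (M + 1)) = a at *
    generalize (⟨k + 1, by omega⟩ : Fin (M + 1)) = b at *
    generalize (⟨k + 1 + 1, by omega⟩ : Fin (M + 1)) = c at *
    rw [Equiv.swap_mul_swap_mul_swap hab hac, Equiv.swap_comm a b, Equiv.swap_comm b c,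
      Equiv.swap_mul_swap_mul_swap hbc.symm hac.symm, Equiv.swap_comm]
  comm k l hkl hl := by
    rw [adjSwap_lt hl, adjSwap_lt (show k < M by omega)]
    refine (Equiv.Perm.disjoint_swap_swap ?_).commute
    simp [Fin.ext_iff]
    omega

theorem closure_adjSwap (M : ℕ) : Submonoid.closure (adjSwap M '' {k | k < M}) = ⊤ := by
  rw [eq_top_iff, ← Equiv.Perm.mclosure_swap_castSucc_succ]
  refine Submonoid.closure_mono ?_
  rintro _ ⟨i, rfl⟩
  exact ⟨i.1, i.2, adjSwap_lt i.2⟩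

/-- The universal property of the symmetric group given by the Coxeter presentation. -/
theorem exists_hom_of_coxeterRel {G : Type*} [Monoid G] {s : ℕ → G} {M : ℕ}
    (h : CoxeterRel s M) :
    ∃ π : Equiv.Perm (Fin (M + 1)) →* G, ∀ k < M, π (adjSwap M k) = s k := by
  classical
  -- The homomorphism is obtained from its graph. The pairs satisfy the Coxeter relations, so the
  -- submonoid they generate has at most (M + 1)! elements; it maps onto the symmetric group, hence
  -- bijectively, and is the graph of the required map.
  let t : ℕ → G × Equiv.Perm (Fin (M + 1)) := fun k => (s k, adjSwap M k)
  have ht : CoxeterRel t M :=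
    { sq := fun k hk => Prod.ext (h.sq k hk) ((adjSwap_rel M).sq k hk)
      braid := fun k hk => Prod.ext (h.braid k hk) ((adjSwap_rel M).braid k hk)
      comm := fun k l hk hl => Prod.ext (h.comm k l hk hl) ((adjSwap_rel M).comm k l hk hl) }
  let C : Submonoid (G × Equiv.Perm (Fin (M + 1))) := Submonoid.closure (t '' {k | k < M})
  have hC : ∀ x ∈ C, x ∈ normalForms t M := by
    intro x hx
    induction hx using Submonoid.closure_induction_left with
    | one => exact one_mem_normalForms t M
    | mul_left x hx y _ ih =>
      obtain ⟨k, hk, rfl⟩ := hx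
      exact mul_mem_normalForms ht M le_rfl k hk y ih
  let p : C →* Equiv.Perm (Fin (M + 1)) := (MonoidHom.snd _ _).comp C.subtype
  have hmap : C.map (MonoidHom.snd G (Equiv.Perm (Fin (M + 1)))) = ⊤ := by
    rw [MonoidHom.map_mclosure, ← closure_adjSwap, Set.image_image]
    rfl
  have hsurj : Surjective p := by
    intro σ
    have : σ ∈ C.map (MonoidHom.snd G (Equiv.Perm (Fin (M + 1)))) := by rw [hmap]; trivial
    obtain ⟨x, hx, rfl⟩ := this
    exact ⟨⟨x, hx⟩, rfl⟩
  have hinj' : Set.InjOn Prod.snd (normalForms t M : Set (G × Equiv.Perm (Fin (M + 1)))) := by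
    refine Finset.injOn_of_surjOn_of_card_le (t := Finset.univ) Prod.snd
      (fun _ _ => Finset.mem_coe.2 (Finset.mem_univ _)) ?_ ?_
    · intro σ _
      obtain ⟨x, rfl⟩ := hsurj σ
      exact ⟨x.1, hC _ x.2, rfl⟩
    · rw [Finset.card_univ, Fintype.card_perm, Fintype.card_fin]
      exact card_normalForms_le t M
  have hinj : Injective p := fun x y hxy => Subtype.ext (hinj' (hC _ x.2) (hC _ y.2) hxy)
  let e : C ≃* Equiv.Perm (Fin (M + 1)) := MulEquiv.ofBijective p ⟨hinj, hsurj⟩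
  refine ⟨((MonoidHom.fst _ _).comp C.subtype).comp e.symm.toMonoidHom, fun k hk => ?_⟩
  have hk : e.symm (adjSwap M k) = ⟨t k, Submonoid.subset_closure ⟨k, hk, rfl⟩⟩ :=
    e.symm_apply_eq.2 rfl
  change (e.symm (adjSwap M k)).1.1 = s k
  rw [hk]

/-- Induction over the permutations by multiplication with adjacent transpositions. -/
theorem perm_induction {m : ℕ} {p : Equiv.Perm (Fin m) → Prop} (one : p 1)
    (mul : ∀ (k : ℕ) (hk : k + 1 < m) (σ : Equiv.Perm (Fin m)), p σ →
      p (Equiv.swap (ix k hk) (ixs k hk) * σ)) (σ : Equiv.Perm (Fin m)) : p σ := by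
  cases m with
  | zero => rwa [Subsingleton.elim σ 1]
  | succ M =>
    have hσ : σ ∈ Submonoid.closure (adjSwap M '' {k | k < M}) := by
      rw [closure_adjSwap]; trivial
    induction hσ using Submonoid.closure_induction_left with
    | one => exact one
    | mul_left x hx y _ ih =>
      obtain ⟨k, hk, rfl⟩ := hx
      rw [adjSwap_lt hk]
      exact mul k (Nat.succ_lt_succ hk) y ih

/-! ### The partial bijections in the abstract algebra -/

theorem gen_rel {m : ℕ} {x y : FreeAlgebra ℂ (Gen m)} (h : Rel m x y) :
    RingQuot.mkAlgHom ℂ (Rel m) x = RingQuot.mkAlgHom ℂ (Rel m) y := RingQuot.mkAlgHom_rel ℂ h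

/-- The generator `s_k` of the abstract algebra. -/
abbrev sA {m : ℕ} (k : ℕ) (hk : k + 1 < m) : Abs m := gen (Gen.s k hk)

/-- The generator `ε_k` of the abstract algebra. -/
abbrev eA {m : ℕ} (k : Fin m) : Abs m := gen (Gen.e k)

/-- The generator `u_k` of the abstract algebra. -/
abbrev uA {m : ℕ} (k : Fin m) : Abs m := gen (Gen.u k)

theorem sA_sq {m : ℕ} (k : ℕ) (hk : k + 1 < m) : sA k hk * sA k hk = 1 := by
  have hr := gen_rel (Rel.s_sq k hk)
  simp only [map_mul, map_one] at hr
  exact hr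

theorem sA_eA {m : ℕ} (k : ℕ) (hk : k + 1 < m) :
    sA k hk * eA (ix k hk) = eA (ixs k hk) * sA k hk := by
  have hr := gen_rel (Rel.s_e k hk)
  simp only [map_mul] at hr
  exact hr

theorem sA_eA' {m : ℕ} (k : ℕ) (hk : k + 1 < m) :
    sA k hk * eA (ixs k hk) = eA (ix k hk) * sA k hk := by
  have h : sA k hk * (sA k hk * eA (ix k hk)) * sA k hk =
      sA k hk * (eA (ixs k hk) * sA k hk) * sA k hk := by rw [sA_eA]
  rw [← mul_assoc, sA_sq, one_mul, mul_assoc, mul_assoc, sA_sq, mul_one] at h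
  exact h.symm

theorem eA_commute {m : ℕ} (k l : Fin m) : Commute (eA k) (eA l) := by
  have hr := gen_rel (Rel.e_comm k l)
  simp only [map_mul] at hr
  exact hr

theorem eA_sq {m : ℕ} (k : Fin m) : eA k * eA k = eA k := by
  have hr := gen_rel (Rel.e_sq k)
  simp only [map_mul] at hr
  exact hr

theorem uA_commute {m : ℕ} (k l : Fin m) : Commute (uA k) (uA l) := by
  have hr := gen_rel (Rel.u_comm k l)
  simp only [map_mul] at hr
  exact hr

theorem eA_mul_uA {m : ℕ} (k : Fin m) : eA k * uA k = 0 := by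
  have hr := gen_rel (Rel.e_u k)
  simp only [map_mul, map_zero] at hr
  exact hr

theorem uA_mul_eA {m : ℕ} (k : Fin m) : uA k * eA k = 0 := by
  have hr := gen_rel (Rel.u_e k)
  simp only [map_mul, map_zero] at hr
  exact hr

theorem eA_uA_commute {m : ℕ} (i k : Fin m) : Commute (eA i) (uA k) := by
  by_cases h : i = k
  · subst h
    exact (eA_mul_uA i).trans (uA_mul_eA i).symm
  · have hr := gen_rel (Rel.e_u_comm i k h)
    simp only [map_mul] at hr
    exact hr

theorem sA_uA {m : ℕ} (k : ℕ) (hk : k + 1 < m) : sA k hk * uA (ix k hk) =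
    uA (ixs k hk) * sA k hk + (1 - eA (ix k hk)) * (1 - eA (ixs k hk)) := by
  have hr := gen_rel (Rel.s_u k hk)
  simp only [map_mul, map_add, map_sub, map_one] at hr
  exact hr

theorem exists_permHom (m : ℕ) : ∃ π : Equiv.Perm (Fin m) →* Abs m,
    ∀ (k : ℕ) (hk : k + 1 < m), π (Equiv.swap (ix k hk) (ixs k hk)) = sA k hk := by
  cases m with
  | zero => exact ⟨1, fun k hk => absurd hk (Nat.not_lt_zero _)⟩
  | succ M =>
    let s : ℕ → Abs (M + 1) := fun k => if hk : k + 1 < M + 1 then sA k hk else 1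
    have hs : ∀ k (hk : k < M), s k = sA k (Nat.succ_lt_succ hk) := fun k hk => dif_pos _
    have h : CoxeterRel s M :=
      { sq := fun k hk => by rw [hs k hk, sA_sq]
        braid := fun k hk => by
          rw [hs k (by omega), hs (k + 1) hk]
          have hr := gen_rel (Rel.braid k (Nat.succ_lt_succ (by omega)) (Nat.succ_lt_succ hk))
          simp only [map_mul] at hr
          exact hr
        comm := fun k l hk hl => by
          rw [hs k (by omega), hs l hl]
          have hr := gen_rel (Rel.s_comm k l (Nat.succ_lt_succ (by omega)) (Nat.succ_lt_succ hl) hk)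
          simp only [map_mul] at hr
          exact hr }
    obtain ⟨π, hπ⟩ := exists_hom_of_coxeterRel h
    refine ⟨π, fun k hk => ?_⟩
    have hk' : k < M := Nat.lt_of_succ_lt_succ hk
    rw [← hs k hk', ← hπ k hk', adjSwap_lt hk']

/-- The homomorphism of the symmetric group to the abstract algebra. -/
def permA (m : ℕ) : Equiv.Perm (Fin m) →* Abs m := (exists_permHom m).choose

theorem permA_swap {m : ℕ} (k : ℕ) (hk : k + 1 < m) :
    permA m (Equiv.swap (ix k hk) (ixs k hk)) = sA k hk := (exists_permHom m).choose_spec k hk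

theorem permA_mul_eA {m : ℕ} (σ : Equiv.Perm (Fin m)) :
    ∀ i, permA m σ * eA i = eA (σ i) * permA m σ := by
  induction σ using perm_induction with
  | one => intro i; simp
  | mul k hk σ ih =>
    intro i
    rw [map_mul, mul_assoc, ih, ← mul_assoc, ← mul_assoc, permA_swap, Equiv.Perm.mul_apply]
    congr 1
    by_cases h1 : σ i = ix k hk
    · rw [h1, Equiv.swap_apply_left, sA_eA]
    by_cases h2 : σ i = ixs k hk
    · rw [h2, Equiv.swap_apply_right, sA_eA']
    rw [Equiv.swap_apply_of_ne_of_ne h1 h2]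
    have hr := gen_rel (Rel.s_e_comm k hk _ h1 h2)
    simp only [map_mul] at hr
    exact hr

/-- The defining relation is given for adjacent points only. Conjugation by a permutation that takes
the first two points to i and j transports it to any pair. -/
theorem permA_swap_mul_eA_mul_eA {m : ℕ} {i j : Fin m} (hij : i ≠ j) :
    permA m (Equiv.swap i j) * (eA i * eA j) = eA i * eA j := by
  have hm : 0 + 1 < m := by
    have := i.2
    have := j.2
    have : i.1 ≠ j.1 := fun h => hij (Fin.ext h)
    omega
  obtain ⟨σ, hσ1, hσ2⟩ : ∃ σ : Equiv.Perm (Fin m), σ (ix 0 hm) = i ∧ σ (ixs 0 hm) = j := by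
    have hne : ix 0 hm ≠ ixs 0 hm := by simp [Fin.ext_iff]
    -- The right factor sends the first point to i; the left one corrects the image of the second
    -- point to j without moving i.
    refine ⟨Equiv.swap (Equiv.swap (ix 0 hm) i (ixs 0 hm)) j * Equiv.swap (ix 0 hm) i, ?_, ?_⟩
    · rw [Equiv.Perm.mul_apply, Equiv.swap_apply_left, Equiv.swap_apply_of_ne_of_ne _ hij]
      intro h
      have := (Equiv.swap (ix 0 hm) i).injective ((Equiv.swap_apply_left (ix 0 hm) i).trans h)
      exact hne this
    · rw [Equiv.Perm.mul_apply, Equiv.swap_apply_left]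
  have h1 : Equiv.swap i j = σ * Equiv.swap (ix 0 hm) (ixs 0 hm) * σ⁻¹ := by
    rw [Equiv.mul_swap_eq_swap_mul, hσ1, hσ2, mul_assoc, mul_inv_cancel, mul_one]
  have h2 : permA m σ⁻¹ * (eA i * eA j) = eA (ix 0 hm) * eA (ixs 0 hm) * permA m σ⁻¹ := by
    rw [← mul_assoc, permA_mul_eA, mul_assoc, permA_mul_eA, ← mul_assoc, Equiv.Perm.inv_eq_iff_eq.2
      hσ1.symm, Equiv.Perm.inv_eq_iff_eq.2 hσ2.symm]
  have h3 : sA 0 hm * (eA (ix 0 hm) * eA (ixs 0 hm)) = eA (ix 0 hm) * eA (ixs 0 hm) := by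
    rw [← mul_assoc]
    have hr := gen_rel (Rel.s_e_e 0 hm)
    simp only [map_mul] at hr
    exact hr
  rw [h1, map_mul, map_mul, mul_assoc, h2, mul_assoc, permA_swap, ← mul_assoc (sA 0 hm), h3,
    ← h2, ← mul_assoc, ← map_mul, mul_inv_cancel, map_one, one_mul]

/-- The product of the `ε_i`, `i ∈ S`. -/
def eSet {m : ℕ} (S : Finset (Fin m)) : Abs m :=
  ((List.finRange m).map fun i => if i ∈ S then eA i else 1).prod

theorem eSet_empty {m : ℕ} : eSet (∅ : Finset (Fin m)) = 1 := by
  unfold eSet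
  refine List.prod_eq_one fun x hx => ?_
  obtain ⟨i, _, rfl⟩ := List.mem_map.1 hx
  simp

theorem eSet_mul_eA {m : ℕ} (S : Finset (Fin m)) (k : Fin m) :
    eSet S * eA k = eSet (insert k S) := by
  unfold eSet
  rw [← list_prod_update (x := k) (fun i => ?_) (List.nodup_finRange m) (List.mem_finRange k)]
  · congr 1
    refine List.map_congr_left fun i _ => ?_
    by_cases h : i = k
    · subst h
      rw [update_self, if_pos (Finset.mem_insert_self _ _)]
      split_ifs
      · exact eA_sq i
      · exact one_mul _
    · rw [update_of_ne h]
      simp [h]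
  · split_ifs
    · exact eA_commute i k
    · exact Commute.one_left _

theorem eA_mul_eSet {m : ℕ} (k : Fin m) (S : Finset (Fin m)) :
    eA k * eSet S = eSet (insert k S) := by
  rw [← eSet_mul_eA]
  refine (Commute.list_prod_left _ _ fun z hz => ?_).eq.symm
  obtain ⟨i, _, rfl⟩ := List.mem_map.1 hz
  split_ifs
  · exact eA_commute i k
  · exact Commute.one_left _

/-- Permutations of S are products of transpositions of points of S. Each is absorbed, because the
idempotent of S can reproduce the two factors ε that absorb it. -/
theorem permA_ofSubtype_mul_eSet {m : ℕ} (S : Finset (Fin m)) (ρ : Equiv.Perm {x // x ∈ S}) :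
    permA m (Equiv.Perm.ofSubtype ρ) * eSet S = eSet S := by
  induction ρ using Equiv.Perm.swap_induction_on with
  | one => rw [map_one, map_one, one_mul]
  | swap_mul ρ x y hxy ih =>
    rw [map_mul, map_mul, mul_assoc, ih, Equiv.Perm.ofSubtype_swap_eq]
    have h : eA x.1 * eA y.1 * eSet S = eSet S := by
      rw [mul_assoc, eA_mul_eSet, Finset.insert_eq_of_mem y.2, eA_mul_eSet,
        Finset.insert_eq_of_mem x.2]
    rw [← h, ← mul_assoc, permA_swap_mul_eA_mul_eA (fun hc => hxy (Subtype.ext hc))]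

theorem permA_mul_eSet {m : ℕ} {S : Finset (Fin m)} {τ : Equiv.Perm (Fin m)}
    (h : ∀ x, x ∉ S → τ x = x) : permA m τ * eSet S = eSet S := by
  have hS : ∀ x, τ x ∈ S ↔ x ∈ S := by
    intro x
    constructor
    · intro hx
      by_contra hc
      rw [h x hc] at hx
      exact hc hx
    · intro hx
      by_contra hc
      have := τ.injective (h _ hc)
      rw [this] at hc
      exact hc hx
  have h1 : Equiv.Perm.ofSubtype (τ.subtypePerm hS) = τ :=
    Equiv.Perm.ofSubtype_subtypePerm hS fun x hx => by
      by_contra hc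
      exact hx (h x hc)
  rw [← h1]
  exact permA_ofSubtype_mul_eSet S _

/-- The element of the abstract algebra given by a partial bijection. -/
def pbA {m : ℕ} (γ : PB m) : Abs m :=
  permA m (exists_perm_extend γ).choose * eSet (Finset.univ.filter fun x => γ x = none)

/-- Two extensions of γ differ by a permutation that fixes the domain pointwise, which the
idempotent of the undefined points absorbs. -/
theorem pbA_eq {m : ℕ} {γ : PB m} {σ : Equiv.Perm (Fin m)} (h : ∀ x y, γ x = some y → σ x = y) :
    pbA γ = permA m σ * eSet (Finset.univ.filter fun x => γ x = none) := by
  set σ₀ := (exists_perm_extend γ).choose with hσ₀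
  have h0 : ∀ x y, γ x = some y → σ₀ x = y := (exists_perm_extend γ).choose_spec
  have h1 := permA_mul_eSet (S := Finset.univ.filter fun x => γ x = none) (τ := σ⁻¹ * σ₀)
    fun x hx => by
      simp only [Finset.mem_filter, Finset.mem_univ, true_and] at hx
      obtain ⟨y, hy⟩ := Option.ne_none_iff_exists'.1 hx
      rw [Equiv.Perm.mul_apply, h0 x y hy, Equiv.Perm.inv_eq_iff_eq, h x y hy]
  rw [pbA, ← hσ₀]
  conv_rhs => rw [← h1, ← mul_assoc, ← map_mul, mul_inv_cancel_left]

theorem pbA_one {m : ℕ} : pbA (1 : PB m) = 1 := by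
  rw [pbA_eq (σ := 1) (by intro x y h; simpa [one_apply] using h)]
  have : (Finset.univ.filter fun x => (1 : PB m) x = none) = ∅ := by simp [one_apply]
  rw [this, eSet_empty, map_one, one_mul]

theorem sA_mul_pbA {m : ℕ} (k : ℕ) (hk : k + 1 < m) (γ : PB m) :
    sA k hk * pbA γ = pbA (swapPB (ix k hk) (ixs k hk) * γ) := by
  obtain ⟨σ, hσ⟩ := exists_perm_extend γ
  rw [pbA_eq hσ, pbA_eq (σ := Equiv.swap (ix k hk) (ixs k hk) * σ), map_mul, permA_swap, mul_assoc]
  · congr 3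
    refine Finset.filter_congr fun x _ => ?_
    rw [mul_apply]
    cases γ x <;> simp [swapPB_apply]
  · intro x y h
    rw [mul_apply, Option.bind_eq_some_iff] at h
    obtain ⟨z, hz, hzy⟩ := h
    rw [swapPB_apply, Option.some.injEq] at hzy
    rw [Equiv.Perm.mul_apply, hσ x z hz, hzy]

/-- Passing ε_k through σ turns it into the idempotent of the preimage of k, which joins the set of
undefined points. -/
theorem eA_mul_pbA {m : ℕ} (k : Fin m) (γ : PB m) : eA k * pbA γ = pbA (epsPB k * γ) := by
  obtain ⟨σ, hσ⟩ := exists_perm_extend γ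
  have hk : eA k * permA m σ = permA m σ * eA (σ⁻¹ k) := by
    rw [permA_mul_eA, show σ (σ⁻¹ k) = k from σ.apply_symm_apply k]
  rw [pbA_eq hσ, pbA_eq (σ := σ), ← mul_assoc, hk, mul_assoc, eA_mul_eSet]
  · congr 2
    ext x
    rw [Finset.mem_insert, Finset.mem_filter, Finset.mem_filter, mul_apply,
      Equiv.Perm.eq_inv_iff_eq]
    cases hx : γ x with
    | none => simp
    | some y =>
      rw [Option.bind_some, epsPB_apply, hσ x y hx]
      simp
  · intro x y h
    rw [mul_apply, Option.bind_eq_some_iff] at h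
    obtain ⟨z, hz, hzy⟩ := h
    rw [epsPB_apply] at hzy
    split_ifs at hzy
    rw [Option.some.injEq] at hzy
    rw [hσ x z hz, hzy]

theorem pbA_mul_eA {m : ℕ} {x : Fin m} {γ : PB m} (hx : γ x = none) : pbA γ * eA x = pbA γ := by
  rw [pbA, mul_assoc, eSet_mul_eA, Finset.insert_eq_of_mem (by simpa using hx)]

/-- Induction over the partial bijections by left multiplication with the generators. -/
theorem pb_induction {m : ℕ} {p : PB m → Prop} (one : p 1)
    (swap_mul : ∀ (k : ℕ) (hk : k + 1 < m) (γ : PB m), p γ →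
      p (swapPB (ix k hk) (ixs k hk) * γ))
    (eps_mul : ∀ (k : Fin m) (γ : PB m), p γ → p (epsPB k * γ)) (γ : PB m) : p γ := by
  classical
  have hS : ∀ S : Finset (Fin m), p (epsSet S) := by
    intro S
    induction S using Finset.induction_on with
    | empty => rwa [epsSet_empty]
    | insert i S _ ih =>
      rw [← epsPB_mul_epsSet]
      exact eps_mul i _ ih
  have hperm : ∀ (σ : Equiv.Perm (Fin m)) (S : Finset (Fin m)), p (permHom m σ * epsSet S) := by
    intro σ S
    induction σ using perm_induction with
    | one => rw [map_one, one_mul]; exact hS S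
    | mul k hk σ ih =>
      rw [map_mul, mul_assoc]
      exact swap_mul k hk _ ih
  obtain ⟨σ, hσ⟩ := exists_perm_extend γ
  rw [eq_perm_mul_epsSet hσ]
  exact hperm σ _

theorem absHom_pbA {m : ℕ} (γ : PB m) : absHom m (pbA γ) = const m (of γ) := by
  induction γ using pb_induction with
  | one => rw [pbA_one, map_one, of_one, map_one]
  | swap_mul k hk γ ih =>
    rw [← sA_mul_pbA, map_mul, ih, of_mul, map_mul, absHom_gen]
    rfl
  | eps_mul k γ ih =>
    rw [← eA_mul_pbA, map_mul, ih, of_mul, map_mul, absHom_gen]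
    rfl

/-! ### A spanning set of the abstract algebra: the monomials in the `u_k` -/

theorem mul_mem_of_mem_span {A : Type*} [Ring A] [Algebra ℂ A] {S : Set A} {W : Submodule ℂ A}
    {g : A} (h : ∀ y ∈ S, g * y ∈ W) {x : A} (hx : x ∈ Submodule.span ℂ S) : g * x ∈ W :=
  (Submodule.span_le.2 h : Submodule.span ℂ S ≤ W.comap (LinearMap.mulLeft ℂ g)) hx

theorem mem_mul_of_mem_span {A : Type*} [Ring A] [Algebra ℂ A] {S : Set A} {W : Submodule ℂ A}
    {g : A} (h : ∀ y ∈ S, y * g ∈ W) {x : A} (hx : x ∈ Submodule.span ℂ S) : x * g ∈ W :=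
  (Submodule.span_le.2 h : Submodule.span ℂ S ≤ W.comap (LinearMap.mulRight ℂ g)) hx

/-- The span of the elements of degree at most one in the `u_k`. -/
def linSpan (m : ℕ) : Submodule ℂ (Abs m) :=
  Submodule.span ℂ (Set.range pbA ∪ Set.range fun p : PB m × Fin m => pbA p.1 * uA p.2)

theorem pbA_mem_linSpan {m : ℕ} (γ : PB m) : pbA γ ∈ linSpan m :=
  Submodule.subset_span (Or.inl ⟨γ, rfl⟩)

theorem pbA_mul_uA_mem_linSpan {m : ℕ} (γ : PB m) (x : Fin m) : pbA γ * uA x ∈ linSpan m :=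
  Submodule.subset_span (Or.inr ⟨(γ, x), rfl⟩)

theorem sA_mul_mem_linSpan {m : ℕ} (k : ℕ) (hk : k + 1 < m) {z : Abs m} (hz : z ∈ linSpan m) :
    sA k hk * z ∈ linSpan m := by
  refine mul_mem_of_mem_span ?_ hz
  rintro _ (⟨γ, rfl⟩ | ⟨p, rfl⟩)
  · rw [sA_mul_pbA]
    exact pbA_mem_linSpan _
  · rw [← mul_assoc, sA_mul_pbA]
    exact pbA_mul_uA_mem_linSpan _ _

theorem eA_mul_mem_linSpan {m : ℕ} (k : Fin m) {z : Abs m} (hz : z ∈ linSpan m) :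
    eA k * z ∈ linSpan m := by
  refine mul_mem_of_mem_span ?_ hz
  rintro _ (⟨γ, rfl⟩ | ⟨p, rfl⟩)
  · rw [eA_mul_pbA]
    exact pbA_mem_linSpan _
  · rw [← mul_assoc, eA_mul_pbA]
    exact pbA_mul_uA_mem_linSpan _ _

theorem one_sub_eA_mul_mem_linSpan {m : ℕ} (k : Fin m) {z : Abs m} (hz : z ∈ linSpan m) :
    (1 - eA k) * z ∈ linSpan m := by
  rw [sub_mul, one_mul]
  exact sub_mem hz (eA_mul_mem_linSpan k hz)

theorem uA_mul_sA {m : ℕ} (k : ℕ) (hk : k + 1 < m) : uA (ix k hk) * sA k hk =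
    sA k hk * uA (ixs k hk) +
      sA k hk * ((1 - eA (ix k hk)) * ((1 - eA (ixs k hk)) * sA k hk)) := by
  have h : sA k hk * (sA k hk * uA (ix k hk)) * sA k hk = sA k hk * (uA (ixs k hk) * sA k hk +
    (1 - eA (ix k hk)) * (1 - eA (ixs k hk))) * sA k hk := by rw [sA_uA]
  rw [← mul_assoc, sA_sq, one_mul, mul_add, add_mul, mul_assoc (sA k hk) (_ * _),
    mul_assoc (uA _), sA_sq, mul_one] at h
  rw [h]
  simp only [mul_assoc]

/-- Moving one u to the right across a partial bijection changes its index and creates corrections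
without u. The degree in the u's never rises, so the normal ordering terminates. -/
theorem uA_mul_pbA_mem_linSpan {m : ℕ} (γ : PB m) : ∀ x, uA x * pbA γ ∈ linSpan m := by
  induction γ using pb_induction with
  | one =>
    intro x
    have h := pbA_mul_uA_mem_linSpan (1 : PB m) x
    rw [pbA_one, one_mul] at h
    rwa [pbA_one, mul_one]
  | swap_mul k hk γ ih =>
    intro x
    rw [← sA_mul_pbA, ← mul_assoc]
    by_cases h1 : x = ix k hk
    · subst h1
      rw [uA_mul_sA, add_mul]
      simp only [mul_assoc]
      exact add_mem (sA_mul_mem_linSpan k hk (ih _)) (sA_mul_mem_linSpan k hk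
        (one_sub_eA_mul_mem_linSpan _ (one_sub_eA_mul_mem_linSpan _
          (sA_mul_mem_linSpan k hk (pbA_mem_linSpan γ)))))
    by_cases h2 : x = ixs k hk
    · subst h2
      rw [eq_sub_of_add_eq (sA_uA k hk).symm, sub_mul, mul_assoc, mul_assoc]
      exact sub_mem (sA_mul_mem_linSpan k hk (ih _))
        (one_sub_eA_mul_mem_linSpan _ (one_sub_eA_mul_mem_linSpan _ (pbA_mem_linSpan γ)))
    have hr := gen_rel (Rel.s_u_comm k hk x h1 h2)
    simp only [map_mul] at hr
    change sA k hk * uA x = uA x * sA k hk at hr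
    rw [← hr, mul_assoc]
    exact sA_mul_mem_linSpan k hk (ih x)
  | eps_mul k γ ih =>
    intro x
    rw [← eA_mul_pbA, ← mul_assoc, ← (eA_uA_commute k x).eq, mul_assoc]
    exact eA_mul_mem_linSpan k (ih x)

/-- The products of the partial bijections and the ordered monomials in the `u_k`. -/
def basisA {m : ℕ} (p : PB m × (Fin m → ℕ)) : Abs m := pbA p.1 * monom uA p.2

theorem mul_uA_mul_monom {m : ℕ} (γ : PB m) (x : Fin m) (r : Fin m → ℕ) :
    pbA γ * uA x * monom uA r = basisA (γ, r + Pi.single x 1) := by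
  rw [basisA, monom_add_single uA_commute, mul_assoc,
    (monom_commute (fun i => uA_commute i x) r).eq]

theorem gen_mul_mem_span_basisA {m : ℕ} (g : Gen m) {z : Abs m}
    (hz : z ∈ Submodule.span ℂ (Set.range (basisA (m := m)))) :
    gen g * z ∈ Submodule.span ℂ (Set.range (basisA (m := m))) := by
  refine mul_mem_of_mem_span ?_ hz
  rintro _ ⟨⟨γ, r⟩, rfl⟩
  rw [basisA, ← mul_assoc]
  cases g with
  | s k hk =>
    rw [sA_mul_pbA]
    exact Submodule.subset_span ⟨(_, r), rfl⟩
  | e k =>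
    rw [eA_mul_pbA]
    exact Submodule.subset_span ⟨(_, r), rfl⟩
  | u k =>
    refine mem_mul_of_mem_span ?_ (uA_mul_pbA_mem_linSpan γ k)
    rintro _ (⟨γ', rfl⟩ | ⟨p, rfl⟩)
    · exact Submodule.subset_span ⟨(γ', r), rfl⟩
    · exact Submodule.subset_span ⟨_, (mul_uA_mul_monom p.1 p.2 r).symm⟩

/-- The span is stable under left multiplication by the generators and contains 1. -/
theorem span_basisA (m : ℕ) : Submodule.span ℂ (Set.range (basisA (m := m))) = ⊤ := by
  have h : ∀ (f : FreeAlgebra ℂ (Gen m)) (z : Abs m),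
      z ∈ Submodule.span ℂ (Set.range (basisA (m := m))) →
      RingQuot.mkAlgHom ℂ (Rel m) f * z ∈ Submodule.span ℂ (Set.range (basisA (m := m))) := by
    intro f
    induction f using FreeAlgebra.induction with
    | grade0 c =>
      intro z hz
      rw [AlgHom.commutes, ← Algebra.smul_def]
      exact Submodule.smul_mem _ _ hz
    | grade1 g => exact fun z hz => gen_mul_mem_span_basisA g hz
    | mul a b ha hb =>
      intro z hz
      rw [map_mul, mul_assoc]
      exact ha _ (hb _ hz)
    | add a b ha hb =>
      intro z hz
      rw [map_add, add_mul]
      exact add_mem (ha _ hz) (hb _ hz)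
  rw [eq_top_iff]
  rintro z -
  obtain ⟨f, rfl⟩ := RingQuot.mkAlgHom_surjective ℂ (Rel m) z
  have h1 : (1 : Abs m) ∈ Submodule.span ℂ (Set.range (basisA (m := m))) :=
    Submodule.subset_span ⟨(1, 0), by rw [basisA, pbA_one, monom_zero, one_mul]⟩
  have h2 := h f 1 h1
  rwa [mul_one] at h2

/-- If γ is undefined at x, then γ = γ ε_x; this idempotent travels through the monomial to a factor
u_x and annihilates it. -/
theorem basisA_eq_zero {m : ℕ} {p : PB m × (Fin m → ℕ)} {x : Fin m} (hr : p.2 x ≠ 0)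
    (hx : p.1 x = none) : basisA p = 0 := by
  obtain ⟨r', hr'⟩ := exists_eq_add_single hr
  rw [basisA, hr', ← pbA_mul_eA hx, monom_add_single uA_commute, mul_assoc, ← mul_assoc (eA x),
    ← (monom_commute (fun i => (eA_uA_commute x i).symm) r').eq, mul_assoc, eA_mul_uA, mul_zero,
    mul_zero]

/-! ### The isomorphisms -/

/-- The components of an element of A_0 are central in A(n), as the stabilizer of no points is all
of Γ(n). -/
theorem fromA0_commute {m : ℕ} (a : Alim 0) (b : Alim m) : Commute (fromA0 m a) b := by
  refine lim_ext fun n hn => ?_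
  change a.1 ⟨n, Nat.zero_le n⟩ * b.1 ⟨n, hn⟩ = b.1 ⟨n, hn⟩ * a.1 ⟨n, Nat.zero_le n⟩
  have ha := mem_cent.1 (a.2.1 ⟨n, Nat.zero_le n⟩)
  generalize b.1 ⟨n, hn⟩ = y
  induction y using MonoidAlgebra.induction_on with
  | of γ => exact (ha γ fun i hi => absurd hi (Nat.not_lt_zero _)).symm
  | add p q hp hq => rw [mul_add, add_mul, hp, hq]
  | smul r p hp => rw [mul_smul_comm, smul_mul_assoc, hp]

open scoped TensorProduct

/-- The homomorphism `a ⊗ h ↦ a h` from the tensor product with the abstract algebra. -/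
def tensorHom (m : ℕ) : Alim 0 ⊗[ℂ] Abs m →ₐ[ℂ] Alim m :=
  Algebra.TensorProduct.lift (fromA0 m) (absHom m) fun a _ => fromA0_commute a _

theorem tensorHom_tmul {m : ℕ} (a : Alim 0) (b : Abs m) :
    tensorHom m (a ⊗ₜ b) = fromA0 m a * absHom m b := Algebra.TensorProduct.lift_tmul _ _ _ _ _

theorem const_mem_range_absHom {m : ℕ} (z : Alg m) : const m z ∈ (absHom m).range := by
  induction z using MonoidAlgebra.induction_on with
  | of γ => exact ⟨pbA γ, absHom_pbA γ⟩
  | add p q hp hq => rw [map_add]; exact add_mem hp hq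
  | smul r p hp => rw [map_smul]; exact Subalgebra.smul_mem _ hp r

theorem uLim_mem_range_absHom {m : ℕ} (k : Fin m) : uLim k ∈ (absHom m).range :=
  ⟨uA k, absHom_gen _⟩

theorem tensorHom_surjective (m : ℕ) : Surjective (tensorHom m) := by
  have hle : (absHom m).range ≤ (tensorHom m).range := by
    rintro _ ⟨b, rfl⟩
    refine ⟨1 ⊗ₜ b, ?_⟩
    change tensorHom m _ = absHom m b
    rw [tensorHom_tmul, map_one, one_mul]
  rw [← AlgHom.range_eq_top]
  refine eq_top_of_generators _ (fun a => ⟨a ⊗ₜ 1, ?_⟩)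
    (fun z => hle (const_mem_range_absHom z)) (fun k => hle (uLim_mem_range_absHom k))
  change tensorHom m _ = _
  rw [tensorHom_tmul, map_one, mul_one]

theorem exists_tensor_eq_sum {m : ℕ} (t : Alim 0 ⊗[ℂ] Abs m) :
    ∃ c : PB m × (Fin m → ℕ) →₀ Alim 0, t = c.sum fun p a => a ⊗ₜ[ℂ] basisA p := by
  induction t using TensorProduct.induction_on with
  | zero => exact ⟨0, by simp⟩
  | add x y hx hy =>
    obtain ⟨c, rfl⟩ := hx
    obtain ⟨d, rfl⟩ := hy
    exact ⟨c + d, (Finsupp.sum_add_index' (h := fun p a => a ⊗ₜ[ℂ] basisA p)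
      (fun _ => TensorProduct.zero_tmul _ _) (fun _ _ _ => TensorProduct.add_tmul _ _ _)).symm⟩
  | tmul a b =>
    have hb : b ∈ Submodule.span ℂ (Set.range (basisA (m := m))) := by
      rw [span_basisA]; trivial
    obtain ⟨c, rfl⟩ := Finsupp.mem_span_range_iff_exists_finsupp.1 hb
    refine ⟨c.mapRange (fun z => z • a) (zero_smul _ _), ?_⟩
    rw [Finsupp.sum_mapRange_index (h := fun p a => a ⊗ₜ[ℂ] basisA p)
      (fun _ => TensorProduct.zero_tmul _ _), Finsupp.sum,
      Finsupp.sum, TensorProduct.tmul_sum]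
    refine Finset.sum_congr rfl fun p _ => ?_
    rw [TensorProduct.tmul_smul, TensorProduct.smul_tmul']

theorem tensorHom_injective (m : ℕ) : Injective (tensorHom m) := by
  classical
  rw [injective_iff_map_eq_zero]
  intro t ht
  obtain ⟨c, rfl⟩ := exists_tensor_eq_sum t
  let P : PB m × (Fin m → ℕ) → Prop := fun p => ∀ x, p.2 x ≠ 0 → (p.1 x).isSome
  -- Coefficients at the pairs where `basisA` vanishes are irrelevant. Setting them to zero gives
  -- the support condition required by `coeff_eq_zero`.
  let d : (Fin m → ℕ) → PB m → Alim 0 := fun r γ => if P (γ, r) then c (γ, r) else 0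
  let s : Finset (Fin m → ℕ) := c.support.image Prod.snd
  have hd : ∀ p, c p ⊗ₜ[ℂ] basisA p = d p.2 p.1 ⊗ₜ[ℂ] basisA p := by
    intro p
    by_cases hp : P p
    · simp only [d]
      rw [if_pos hp]
    · have hz : basisA p = 0 := by
        simp only [P] at hp
        push Not at hp
        obtain ⟨x, hx, hx2⟩ := hp
        exact basisA_eq_zero hx (by simpa using hx2)
      rw [hz, TensorProduct.tmul_zero, TensorProduct.tmul_zero]
  have hsum : (c.sum fun p a => a ⊗ₜ[ℂ] basisA p) =
      ∑ r ∈ s, ∑ γ, d r γ ⊗ₜ[ℂ] basisA (γ, r) := by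
    rw [← Finset.sum_product_right (Finset.univ) s
      (fun p => d p.2 p.1 ⊗ₜ[ℂ] basisA p), Finsupp.sum]
    simp only [← hd]
    refine Finset.sum_subset (fun p hp => ?_) fun p _ hp => ?_
    · exact Finset.mem_product.2 ⟨Finset.mem_univ _, Finset.mem_image_of_mem _ hp⟩
    · rw [Finsupp.notMem_support_iff.1 hp, TensorProduct.zero_tmul]
  rw [hsum] at ht ⊢
  have h0 := coeff_eq_zero s d (fun r γ h => ?_) ?_
  · refine Finset.sum_eq_zero fun r hr => Finset.sum_eq_zero fun γ _ => ?_
    rw [h0 r hr γ, TensorProduct.zero_tmul]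
  · by_contra hc
    exact h (if_neg hc)
  · rw [← ht, map_sum]
    refine Finset.sum_congr rfl fun r _ => ?_
    rw [map_sum, Finset.sum_mul]
    refine Finset.sum_congr rfl fun γ _ => ?_
    have hu : (fun i => absHom m (uA i)) = uLim := funext fun i => absHom_gen _
    rw [tensorHom_tmul, basisA, map_mul, absHom_pbA, map_monom, hu, mul_assoc]

/-- Over a field b ↦ 1 ⊗ b is injective because ℂ → A_0 is, so injectivity passes from the tensor
product to its second factor. -/
theorem absHom_injective (m : ℕ) : Injective (absHom m) := by
  have h : Injective (Algebra.TensorProduct.includeRight : Abs m →ₐ[ℂ] Alim 0 ⊗[ℂ] Abs m) :=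
    Algebra.TensorProduct.includeRight_injective (FaithfulSMul.algebraMap_injective ℂ (Alim 0))
  have h2 := (tensorHom_injective m).comp h
  intro x y hxy
  refine h2 ?_
  change tensorHom m (1 ⊗ₜ x) = tensorHom m (1 ⊗ₜ y)
  rw [tensorHom_tmul, tensorHom_tmul, hxy]

theorem range_absHom (m : ℕ) : (absHom m).range = Htilde m := by
  refine le_antisymm ?_ (Algebra.adjoin_le ?_)
  · rintro _ ⟨b, rfl⟩
    obtain ⟨f, rfl⟩ := RingQuot.mkAlgHom_surjective ℂ (Rel m) b
    change absHom m _ ∈ _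
    induction f using FreeAlgebra.induction with
    | grade0 c =>
      rw [AlgHom.commutes, AlgHom.commutes]
      exact Subalgebra.algebraMap_mem _ c
    | grade1 g =>
      have hg : absHom m (gen g) ∈ Htilde m := by
        rw [absHom_gen]
        cases g with
        | s k hk => exact Algebra.subset_adjoin (Or.inl ⟨_, rfl⟩)
        | e k => exact Algebra.subset_adjoin (Or.inl ⟨_, rfl⟩)
        | u k => exact Algebra.subset_adjoin (Or.inr ⟨_, rfl⟩)
      exact hg
    | mul a b ha hb => rw [map_mul, map_mul]; exact mul_mem ha hb
    | add a b ha hb => rw [map_add, map_add]; exact add_mem ha hb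
  · rintro _ (⟨z, rfl⟩ | ⟨k, rfl⟩)
    · exact const_mem_range_absHom z
    · exact uLim_mem_range_absHom k

/-- The isomorphism of the abstract algebra with the subalgebra of `A_m`. -/
def absEquiv (m : ℕ) : Abs m ≃ₐ[ℂ] Htilde m :=
  (AlgEquiv.ofInjective (absHom m) (absHom_injective m)).trans
    (Subalgebra.equivOfEq _ _ (range_absHom m))

theorem absEquiv_apply {m : ℕ} (b : Abs m) : (absEquiv m b : Alim m) = absHom m b := rfl

/-- The isomorphism `a ⊗ h ↦ a h`. -/
def tensorEquiv (m : ℕ) : Alim 0 ⊗[ℂ] Htilde m ≃ₐ[ℂ] Alim m :=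
  (Algebra.TensorProduct.congr AlgEquiv.refl (absEquiv m).symm).trans
    (AlgEquiv.ofBijective (tensorHom m) ⟨tensorHom_injective m, tensorHom_surjective m⟩)

theorem tensorEquiv_tmul {m : ℕ} (a : Alim 0) (h : Htilde m) :
    tensorEquiv m (a ⊗ₜ h) = fromA0 m a * (h : Alim m) := by
  change tensorHom m (a ⊗ₜ (absEquiv m).symm h) = _
  rw [tensorHom_tmul, ← absEquiv_apply, AlgEquiv.apply_symm_apply]

theorem absEquiv_gen {m : ℕ} (g : Gen m) : (absEquiv m (gen g) : Alim m) = genLim g :=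
  absHom_gen g

end PartialBij

end

open scoped TensorProduct in
theorem theorem5p18 (m : ℕ) :
    (∃ F : (PartialBij.Alim 0 ⊗[ℂ] PartialBij.Htilde m) ≃ₐ[ℂ] PartialBij.Alim m,
      ∀ (a : PartialBij.Alim 0) (h : PartialBij.Htilde m),
        F (a ⊗ₜ[ℂ] h) = PartialBij.fromA0 m a * (h : PartialBij.Alim m)) ∧
    (∃ G : PartialBij.Abs m ≃ₐ[ℂ] PartialBij.Htilde m,
      (∀ (k : ℕ) (hk : k + 1 < m),
        (G (PartialBij.gen (PartialBij.Gen.s k hk)) : PartialBij.Alim m) =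
          PartialBij.const m
            (PartialBij.swapEl (PartialBij.ix k hk) (PartialBij.ixs k hk))) ∧
      (∀ k : Fin m,
        (G (PartialBij.gen (PartialBij.Gen.e k)) : PartialBij.Alim m) =
          PartialBij.const m (PartialBij.eps k)) ∧
      (∀ k : Fin m,
        (G (PartialBij.gen (PartialBij.Gen.u k)) : PartialBij.Alim m) =
          PartialBij.uLim k)) :=
  ⟨⟨PartialBij.tensorEquiv m, PartialBij.tensorEquiv_tmul⟩, PartialBij.absEquiv m,
    fun _ _ => PartialBij.absEquiv_gen _, fun _ => PartialBij.absEquiv_gen _,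
    fun _ => PartialBij.absEquiv_gen _⟩
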